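/- Let $m,a,l,\Lambda\in\mathbb R$ and let $g$ be the four-dimensional Kerr-NUT-(Anti)-de Sitter metric in coordinates $(t,r,\theta,\phi)$, $$g=-\frac{Q}{R^2}\Big[dt-\big(a\sin^2\theta+4l\sin^2\tfrac{\theta}{2}\big)d\phi\Big]^2+\frac{P}{R^2}\Big[a\,dt-\big(r^2+(a+l)^2\big)d\phi\Big]^2+\frac{R^2}{Q}dr^2+\frac{R^2}{P}\sin^2\theta\,d\theta^2,$$ $$R^2=r^2+(l+a\cos\theta)^2,\qquad P=\sin^2\theta\,\big(1+(3l+a\cos\theta)(l+a\cos\theta)\Lambda/3\big),$$ $$Q=(a^2-l^2)-2mr+r^2-\Lambda\big[(3l^2+a^2)r^2+r^4\big]/3 .$$ Let $\Omega$ be an open set of coordinate points with $0<\theta<\pi$, $R^2>0$, $P>0$, $Q\neq0$, let $U$ be any smooth real function of $(t,r,\theta,\phi)$ on $\Omega$, and let $\hat g=e^{2U}g$ on $\Omega$. For a metric with Weyl tensor $C_{abcd}$ and Hodge dual $C^*_{abcd}=\frac12\varepsilon_{abef}C^{ef}{}_{cd}$ put $I_1=C_{abcd}C^{abcd}$, $I_2=C^*_{abcd}C^{abcd}$,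 $I_3=C_{abcd;e}C^{abcd;e}$, $I_{3a}=C_{abcd;e}C^{ebcd;a}$, $I_4=C^*_{abcd;e}C^{abcd;e}$, $I_{4a}=C^*_{abcd;e}C^{ebcd;a}$, $I_5=I_{1;e}I_1{}^{;e}$, $I_6=I_{2;e}I_2{}^{;e}$, and $$J_4=6I_1I_3-16I_1I_{3a}+I_5,\qquad K_4=6I_2I_4-16I_2I_{4a}+I_6,$$ $$J_+=-\frac{J_4}{2^8\,3^3},\qquad J_-=\frac{K_4}{2^8\,3^3},\qquad J_{\rm ergo}=J_++J_- .$$ Further put $$\Psi_2=-\frac{m+iL}{\big(r+i(l+a\cos\theta)\big)^3},\quad L=l\Big(1+\tfrac13(a^2-l^2)\Lambda\Big),$$ $$\rho=\frac{\sqrt Q\,[r-i(a\cos\theta+l)]}{\sqrt2\,R^3},\qquad \tau=\frac{a\sqrt P\,[r-i(a\cos\theta+l)]}{\sqrt2\,R^3}$$ (with $\sqrt Q$ the complex square root where $Q<0$). Then: 1. Where $Q>0$, consider the covectors $\ell=(t^0-t^1)/\sqrt2$, $n=(t^0+t^1)/\sqrt2$, $\mathsf m=(t^2-it^3)/\sqrt2$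 with $t^0=\frac{\sqrt Q}{R}[dt-(a\sin^2\theta+4l\sin^2\frac\theta2)d\phi]$, $t^1=\frac{R}{\sqrt Q}dr$, $t^2=\frac{\sqrt P}{R}[a\,dt-(r^2+(a+l)^2)d\phi]$, $t^3=\frac{R}{\sqrt P}\sin\theta\,d\theta$. They form a null tetrad $(\ell,n,\mathsf m,\bar{\mathsf m})$ of $g$, and $\Psi_2,\rho,\tau$ are its Newman-Penrose scalars $\Psi_2=C_{abcd}\ell^a\mathsf m^b\bar{\mathsf m}^cn^d$, $\rho=-\ell_{a;b}\mathsf m^a\bar{\mathsf m}^b$, $\tau=-\ell_{a;b}\mathsf m^an^b$. 2. On $\Omega$, $$J_{\rm ergo}(\hat g)=e^{-10U}J_{\rm ergo}(g)=-4\,e^{-10U}\,\mathrm{Re}\big[\Psi_2^4(\rho^2-\tau^2)\big].$$ 3. $\partial_t$ is a Killing vector field of $g$ and a conformal Killing vector field of $\hat g$. The conformal stationary limit surface $\{x\in\Omega:\hat g(\partial_t,\partial_t)=0\}$ coincides with the stationary limit surface $\{x\in\Omega:g(\partial_t,\partial_t)=0\}$ of $g$, and $J_{\rm ergo}(\hat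 g)$ vanishes on it. -/

import Mathlib

open scoped ContDiff

noncomputable section

namespace ConformalBH

/-! ### Tensor calculus of a four-dimensional metric in a coordinate chart -/

/-- Points of a four-dimensional coordinate chart. -/
abbrev Coords : Type := Fin 4 → ℝ

/-- The components `g_{ab}` of a metric as functions of the coordinates. -/
abbrev MetricField : Type := Coords → Matrix (Fin 4) (Fin 4) ℝ

/-- The components `T_{abcd}` of a covariant tensor field of rank four. -/
abbrev Tensor4 : Type := Coords → Fin 4 → Fin 4 → Fin 4 → Fin 4 → ℝ

/-- The components of a covariant tensor field of rank five; for a covariant derivative the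
last index is the derivative index, `T_{abcd;e}`. -/
abbrev Tensor5 : Type := Coords → Fin 4 → Fin 4 → Fin 4 → Fin 4 → Fin 4 → ℝ

/-- The partial derivative `∂_i f`. -/
def pd {F : Type*} [NormedAddCommGroup F] [NormedSpace ℝ F] (i : Fin 4) (f : Coords → F)
    (x : Coords) : F :=
  fderiv ℝ f x (Pi.single i 1)

/-- The inverse metric `g^{ab}`. -/
def invMetric (g : MetricField) (x : Coords) (a b : Fin 4) : ℝ := (g x)⁻¹ a b

/-- Christoffel symbols `Γ^a_{bc}` of the Levi-Civita connection. -/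
def christoffel (g : MetricField) (x : Coords) (a b c : Fin 4) : ℝ :=
  (1 / 2) * ∑ d, invMetric g x a d *
    (pd b (fun y => g y d c) x + pd c (fun y => g y d b) x - pd d (fun y => g y b c) x)

/-- The Riemann tensor
`R^a_{bcd} = ∂_c Γ^a_{db} - ∂_d Γ^a_{cb} + Γ^a_{ce} Γ^e_{db} - Γ^a_{de} Γ^e_{cb}`. -/
def riemannUp (g : MetricField) (x : Coords) (a b c d : Fin 4) : ℝ :=
  pd c (fun y => christoffel g y a d b) x - pd d (fun y => christoffel g y a c b) x
    + ∑ e, (christoffel g x a c e * christoffel g x e d b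
          - christoffel g x a d e * christoffel g x e c b)

/-- `R_{abcd}`. -/
def riemann (g : MetricField) : Tensor4 := fun x a b c d =>
  ∑ e, g x a e * riemannUp g x e b c d

/-- The Ricci tensor `R_{bd} = R^a_{bad}`. -/
def ricci (g : MetricField) (x : Coords) (b d : Fin 4) : ℝ := ∑ a, riemannUp g x a b a d

/-- The scalar curvature. -/
def scalarCurv (g : MetricField) (x : Coords) : ℝ := ∑ a, ∑ b, invMetric g x a b * ricci g x a b

/-- The Weyl tensor `C_{abcd}` in dimension four. -/
def weyl (g : MetricField) : Tensor4 := fun x a b c d =>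
  riemann g x a b c d
    - (1 / 2) * (g x a c * ricci g x b d - g x a d * ricci g x b c
        - g x b c * ricci g x a d + g x b d * ricci g x a c)
    + (scalarCurv g x / 6) * (g x a c * g x b d - g x a d * g x b c)

/-- The Levi-Civita permutation symbol `[abcd]`, with `[0123] = 1`: the determinant of the
matrix whose rows are the standard basis vectors with numbers `a, b, c, d`. -/
def permSymbol (a b c d : Fin 4) : ℝ :=
  (Matrix.of fun i j : Fin 4 => if ![a, b, c, d] i = j then (1 : ℝ) else 0).det

/-- The volume form `ε_{abcd} = √|det g| [abcd]`. -/
def volForm (g : MetricField) : Tensor4 := fun x a b c d =>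
  Real.sqrt |(g x).det| * permSymbol a b c d

/-- The Hodge dual `C*_{abcd} = ½ ε_{abef} C^{ef}_{cd}` of the Weyl tensor. -/
def weylDual (g : MetricField) : Tensor4 := fun x a b c d =>
  (1 / 2) * ∑ e, ∑ f, volForm g x a b e f *
    ∑ e', ∑ f', invMetric g x e e' * invMetric g x f f' * weyl g x e' f' c d

/-- The covariant derivative `T_{abcd;e}` of a covariant tensor field of rank four. -/
def covDeriv4 (g : MetricField) (T : Tensor4) : Tensor5 := fun x a b c d e =>
  pd e (fun y => T y a b c d) x
    - ∑ f, (christoffel g x f e a * T x f b c d + christoffel g x f e b * T x a f c d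
          + christoffel g x f e c * T x a b f d + christoffel g x f e d * T x a b c f)

/-- `T^{abcd}`. -/
def raise4 (g : MetricField) (T : Tensor4) : Tensor4 := fun x a b c d =>
  ∑ a', ∑ b', ∑ c', ∑ d', invMetric g x a a' * invMetric g x b b' * invMetric g x c c'
    * invMetric g x d d' * T x a' b' c' d'

/-- `T^{abcde}`. -/
def raise5 (g : MetricField) (T : Tensor5) : Tensor5 := fun x a b c d e =>
  ∑ a', ∑ b', ∑ c', ∑ d', ∑ e', invMetric g x a a' * invMetric g x b b' * invMetric g x c c'
    * invMetric g x d d' * invMetric g x e e' * T x a' b' c' d' e'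

/-- The full contraction `S_{abcd} T^{abcd}`. -/
def contract4 (g : MetricField) (S T : Tensor4) (x : Coords) : ℝ :=
  ∑ a, ∑ b, ∑ c, ∑ d, S x a b c d * raise4 g T x a b c d

/-- The full contraction `S_{abcd;e} T^{abcd;e}`. -/
def contract5 (g : MetricField) (S T : Tensor5) (x : Coords) : ℝ :=
  ∑ a, ∑ b, ∑ c, ∑ d, ∑ e, S x a b c d e * raise5 g T x a b c d e

/-- The full contraction `S_{abcd;e} T^{ebcd;a}`. -/
def contract5swap (g : MetricField) (S T : Tensor5) (x : Coords) : ℝ :=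
  ∑ a, ∑ b, ∑ c, ∑ d, ∑ e, S x a b c d e * raise5 g T x e b c d a

/-- `f_{;e} f^{;e}`. -/
def gradSq (g : MetricField) (f : Coords → ℝ) (x : Coords) : ℝ :=
  ∑ a, ∑ b, invMetric g x a b * pd a f x * pd b f x

/-! ### Scalar polynomial curvature invariants -/

/-- `I₁ = C_{abcd} C^{abcd}`. -/
def I1 (g : MetricField) : Coords → ℝ := contract4 g (weyl g) (weyl g)

/-- `I₂ = C*_{abcd} C^{abcd}`. -/
def I2 (g : MetricField) : Coords → ℝ := contract4 g (weylDual g) (weyl g)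

/-- `I₃ = C_{abcd;e} C^{abcd;e}`. -/
def I3 (g : MetricField) : Coords → ℝ :=
  contract5 g (covDeriv4 g (weyl g)) (covDeriv4 g (weyl g))

/-- `I₃ₐ = C_{abcd;e} C^{ebcd;a}`. -/
def I3a (g : MetricField) : Coords → ℝ :=
  contract5swap g (covDeriv4 g (weyl g)) (covDeriv4 g (weyl g))

/-- `I₄ = C*_{abcd;e} C^{abcd;e}`. -/
def I4 (g : MetricField) : Coords → ℝ :=
  contract5 g (covDeriv4 g (weylDual g)) (covDeriv4 g (weyl g))

/-- `I₄ₐ = C*_{abcd;e} C^{ebcd;a}`. -/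
def I4a (g : MetricField) : Coords → ℝ :=
  contract5swap g (covDeriv4 g (weylDual g)) (covDeriv4 g (weyl g))

/-- `I₅ = I_{1;e} I₁^{;e}`. -/
def I5 (g : MetricField) : Coords → ℝ := gradSq g (I1 g)

/-- `I₆ = I_{2;e} I₂^{;e}`. -/
def I6 (g : MetricField) : Coords → ℝ := gradSq g (I2 g)

/-- `J₄ = 6 I₁ I₃ - 16 I₁ I₃ₐ + I₅`. -/
def J4 (g : MetricField) (x : Coords) : ℝ :=
  6 * I1 g x * I3 g x - 16 * I1 g x * I3a g x + I5 g x

/-- `K₄ = 6 I₂ I₄ - 16 I₂ I₄ₐ + I₆`. -/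
def K4 (g : MetricField) (x : Coords) : ℝ :=
  6 * I2 g x * I4 g x - 16 * I2 g x * I4a g x + I6 g x

/-- `J₊`, the invariant `J₄` in the normalization in which
`J₊ = -[2 Re(Ψ₂⁴(ρ² - τ²)) - 10 |Ψ₂|⁴ Re(ρ² - τ²) + 12 |Ψ₂|⁴ (|ρ|² + |τ|²)]`
for the Kerr-NUT-(Anti)-de Sitter metric. -/
def Jplus (g : MetricField) (x : Coords) : ℝ := -(J4 g x) / 6912

/-- `J₋`, the invariant `K₄` in the normalization in which
`J₋ = -[2 Re(Ψ₂⁴(ρ² - τ²)) + 10 |Ψ₂|⁴ Re(ρ² - τ²) - 12 |Ψ₂|⁴ (|ρ|² + |τ|²)]`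
for the Kerr-NUT-(Anti)-de Sitter metric. -/
def Jminus (g : MetricField) (x : Coords) : ℝ := K4 g x / 6912

/-- `J_ergo = J₊ + J₋`. -/
def Jergo (g : MetricField) (x : Coords) : ℝ := Jplus g x + Jminus g x

/-! ### The Newman-Penrose scalars used below, for signature `(-,+,+,+)` -/

/-- A complex covector field. -/
abbrev CCovector : Type := Coords → Fin 4 → ℂ

/-- The complex-bilinear inner product `g^{ab} α_a β_b`. -/
def cinner (g : MetricField) (α β : CCovector) (x : Coords) : ℂ :=
  ∑ a, ∑ b, (invMetric g x a b : ℂ) * α x a * β x b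

/-- `α^a`. -/
def sharp (g : MetricField) (α : CCovector) (x : Coords) (a : Fin 4) : ℂ :=
  ∑ b, (invMetric g x a b : ℂ) * α x b

/-- The complex conjugate covector field. -/
def conjCov (α : CCovector) : CCovector := fun x a => (starRingEnd ℂ) (α x a)

/-- The covariant derivative `α_{a;b}`. -/
def covDeriv1 (g : MetricField) (α : CCovector) (x : Coords) (a b : Fin 4) : ℂ :=
  pd b (fun y => α y a) x - ∑ c, (christoffel g x c b a : ℂ) * α x c

/-- `(ℓ, n, m, m̄)` is a null tetrad of `g` at `x`: `ℓ`, `n` are real, `ℓ·n = -1`, `m·m̄ = 1`, and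
all the other inner products vanish. -/
def IsNullTetradAt (g : MetricField) (ℓ n m : CCovector) (x : Coords) : Prop :=
  conjCov ℓ x = ℓ x ∧ conjCov n x = n x ∧
  cinner g ℓ ℓ x = 0 ∧ cinner g n n x = 0 ∧ cinner g m m x = 0 ∧
  cinner g ℓ n x = -1 ∧ cinner g m (conjCov m) x = 1 ∧
  cinner g ℓ m x = 0 ∧ cinner g n m x = 0

/-- `Ψ₂ = C_{abcd} ℓ^a m^b m̄^c n^d`. -/
def npPsi2 (g : MetricField) (ℓ n m : CCovector) (x : Coords) : ℂ :=
  ∑ a, ∑ b, ∑ c, ∑ d, (weyl g x a b c d : ℂ) * sharp g ℓ x a * sharp g m x b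
    * sharp g (conjCov m) x c * sharp g n x d

/-- The spin coefficient `ρ = -ℓ_{a;b} m^a m̄^b`. -/
def npRho (g : MetricField) (ℓ m : CCovector) (x : Coords) : ℂ :=
  -∑ a, ∑ b, covDeriv1 g ℓ x a b * sharp g m x a * sharp g (conjCov m) x b

/-- The spin coefficient `τ = -ℓ_{a;b} m^a n^b`. -/
def npTau (g : MetricField) (ℓ n m : CCovector) (x : Coords) : ℂ :=
  -∑ a, ∑ b, covDeriv1 g ℓ x a b * sharp g m x a * sharp g n x b

/-! ### Killing fields and stationary limit surfaces -/

/-- The Lie derivative `(L_ξ g)_{ab}`. -/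
def lieMetric (g : MetricField) (ξ : Coords → Fin 4 → ℝ) (x : Coords) (a b : Fin 4) : ℝ :=
  ∑ c, (ξ x c * pd c (fun y => g y a b) x + g x c b * pd a (fun y => ξ y c) x
    + g x a c * pd b (fun y => ξ y c) x)

/-- `ξ` is a Killing vector field of `g` on `Ω`. -/
def IsKillingOn (g : MetricField) (ξ : Coords → Fin 4 → ℝ) (Ω : Set Coords) : Prop :=
  ∀ x ∈ Ω, ∀ a b, lieMetric g ξ x a b = 0

/-- `ξ` is a conformal Killing vector field of `g` on `Ω`. -/
def IsConformalKillingOn (g : MetricField) (ξ : Coords → Fin 4 → ℝ) (Ω : Set Coords) : Prop :=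
  ∃ f : Coords → ℝ, ∀ x ∈ Ω, ∀ a b, lieMetric g ξ x a b = f x * g x a b

/-- The points of `Ω` at which the vector field `ξ` is null for `g`. For a stationary metric `g`
with stationary Killing field `ξ` this is the stationary limit surface; for a metric conformal to
it, with `ξ` as a conformal Killing field, this is the conformal stationary limit surface. -/
def limitSurface (g : MetricField) (ξ : Coords → Fin 4 → ℝ) (Ω : Set Coords) : Set Coords :=
  {x ∈ Ω | ∑ a, ∑ b, g x a b * ξ x a * ξ x b = 0}

/-! ### The Kerr-NUT-(Anti)-de Sitter metric

The coordinates `x 0, x 1, x 2, x 3` are `t, r, θ, φ`. The parameters are the mass `m`, the rotation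
parameter `a`, the NUT parameter `l` and the cosmological constant `Λ`. -/

/-- The parameters of the metric. -/
structure Params where
  (m a l Λ : ℝ)

/-- `R² = r² + (l + a cos θ)²`. -/
def knR2 (p : Params) (x : Coords) : ℝ := x 1 ^ 2 + (p.l + p.a * Real.cos (x 2)) ^ 2

/-- `R`. -/
def knR (p : Params) (x : Coords) : ℝ := Real.sqrt (knR2 p x)

/-- `P = sin²θ (1 + (3l + a cos θ)(l + a cos θ) Λ/3)`. -/
def knP (p : Params) (x : Coords) : ℝ :=
  Real.sin (x 2) ^ 2 *
    (1 + (3 * p.l + p.a * Real.cos (x 2)) * (p.l + p.a * Real.cos (x 2)) * p.Λ / 3)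

/-- `Q = (a² - l²) - 2 m r + r² - Λ [(3 l² + a²) r² + r⁴]/3`. -/
def knQ (p : Params) (x : Coords) : ℝ :=
  (p.a ^ 2 - p.l ^ 2) - 2 * p.m * x 1 + x 1 ^ 2
    - p.Λ * ((3 * p.l ^ 2 + p.a ^ 2) * x 1 ^ 2 + x 1 ^ 4) / 3

/-- The one-form `dt - (a sin²θ + 4 l sin²(θ/2)) dφ`. -/
def knForm0 (p : Params) (x : Coords) : Fin 4 → ℝ :=
  ![1, 0, 0, -(p.a * Real.sin (x 2) ^ 2 + 4 * p.l * Real.sin (x 2 / 2) ^ 2)]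

/-- The one-form `a dt - (r² + (a + l)²) dφ`. -/
def knForm2 (p : Params) (x : Coords) : Fin 4 → ℝ :=
  ![p.a, 0, 0, -(x 1 ^ 2 + (p.a + p.l) ^ 2)]

/-- The one-form `dr`. -/
def formR : Fin 4 → ℝ := ![0, 1, 0, 0]

/-- The one-form `dθ`. -/
def formTheta : Fin 4 → ℝ := ![0, 0, 1, 0]

/-- The Kerr-NUT-(Anti)-de Sitter metric. -/
def knMetric (p : Params) : MetricField := fun x => Matrix.of fun i j =>
  -(knQ p x / knR2 p x) * (knForm0 p x i * knForm0 p x j)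
    + knP p x / knR2 p x * (knForm2 p x i * knForm2 p x j)
    + knR2 p x / knQ p x * (formR i * formR j)
    + knR2 p x / knP p x * Real.sin (x 2) ^ 2 * (formTheta i * formTheta j)

/-- The coordinate domain: the points with `0 < θ < π` off the ring singularity `R = 0` and off the
horizons `Q = 0` at which `P > 0`. There the metric is regular, of signature `(-,+,+,+)`. -/
def knDomain (p : Params) : Set Coords :=
  {x | 0 < x 2 ∧ x 2 < Real.pi ∧ 0 < knR2 p x ∧ 0 < knP p x ∧ knQ p x ≠ 0}

/-- The stationary Killing vector field `∂_t`. -/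
def dt : Coords → Fin 4 → ℝ := fun _ => Pi.single 0 1

/-- The orthonormal coframe `t⁰, t¹, t², t³`, real where `Q > 0` and `P > 0`. -/
def knT (p : Params) (k : Fin 4) (x : Coords) (i : Fin 4) : ℝ :=
  ![Real.sqrt (knQ p x) / knR p x * knForm0 p x i,
    knR p x / Real.sqrt (knQ p x) * formR i,
    Real.sqrt (knP p x) / knR p x * knForm2 p x i,
    knR p x / Real.sqrt (knP p x) * Real.sin (x 2) * formTheta i] k

/-- `ℓ = (t⁰ - t¹)/√2`. -/
def knEll (p : Params) : CCovector := fun x i =>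
  ((knT p 0 x i : ℂ) - (knT p 1 x i : ℂ)) / (Real.sqrt 2 : ℂ)

/-- `n = (t⁰ + t¹)/√2`. -/
def knN (p : Params) : CCovector := fun x i =>
  ((knT p 0 x i : ℂ) + (knT p 1 x i : ℂ)) / (Real.sqrt 2 : ℂ)

/-- `m = (t² - i t³)/√2`. -/
def knM (p : Params) : CCovector := fun x i =>
  ((knT p 2 x i : ℂ) - Complex.I * (knT p 3 x i : ℂ)) / (Real.sqrt 2 : ℂ)

/-- `L = l (1 + (a² - l²) Λ/3)`. -/
def knL (p : Params) : ℝ := p.l * (1 + (p.a ^ 2 - p.l ^ 2) * p.Λ / 3)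

/-- `Ψ₂ = -(m + i L) (1/(r + i (l + a cos θ)))³`. -/
def knPsi2 (p : Params) (x : Coords) : ℂ :=
  -((p.m : ℂ) + Complex.I * (knL p : ℂ)) *
    (1 / ((x 1 : ℂ) + Complex.I * ((p.l + p.a * Real.cos (x 2) : ℝ) : ℂ))) ^ 3

/-- `ρ = (1/√2) √Q [r - i (a cos θ + l)]/R³`; the square root is the complex one, so that the formula
also makes sense between the horizons, where `Q < 0`. -/
def knRho (p : Params) (x : Coords) : ℂ :=
  1 / (Real.sqrt 2 : ℂ) * ((knQ p x : ℂ) ^ (1 / 2 : ℂ)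
    * ((x 1 : ℂ) - Complex.I * ((p.a * Real.cos (x 2) + p.l : ℝ) : ℂ)) / (knR p x : ℂ) ^ 3)

/-- `τ = (1/√2) a √P [r - i (a cos θ + l)]/R³`. -/
def knTau (p : Params) (x : Coords) : ℂ :=
  1 / (Real.sqrt 2 : ℂ) * ((p.a : ℂ) * (Real.sqrt (knP p x) : ℂ)
    * ((x 1 : ℂ) - Complex.I * ((p.a * Real.cos (x 2) + p.l : ℝ) : ℂ)) / (knR p x : ℂ) ^ 3)

end ConformalBH

end

noncomputable section

open Filter Topology

namespace ConformalBH

/-! ### Partial derivatives -/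

section PartialDerivatives

variable {F : Type*} [NormedAddCommGroup F] [NormedSpace ℝ F]

/-! The invariants pair off into complex ones. Put D = C + iC*. A self-dual tensor has vanishing
contraction with an anti-self-dual one, and this persists for the first derivatives. Hence I₁ + iI₂,
I₃ + iI₄ and I₃ₐ + iI₄ₐ are half the contractions of D or ∇D with itself (`contr_re_add_im`), and
J_ergo is -1/6912 times the real part of the single complex invariant 6·I·W - 16·I·Wₐ + dI·dI
(`Jergo_eq_re`).

The metric is of type D. With X = ℓ∧m, Y = n∧m̃, Z = ℓ∧n - m∧m̃ in a null frame, D = -2Ψ₂(XY + YX -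
ZZ) (`weylC_knMetric`). The derivative of XY + YX - ZZ involves only two of the connection forms, N
and L, and both are built from one covector ξ = -dζ/ζ, where ζ = r + i(l + a cos θ). As Ψ₂ is a
constant times ζ⁻³, also dΨ₂ = 3Ψ₂ξ.

Under g ↦ e^{2U}g the tensor D is multiplied by e^{2U}, while the new connection brings u = dU into
∇D. The derivative is then governed by t = 3ξ - 2u (amplitude) and w = u - ξ (bivectors), and the
complex invariant becomes 13824 e^{-10U} Ψ₂⁴ (t·t + 4 t·w + 4 w·w). The coefficients 6, -16, 1 thus
produce the perfect square of t + 2w = ξ, in which u has disappeared (`Jergo_conformal_typeD`).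
Covariance and value come together, the original metric being the case U = 0.

Finally ξ·ξ = (Q - a²P)/(R²ζ²) = 2(ρ² - τ²) (`covContr_knXi`, `knRho_sq_sub_knTau_sq`), and g(∂_t,
∂_t) = -(Q - a²P)/R², so J_ergo vanishes where ∂_t is null.

The geometry is obtained by Cartan's method. A proposed connection form that is antisymmetric and
torsion-free is the Levi-Civita one (`pdMat_eq_of_structure`), and its curvature form is the Riemann
tensor (`frame_mul_riemannUp`). The trace-free part is the Weyl tensor (`weyl_eq_of_decomposition`),
and its conformal weight follows from `riemann_conformal`. The frame is rational in ζ, ζ̄, P, Q and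
i sin θ, and polynomial in the function F of the first one-form. No square root occurs, so one
computation covers both signs of Q. The price is that m̃ is only proportional to the conjugate of m.
The field equations enter through `vacuum_identity`. -/

theorem pd_congr {f g : Coords → F} {x : Coords} (h : f =ᶠ[𝓝 x] g) (i : Fin 4) :
    pd i f x = pd i g x := by
  rw [pd, pd, h.fderiv_eq]

theorem pd_const (i : Fin 4) (c : F) (x : Coords) : pd i (fun _ => c) x = 0 := by
  simp [pd]

theorem pd_add {f g : Coords → F} {x : Coords} (hf : DifferentiableAt ℝ f x)
    (hg : DifferentiableAt ℝ g x) (i : Fin 4) :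
    pd i (fun y => f y + g y) x = pd i f x + pd i g x := by
  simp only [pd, fderiv_fun_add hf hg, add_apply]

theorem pd_sub {f g : Coords → F} {x : Coords} (hf : DifferentiableAt ℝ f x)
    (hg : DifferentiableAt ℝ g x) (i : Fin 4) :
    pd i (fun y => f y - g y) x = pd i f x - pd i g x := by
  simp only [pd, fderiv_fun_sub hf hg, sub_apply]

theorem pd_neg (f : Coords → F) (x : Coords) (i : Fin 4) :
    pd i (fun y => -f y) x = -pd i f x := by
  simp only [pd, fderiv_fun_neg, neg_apply]

theorem pd_sum {ι : Type*} (s : Finset ι) {f : ι → Coords → F} {x : Coords}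
    (hf : ∀ k ∈ s, DifferentiableAt ℝ (f k) x) (i : Fin 4) :
    pd i (fun y => ∑ k ∈ s, f k y) x = ∑ k ∈ s, pd i (f k) x := by
  simp only [pd, fderiv_fun_sum hf, sum_apply]

theorem pd_mul {𝔸 : Type*} [NormedCommRing 𝔸] [NormedAlgebra ℝ 𝔸] {f g : Coords → 𝔸} {x : Coords}
    (hf : DifferentiableAt ℝ f x) (hg : DifferentiableAt ℝ g x) (i : Fin 4) :
    pd i (fun y => f y * g y) x = pd i f x * g x + f x * pd i g x := by
  simp only [pd, fderiv_fun_mul hf hg, add_apply,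
    smul_apply, smul_eq_mul]
  ring

theorem pd_const_mul {𝔸 : Type*} [NormedCommRing 𝔸] [NormedAlgebra ℝ 𝔸] {f : Coords → 𝔸}
    {x : Coords} (hf : DifferentiableAt ℝ f x) (c : 𝔸) (i : Fin 4) :
    pd i (fun y => c * f y) x = c * pd i f x := by
  rw [pd_mul (differentiableAt_const c) hf, pd_const, zero_mul, zero_add]

theorem pd_clm {G : Type*} [NormedAddCommGroup G] [NormedSpace ℝ G] {f : Coords → F} {x : Coords}
    (hf : DifferentiableAt ℝ f x) (T : F →L[ℝ] G) (i : Fin 4) :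
    pd i (fun y => T (f y)) x = T (pd i f x) := by
  have := (T.hasFDerivAt.comp x hf.hasFDerivAt).fderiv
  simp only [Function.comp_def] at this
  rw [pd, this]; rfl

theorem pd_ofReal {f : Coords → ℝ} {x : Coords} (hf : DifferentiableAt ℝ f x) (i : Fin 4) :
    pd i (fun y => (f y : ℂ)) x = ((pd i f x : ℝ) : ℂ) :=
  pd_clm hf Complex.ofRealCLM i

theorem pd_re {f : Coords → ℂ} {x : Coords} (hf : DifferentiableAt ℝ f x) (i : Fin 4) :
    pd i (fun y => (f y).re) x = (pd i f x).re :=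
  pd_clm hf Complex.reCLM i

theorem pd_im {f : Coords → ℂ} {x : Coords} (hf : DifferentiableAt ℝ f x) (i : Fin 4) :
    pd i (fun y => (f y).im) x = (pd i f x).im :=
  pd_clm hf Complex.imCLM i

theorem differentiableAt_ofReal {f : Coords → ℝ} {x : Coords} (hf : DifferentiableAt ℝ f x) :
    DifferentiableAt ℝ (fun y => (f y : ℂ)) x :=
  Complex.ofRealCLM.differentiableAt.comp x hf

theorem contDiffAt_pd {f : Coords → F} {x : Coords} (hf : ContDiffAt ℝ ∞ f x) (i : Fin 4) :
    ContDiffAt ℝ ∞ (fun y => pd i f y) x :=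
  (hf.fderiv_right (m := ∞) (by simp)).clm_apply contDiffAt_const

theorem pd_comm {f : Coords → F} {x : Coords} (hf : ContDiffAt ℝ ∞ f x) (i j : Fin 4) :
    pd i (fun y => pd j f y) x = pd j (fun y => pd i f y) x := by
  have hs : IsSymmSndFDerivAt ℝ f x := hf.isSymmSndFDerivAt (by simpa using WithTop.coe_le_coe.mpr (le_top (a := (2 : ℕ∞))))
  have hd : DifferentiableAt ℝ (fderiv ℝ f) x :=
    (hf.fderiv_right (m := ∞) (by simp)).differentiableAt (by simp)
  have key : ∀ k l : Fin 4, pd k (fun y => pd l f y) x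
      = fderiv ℝ (fderiv ℝ f) x (Pi.single k 1) (Pi.single l 1) := by
    intro k l
    exact pd_clm hd (ContinuousLinearMap.apply ℝ F (Pi.single l 1 : Coords)) k
  rw [key, key, hs.eq]

end PartialDerivatives

/-! ### Levi-Civita connection and curvature of a metric given by a complex moving frame -/

section Frames

open Matrix

variable {g : MetricField} {E : Coords → Matrix (Fin 4) (Fin 4) ℂ} {η e : Matrix (Fin 4) (Fin 4) ℂ}
  {W : Coords → Fin 4 → Matrix (Fin 4) (Fin 4) ℂ} {x : Coords}

/-- The matrix `(Γ_c)_{ab} = Γ^a_{cb}` of Christoffel symbols, with complex entries. -/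
def christoffelMat (g : MetricField) (x : Coords) (c : Fin 4) : Matrix (Fin 4) (Fin 4) ℂ :=
  of fun a b => (christoffel g x a c b : ℂ)

/-- The entrywise partial derivative of a matrix valued function. -/
def pdMat (c : Fin 4) (E : Coords → Matrix (Fin 4) (Fin 4) ℂ) (x : Coords) :
    Matrix (Fin 4) (Fin 4) ℂ :=
  of fun i a => pd c (fun y => E y i a) x

/-- The inverse metric, with complex entries. -/
def invMetricC (g : MetricField) (x : Coords) : Matrix (Fin 4) (Fin 4) ℂ :=
  of fun a b => (invMetric g x a b : ℂ)

/-- The metric, with complex entries. -/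
def metricC (g : MetricField) (x : Coords) : Matrix (Fin 4) (Fin 4) ℂ :=
  of fun a b => (g x a b : ℂ)

/-- The frame is complex, whereas `invMetric` inverts a real matrix. The two are compared by
uniqueness of the inverse after extension of scalars. -/
theorem invMetricC_eq_of_frame (hg : metricC g x = (E x)ᵀ * η * E x) (he : E x * e = 1)
    (hη : η * η = 1) : invMetricC g x = e * η * eᵀ := by
  have he' : e * E x = 1 := mul_eq_one_comm.mp he
  have h1 : metricC g x * (e * η * eᵀ) = 1 := by
    calc metricC g x * (e * η * eᵀ) = (E x)ᵀ * η * (E x * e) * η * eᵀ := by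
          rw [hg]; simp only [Matrix.mul_assoc]
      _ = (E x)ᵀ * (η * η) * eᵀ := by rw [he]; simp only [Matrix.mul_assoc, Matrix.one_mul]
      _ = 1 := by rw [hη, Matrix.mul_one, ← transpose_mul, he', transpose_one]
  have hm : metricC g x = (g x).map (algebraMap ℝ ℂ) := rfl
  have hdet : IsUnit (g x).det := by
    have h2 : (metricC g x).det ≠ 0 := by
      intro h0
      have := congrArg Matrix.det h1
      rw [det_mul, h0, zero_mul, det_one] at this
      exact zero_ne_one this
    rw [hm, ← RingHom.mapMatrix_apply, ← RingHom.map_det] at h2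
    exact isUnit_iff_ne_zero.mpr (fun h => h2 (by rw [h, map_zero]))
  have h3 : invMetricC g x * metricC g x = 1 := by
    have h4 : invMetricC g x = (g x)⁻¹.map (algebraMap ℝ ℂ) := rfl
    rw [h4, hm, ← Matrix.map_mul, nonsing_inv_mul _ hdet]
    simp
  calc invMetricC g x = invMetricC g x * (metricC g x * (e * η * eᵀ)) := by rw [h1, Matrix.mul_one]
    _ = e * η * eᵀ := by rw [← Matrix.mul_assoc, h3, Matrix.one_mul]

theorem det_ne_zero_of_frame (hg : metricC g x = (E x)ᵀ * η * E x) (he : E x * e = 1)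
    (hη : η * η = 1) : (g x).det ≠ 0 := by
  intro h
  have h2 : (metricC g x).det = 0 := by
    have hm : metricC g x = (g x).map (algebraMap ℝ ℂ) := rfl
    rw [hm, ← RingHom.mapMatrix_apply, ← RingHom.map_det, h, map_zero]
  rw [hg, det_mul, det_mul, det_transpose] at h2
  have h3 : (E x).det * e.det = 1 := by rw [← det_mul, he, det_one]
  have h4 : η.det * η.det = 1 := by rw [← det_mul, hη, det_one]
  have h5 : (E x).det ≠ 0 := left_ne_zero_of_mul_eq_one h3
  have h6 : η.det ≠ 0 := left_ne_zero_of_mul_eq_one h4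
  exact (mul_ne_zero (mul_ne_zero h5 h6) h5) h2

/-- The first structure equation: an antisymmetric connection form without torsion is the one of
the Levi-Civita connection. -/
theorem pdMat_eq_of_structure (hg : ∀ᶠ y in 𝓝 x, metricC g y = (E y)ᵀ * η * E y)
    (hgd : ∀ a b, DifferentiableAt ℝ (fun y => g y a b) x)
    (hE : ∀ i a, DifferentiableAt ℝ (fun y => E y i a) x) (he : E x * e = 1)
    (hη : η * η = 1) (hηt : ηᵀ = η)
    (hW : ∀ c, (W x c)ᵀ * η + η * W x c = 0)
    (htor : ∀ c d i, pd c (fun y => E y i d) x + ∑ j, W x c i j * E x j d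
      = pd d (fun y => E y i c) x + ∑ j, W x d i j * E x j c) (c : Fin 4) :
    pdMat c E x = E x * christoffelMat g x c - W x c * E x := by
  have hdg : ∀ c, (of fun a b => ((pd c (fun y => g y a b) x : ℝ) : ℂ)) =
      (pdMat c E x)ᵀ * η * E x + (E x)ᵀ * η * pdMat c E x := by
    intro c
    ext a b
    have h1 : pd c (fun y => (g y a b : ℂ)) x
        = pd c (fun y => ∑ j, (∑ i, E y i a * η i j) * E y j b) x := by
      apply pd_congr
      filter_upwards [hg] with y hy
      have := congrFun (congrFun hy a) b
      simpa [metricC, Matrix.mul_apply] using this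
    rw [of_apply, ← pd_ofReal (hgd a b), h1, pd_sum _ (fun j _ => by fun_prop)]
    simp only [Matrix.add_apply, Matrix.mul_apply, transpose_apply, pdMat, of_apply]
    rw [← Finset.sum_add_distrib]
    refine Finset.sum_congr rfl fun j _ => ?_
    rw [pd_mul (by fun_prop) (by fun_prop), pd_sum _ (fun i _ => by fun_prop)]
    congr 2
    refine Finset.sum_congr rfl fun i _ => ?_
    rw [pd_mul (by fun_prop) (by fun_prop), pd_const, mul_zero, add_zero]
  -- H is the candidate for the Christoffel symbols with lowered first index. Absence of torsion
  -- makes it symmetric in the two lower indices, and antisymmetry of W gives H_cᵀ + H_c = ∂_c g.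
  -- These two properties determine Γ.
  set H : Fin 4 → Matrix (Fin 4) (Fin 4) ℂ :=
    fun c => (E x)ᵀ * η * (pdMat c E x + W x c * E x) with hH
  have hHsymm : ∀ c d b, H c d b = H b d c := by
    intro c d b
    simp only [hH, Matrix.mul_apply (M := (E x)ᵀ * η)]
    refine Finset.sum_congr rfl fun j _ => ?_
    congr 1
    simpa [Matrix.add_apply, Matrix.mul_apply, pdMat] using htor c b j
  have hgH : ∀ c, (of fun a b => ((pd c (fun y => g y a b) x : ℝ) : ℂ)) = (H c)ᵀ + H c := by
    intro c
    rw [hdg c]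
    simp only [hH, transpose_mul, transpose_add, transpose_transpose, hηt, Matrix.mul_add]
    have h0 : (E x)ᵀ * ((W x c)ᵀ * η + η * W x c) * E x = 0 := by rw [hW]; simp
    have h1 : (E x)ᵀ * (W x c)ᵀ * (η * E x) + (E x)ᵀ * η * (W x c * E x) = 0 := by
      rw [← h0]; simp only [Matrix.mul_add, Matrix.add_mul, Matrix.mul_assoc]
    have h2 : (pdMat c E x)ᵀ * (η * E x) = (pdMat c E x)ᵀ * η * E x := by
      rw [Matrix.mul_assoc]
    rw [h2]
    linear_combination (norm := abel) -h1
  have hG := invMetricC_eq_of_frame (g := g) (E := E) hg.self_of_nhds he hη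
  have hΓ : christoffelMat g x c = invMetricC g x * H c := by
    ext a b
    have hent : ∀ c a b, ((pd c (fun y => g y a b) x : ℝ) : ℂ) = H c b a + H c a b := by
      intro c a b
      have := congrFun (congrFun (hgH c) a) b
      simpa using this
    simp only [christoffelMat, of_apply, christoffel, Matrix.mul_apply, invMetricC]
    push_cast
    rw [Finset.mul_sum]
    refine Finset.sum_congr rfl fun d _ => ?_
    -- Koszul's argument: each derivative of g is a sum of two values of H. By the symmetry of H
    -- four of the six terms cancel and the other two coincide.
    rw [hent, hent, hent, hHsymm c b d, hHsymm b c d, hHsymm b d c]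
    rw [hHsymm d b c]
    ring
  have hEt : eᵀ * (E x)ᵀ = 1 := by rw [← transpose_mul, he, transpose_one]
  rw [hΓ, hG, hH]
  have : E x * (e * η * eᵀ * ((E x)ᵀ * η * (pdMat c E x + W x c * E x)))
      = (E x * e) * η * (eᵀ * (E x)ᵀ) * η * (pdMat c E x + W x c * E x) := by
    simp only [Matrix.mul_assoc]
  simp only [this, he, hEt, Matrix.one_mul, Matrix.mul_one, hη, add_sub_cancel_right]

/-- The curvature two-form `Ω_{cd} = ∂_c W_d - ∂_d W_c + [W_c, W_d]` of a connection form. -/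
def connCurv (W : Coords → Fin 4 → Matrix (Fin 4) (Fin 4) ℂ) (x : Coords) (c d : Fin 4) :
    Matrix (Fin 4) (Fin 4) ℂ :=
  pdMat c (fun y => W y d) x - pdMat d (fun y => W y c) x + (W x c * W x d - W x d * W x c)

theorem pdMat_mul {M N : Coords → Matrix (Fin 4) (Fin 4) ℂ}
    (hM : ∀ i j, DifferentiableAt ℝ (fun y => M y i j) x)
    (hN : ∀ i j, DifferentiableAt ℝ (fun y => N y i j) x) (c : Fin 4) :
    pdMat c (fun y => M y * N y) x = pdMat c M x * N x + M x * pdMat c N x := by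
  ext i j
  simp only [pdMat, of_apply, Matrix.mul_apply, Matrix.add_apply]
  rw [pd_sum (f := fun k y => M y i k * N y k j) _ (fun k _ => (hM i k).mul (hN k j)), ← Finset.sum_add_distrib]
  exact Finset.sum_congr rfl fun k _ => pd_mul (hM i k) (hN k j) c

/-- The second structure equation. -/
theorem frame_mul_riemannUp (hE : ∀ i a, ContDiffAt ℝ ∞ (fun y => E y i a) x)
    (hWd : ∀ c i j, DifferentiableAt ℝ (fun y => W y c i j) x)
    (hΓd : ∀ a b c, DifferentiableAt ℝ (fun y => christoffel g y a b c) x)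
    (hstr : ∀ᶠ y in 𝓝 x, ∀ c, pdMat c E y = E y * christoffelMat g y c - W y c * E y)
    (c d : Fin 4) :
    E x * (of fun a b => (riemannUp g x a b c d : ℂ)) = connCurv W x c d * E x := by
  have hEd : ∀ i a, DifferentiableAt ℝ (fun y => E y i a) x :=
    fun i a => (hE i a).differentiableAt (by simp)
  have hΓd' : ∀ c i j, DifferentiableAt ℝ (fun y => christoffelMat g y c i j) x :=
    fun c i j => differentiableAt_ofReal (hΓd i c j)
  have hR : (of fun a b => (riemannUp g x a b c d : ℂ)) =
      pdMat c (fun y => christoffelMat g y d) x - pdMat d (fun y => christoffelMat g y c) x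
      + (christoffelMat g x c * christoffelMat g x d
        - christoffelMat g x d * christoffelMat g x c) := by
    ext a b
    simp only [riemannUp, of_apply, Matrix.add_apply, Matrix.sub_apply, Matrix.mul_apply, pdMat,
      christoffelMat, pd_ofReal (hΓd _ _ _), ← Finset.sum_sub_distrib]
    push_cast
    rfl
  -- The structure equation in the form ∂_d E + W_d E = E Γ_d, differentiated along c.
  -- Antisymmetrizing in c and d removes the second derivatives of E.
  have hrel : ∀ c d, pdMat c (fun y => pdMat d E y) x + (pdMat c (fun y => W y d) x * E x
      + W x d * pdMat c E x) = pdMat c E x * christoffelMat g x d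
        + E x * pdMat c (fun y => christoffelMat g y d) x := by
    intro c d
    rw [← pdMat_mul (hWd d) hEd, ← pdMat_mul hEd (hΓd' d)]
    ext i j
    simp only [pdMat, of_apply, Matrix.add_apply]
    have h1 : DifferentiableAt ℝ (fun y => pd d (fun y => E y i j) y) x :=
      (contDiffAt_pd (hE i j) d).differentiableAt (by simp)
    rw [← pd_add h1]
    · apply pd_congr
      filter_upwards [hstr] with y hy
      have := congrFun (congrFun (hy d) i) j
      simp only [pdMat, of_apply, Matrix.sub_apply] at this
      rw [this]; ring
    · simp only [Matrix.mul_apply]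
      exact DifferentiableAt.fun_sum fun k _ => (hWd d i k).mul (hEd k j)
  have hcomm : pdMat c (fun y => pdMat d E y) x = pdMat d (fun y => pdMat c E y) x := by
    ext i j
    exact pd_comm (hE i j) c d
  have hx := hstr.self_of_nhds
  have h1 := hrel c d
  have h2 := hrel d c
  rw [hcomm] at h1
  rw [hR, connCurv]
  rw [hx c] at h1
  rw [hx d] at h2
  have h3 : E x * pdMat c (fun y => christoffelMat g y d) x
      - E x * pdMat d (fun y => christoffelMat g y c) x
      = (pdMat c (fun y => W y d) x * E x + W x d * (E x * christoffelMat g x c - W x c * E x))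
        - (E x * christoffelMat g x c - W x c * E x) * christoffelMat g x d
        - (pdMat d (fun y => W y c) x * E x + W x c * (E x * christoffelMat g x d - W x d * E x))
        + (E x * christoffelMat g x d - W x d * E x) * christoffelMat g x c := by
    linear_combination (norm := noncomm_ring) h2 - h1
  rw [Matrix.mul_add, Matrix.mul_sub, h3]
  noncomm_ring

end Frames

/-! ### Metric compatibility, conformal changes and the Weyl tensor -/

section Metric

variable {g : MetricField} {x : Coords}

theorem sum_invMetric_mul (hdet : (g x).det ≠ 0) (a b : Fin 4) :
    ∑ e, invMetric g x a e * g x e b = if a = b then 1 else 0 := by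
  have := congrFun (congrFun (Matrix.nonsing_inv_mul (g x) (isUnit_iff_ne_zero.mpr hdet)) a) b
  rwa [Matrix.mul_apply, Matrix.one_apply] at this

theorem sum_mul_invMetric (hdet : (g x).det ≠ 0) (a b : Fin 4) :
    ∑ e, g x a e * invMetric g x e b = if a = b then 1 else 0 := by
  have := congrFun (congrFun (Matrix.mul_nonsing_inv (g x) (isUnit_iff_ne_zero.mpr hdet)) a) b
  rwa [Matrix.mul_apply, Matrix.one_apply] at this

theorem invMetric_symm (hs : ∀ a b, g x a b = g x b a) (a b : Fin 4) :
    invMetric g x a b = invMetric g x b a := by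
  have h : (g x).transpose = g x := by ext i j; exact hs j i
  have := Matrix.transpose_nonsing_inv (g x)
  rw [h] at this
  exact congrFun (congrFun this b) a

theorem sum_mul_sum_invMetric (hdet : (g x).det ≠ 0) (v : Fin 4 → ℝ) (a : Fin 4) :
    ∑ e, g x a e * ∑ d, invMetric g x e d * v d = v a := by
  simp only [Finset.mul_sum, ← mul_assoc]
  rw [Finset.sum_comm]
  simp only [← Finset.sum_mul, sum_mul_invMetric hdet, ite_mul, one_mul, zero_mul,
    Finset.sum_ite_eq, Finset.mem_univ, if_true]

theorem sum_invMetric_mul_sum (hdet : (g x).det ≠ 0) (v : Fin 4 → ℝ) (a : Fin 4) :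
    ∑ e, invMetric g x a e * ∑ d, g x e d * v d = v a := by
  simp only [Finset.mul_sum, ← mul_assoc]
  rw [Finset.sum_comm]
  simp only [← Finset.sum_mul, sum_invMetric_mul hdet, ite_mul, one_mul, zero_mul,
    Finset.sum_ite_eq, Finset.mem_univ, if_true]

theorem contDiffAt_det {n : ℕ} {M : Coords → Matrix (Fin n) (Fin n) ℝ}
    (hM : ∀ i j, ContDiffAt ℝ ∞ (fun y => M y i j) x) :
    ContDiffAt ℝ ∞ (fun y => (M y).det) x := by
  simp only [Matrix.det_apply]
  exact ContDiffAt.sum fun σ _ => (contDiffAt_prod fun i _ => hM _ _).const_smul _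

theorem contDiffAt_invMetric (hg : ∀ a b, ContDiffAt ℝ ∞ (fun y => g y a b) x)
    (hdet : (g x).det ≠ 0) (a b : Fin 4) : ContDiffAt ℝ ∞ (fun y => invMetric g y a b) x := by
  -- Cramer's rule: an entry of the inverse is a quotient of determinants, which are polynomials in
  -- the entries of g.
  have h : (fun y => invMetric g y a b)
      = fun y => ((g y).det)⁻¹ * ((g y).updateRow b (Pi.single a 1)).det := by
    funext y
    rw [invMetric, Matrix.inv_def, Matrix.smul_apply, Ring.inverse_eq_inv', smul_eq_mul,
      Matrix.adjugate_apply]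
  rw [h]
  refine ((contDiffAt_det hg).inv hdet).mul (contDiffAt_det fun i j => ?_)
  by_cases hi : i = b
  · subst hi
    simp only [Matrix.updateRow_self]
    exact contDiffAt_const
  · simp only [Matrix.updateRow_ne hi]
    exact hg i j

theorem contDiffAt_christoffel (hg : ∀ a b, ContDiffAt ℝ ∞ (fun y => g y a b) x)
    (hdet : (g x).det ≠ 0) (a b c : Fin 4) :
    ContDiffAt ℝ ∞ (fun y => christoffel g y a b c) x := by
  unfold christoffel
  refine contDiffAt_const.mul (ContDiffAt.sum fun d _ => ?_)
  exact (contDiffAt_invMetric hg hdet a d).mul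
    (((contDiffAt_pd (hg d c) b).add (contDiffAt_pd (hg d b) c)).sub (contDiffAt_pd (hg b c) d))

theorem pd_metric_symm {Ω : Set Coords} (hΩ : IsOpen Ω) (hx : x ∈ Ω)
    (hs : ∀ y ∈ Ω, ∀ a b, g y a b = g y b a) (a b c : Fin 4) :
    pd c (fun y => g y a b) x = pd c (fun y => g y b a) x :=
  pd_congr (by filter_upwards [hΩ.mem_nhds hx] with y hy using hs y hy a b) c

theorem christoffel_symm {Ω : Set Coords} (hΩ : IsOpen Ω) (hx : x ∈ Ω)
    (hs : ∀ y ∈ Ω, ∀ a b, g y a b = g y b a) (a b c : Fin 4) :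
    christoffel g x a b c = christoffel g x a c b := by
  unfold christoffel
  congr 1
  refine Finset.sum_congr rfl fun d _ => ?_
  rw [pd_metric_symm hΩ hx hs b c d]
  ring

/-- This is ∇g = 0. Lowering an index of Γ gives half a Koszul sum, and in the sum over both orders
of a, b only ∂_c g survives. -/
theorem pd_metric_eq {Ω : Set Coords} (hΩ : IsOpen Ω) (hx : x ∈ Ω)
    (hs : ∀ y ∈ Ω, ∀ a b, g y a b = g y b a) (hdet : (g x).det ≠ 0) (a b c : Fin 4) :
    pd c (fun y => g y a b) x
      = ∑ e, g x a e * christoffel g x e c b + ∑ e, g x b e * christoffel g x e c a := by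
  have key : ∀ a b, ∑ e, g x a e * christoffel g x e c b
      = 1 / 2 * (pd c (fun y => g y a b) x + pd b (fun y => g y a c) x
        - pd a (fun y => g y c b) x) := by
    intro a b
    rw [← sum_mul_sum_invMetric hdet (fun d => pd c (fun y => g y d b) x
      + pd b (fun y => g y d c) x - pd d (fun y => g y c b) x) a, Finset.mul_sum]
    refine Finset.sum_congr rfl fun e _ => ?_
    unfold christoffel
    ring
  rw [key, key, pd_metric_symm hΩ hx hs b a c, pd_metric_symm hΩ hx hs c b a,
    pd_metric_symm hΩ hx hs c a b]
  ring

theorem riemannUp_eq (hdet : (g x).det ≠ 0) (a b c d : Fin 4) :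
    riemannUp g x a b c d = ∑ e, invMetric g x a e * riemann g x e b c d :=
  (sum_invMetric_mul_sum hdet (fun e => riemannUp g x e b c d) a).symm

/-- The part of the Riemann tensor that is free of traces is the Weyl tensor. -/
theorem weyl_eq_of_decomposition (hs : ∀ a b, g x a b = g x b a) (hdet : (g x).det ≠ 0)
    {V : Fin 4 → Fin 4 → Fin 4 → Fin 4 → ℝ} {S : Fin 4 → Fin 4 → ℝ}
    (hV : ∀ b d, ∑ a, ∑ c, invMetric g x a c * V a b c d = 0)
    (hR : ∀ a b c d, riemann g x a b c d = V a b c d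
      + (g x a c * S b d - g x a d * S b c - g x b c * S a d + g x b d * S a c))
    (a b c d : Fin 4) : weyl g x a b c d = V a b c d := by
  have hinv := invMetric_symm hs
  set s := ∑ a, ∑ c, invMetric g x a c * S a c with hsdef
  -- The trace of the product of g with S is 4S - S - S + s g in dimension four. The trace of the
  -- result, 2s + 4s = 6s, is the scalar curvature below.
  have hric : ∀ b d, ricci g x b d = 2 * S b d + s * g x b d := by
    intro b d
    have e1 : ∑ a, ∑ c, invMetric g x a c * (g x a c * S b d) = 4 * S b d := by
      have : ∀ a, ∑ c, invMetric g x a c * (g x a c * S b d) = S b d := by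
        intro a
        simp only [← mul_assoc, ← Finset.sum_mul, hs a]
        rw [sum_invMetric_mul hdet]; simp
      simp [this]
    have e2 : ∑ a, ∑ c, invMetric g x a c * (g x a d * S b c) = S b d := by
      rw [Finset.sum_comm]
      simp only [← mul_assoc, ← Finset.sum_mul, hinv _]
      have : ∀ c, ∑ a, invMetric g x c a * g x a d = if c = d then 1 else 0 :=
        fun c => sum_invMetric_mul hdet c d
      simp [this]
    have e3 : ∑ a, ∑ c, invMetric g x a c * (g x b c * S a d) = S b d := by
      simp only [← mul_assoc, ← Finset.sum_mul, hs b]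
      simp [sum_invMetric_mul hdet]
    have e4 : ∑ a, ∑ c, invMetric g x a c * (g x b d * S a c) = s * g x b d := by
      rw [hsdef, Finset.sum_mul]
      refine Finset.sum_congr rfl fun a _ => ?_
      rw [Finset.sum_mul]
      exact Finset.sum_congr rfl fun c _ => by ring
    have e0 : ricci g x b d = ∑ a, ∑ c, invMetric g x a c * riemann g x a b c d := by
      rw [Finset.sum_comm]
      unfold ricci
      refine Finset.sum_congr rfl fun a _ => ?_
      rw [riemannUp_eq hdet]
      exact Finset.sum_congr rfl fun e _ => by rw [hinv]
    rw [e0]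
    simp only [hR, mul_add, mul_sub, Finset.sum_add_distrib, Finset.sum_sub_distrib,
      hV, e1, e2, e3, e4]
    ring
  have hscal : scalarCurv g x = 6 * s := by
    have e5 : ∑ a, ∑ b, invMetric g x a b * (s * g x a b) = 4 * s := by
      have : ∀ a, ∑ b, invMetric g x a b * (s * g x a b) = s := by
        intro a
        have h1 : ∀ b, invMetric g x a b * (s * g x a b) = s * (invMetric g x a b * g x b a) := by
          intro b; rw [hs b a]; ring
        simp only [h1, ← Finset.mul_sum]
        rw [sum_invMetric_mul hdet]; simp
      simp [this]
    have e6 : ∑ a, ∑ b, invMetric g x a b * (2 * S a b) = 2 * s := by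
      rw [hsdef, Finset.mul_sum]
      refine Finset.sum_congr rfl fun a _ => ?_
      rw [Finset.mul_sum]
      exact Finset.sum_congr rfl fun c _ => by ring
    unfold scalarCurv
    simp only [hric, mul_add, Finset.sum_add_distrib, e5, e6]
    ring
  simp only [weyl, hR, hric, hscal]
  ring

end Metric

/-! ### Conformal change of the connection and of the curvature. -/

section Conformal

variable {g g' : MetricField} {x : Coords} {U : Coords → ℝ} {Ω : Set Coords}

/-- The gradient `U^a`. -/
def gradUp (g : MetricField) (U : Coords → ℝ) (x : Coords) (a : Fin 4) : ℝ :=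
  ∑ d, invMetric g x a d * pd d U x

theorem invMetric_conformal (hg' : g' x = Real.exp (2 * U x) • g x) (hdet : (g x).det ≠ 0)
    (a b : Fin 4) : invMetric g' x a b = Real.exp (-2 * U x) * invMetric g x a b := by
  have h : (g' x)⁻¹ = Real.exp (-2 * U x) • (g x)⁻¹ := by
    rw [hg']
    apply Matrix.inv_eq_right_inv
    rw [Matrix.smul_mul, Matrix.mul_smul, smul_smul, ← Real.exp_add,
      Matrix.mul_nonsing_inv _ (isUnit_iff_ne_zero.mpr hdet)]
    simp
  rw [invMetric, h]; rfl

theorem pd_conformal (hΩ : IsOpen Ω) (hx : x ∈ Ω)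
    (hgd : ∀ a b, DifferentiableAt ℝ (fun y => g y a b) x) (hU : DifferentiableAt ℝ U x)
    (hg' : ∀ y ∈ Ω, g' y = Real.exp (2 * U y) • g y) (a b c : Fin 4) :
    pd c (fun y => g' y a b) x
      = Real.exp (2 * U x) * (pd c (fun y => g y a b) x + 2 * pd c U x * g x a b) := by
  have h1 : pd c (fun y => g' y a b) x = pd c (fun y => Real.exp (2 * U y) * g y a b) x := by
    apply pd_congr
    filter_upwards [hΩ.mem_nhds hx] with y hy
    rw [hg' y hy]; rfl
  have h2 : pd c (fun y => Real.exp (2 * U y)) x = 2 * pd c U x * Real.exp (2 * U x) := by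
    have := ((hU.hasFDerivAt.const_mul 2).exp).fderiv
    rw [pd, this]
    simp [pd]; ring
  rw [h1, pd_mul (by fun_prop) (hgd a b), h2]
  ring

theorem christoffel_conformal (hΩ : IsOpen Ω) (hx : x ∈ Ω)
    (hgd : ∀ a b, DifferentiableAt ℝ (fun y => g y a b) x)
    (hdet : (g x).det ≠ 0) (hU : DifferentiableAt ℝ U x)
    (hg' : ∀ y ∈ Ω, g' y = Real.exp (2 * U y) • g y) (a b c : Fin 4) :
    christoffel g' x a b c = christoffel g x a b c
      + ((if a = b then pd c U x else 0) + (if a = c then pd b U x else 0)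
        - g x b c * gradUp g U x a) := by
  have hexp : Real.exp (-2 * U x) * Real.exp (2 * U x) = 1 := by
    rw [← Real.exp_add]; simp
  have h1 : ∑ d, invMetric g x a d * g x d c = if a = c then 1 else 0 := sum_invMetric_mul hdet a c
  have h2 : ∑ d, invMetric g x a d * g x d b = if a = b then 1 else 0 := sum_invMetric_mul hdet a b
  have h3 : christoffel g' x a b c = ∑ d, (1 / 2 * (invMetric g x a d *
      (pd b (fun y => g y d c) x + pd c (fun y => g y d b) x - pd d (fun y => g y b c) x))
      + (pd b U x * (invMetric g x a d * g x d c) + pd c U x * (invMetric g x a d * g x d b)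
        - g x b c * (invMetric g x a d * pd d U x))) := by
    rw [christoffel, Finset.mul_sum]
    refine Finset.sum_congr rfl fun d _ => ?_
    rw [invMetric_conformal (hg' x hx) hdet, pd_conformal hΩ hx hgd hU hg',
      pd_conformal hΩ hx hgd hU hg', pd_conformal hΩ hx hgd hU hg']
    linear_combination (1 / 2 * invMetric g x a d *
      ((pd b (fun y => g y d c) x + 2 * pd b U x * g x d c)
      + (pd c (fun y => g y d b) x + 2 * pd c U x * g x d b)
      - (pd d (fun y => g y b c) x + 2 * pd d U x * g x b c))) * hexp
  rw [h3]
  simp only [Finset.sum_add_distrib, Finset.sum_sub_distrib, ← Finset.mul_sum, h1, h2]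
  rw [christoffel, gradUp]
  simp only [mul_ite, mul_one, mul_zero]
  ring

/-- The behaviour of the curvature under a conformal change of the metric. -/
theorem riemann_conformal (hΩ : IsOpen Ω) (hx : x ∈ Ω)
    (hg : ∀ y ∈ Ω, ∀ a b, ContDiffAt ℝ ∞ (fun z => g z a b) y)
    (hs : ∀ y ∈ Ω, ∀ a b, g y a b = g y b a) (hdet : ∀ y ∈ Ω, (g y).det ≠ 0)
    (hU : ∀ y ∈ Ω, ContDiffAt ℝ ∞ U y)
    (hg' : ∀ y ∈ Ω, g' y = Real.exp (2 * U y) • g y) :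
    ∃ S : Fin 4 → Fin 4 → ℝ, ∀ a b c d,
      riemann g' x a b c d = Real.exp (2 * U x) * (riemann g x a b c d
        - (g x a c * S b d - g x a d * S b c - g x b c * S a d + g x b d * S a c)) := by
  have hgd : ∀ y ∈ Ω, ∀ a b, DifferentiableAt ℝ (fun z => g z a b) y :=
    fun y hy a b => (hg y hy a b).differentiableAt (by simp)
  have hUd : ∀ y ∈ Ω, DifferentiableAt ℝ U y := fun y hy => (hU y hy).differentiableAt (by simp)
  have hUi : ∀ i, DifferentiableAt ℝ (fun y => pd i U y) x :=
    fun i => (contDiffAt_pd (hU x hx) i).differentiableAt (by simp)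
  have hgrad : ∀ a, DifferentiableAt ℝ (fun y => gradUp g U y a) x := by
    intro a
    unfold gradUp
    exact DifferentiableAt.fun_sum fun d _ =>
      ((contDiffAt_invMetric (hg x hx) (hdet x hx) a d).differentiableAt (by simp)).mul (hUi d)
  have hΓ : ∀ a b c, DifferentiableAt ℝ (fun y => christoffel g y a b c) x :=
    fun a b c => (contDiffAt_christoffel (hg x hx) (hdet x hx) a b c).differentiableAt (by simp)
  set Γ := christoffel g x
  set u : Fin 4 → ℝ := fun i => pd i U x with hu
  set v : Fin 4 → ℝ := gradUp g U x with hv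
  set s : ℝ := ∑ e, u e * v e with hsdef
  -- The Hessian of U with both indices down (`Hs`) and with one index up (`Hm`). Derivatives of the
  -- new Christoffel symbols produce ∂∂U and ∂(U^a) separately. `hlow` reconciles them: lowering an
  -- index commutes with ∇.
  set Hs : Fin 4 → Fin 4 → ℝ := fun c b => pd c (fun y => pd b U y) x - ∑ e, Γ e c b * u e with hHs
  set Hm : Fin 4 → Fin 4 → ℝ :=
    fun a c => pd c (fun y => gradUp g U y a) x + ∑ e, Γ a c e * v e with hHm
  have hΓs : ∀ a b c, Γ a b c = Γ a c b := christoffel_symm hΩ hx hs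
  have hHsymm : ∀ a b, Hs a b = Hs b a := by
    intro a b
    simp only [hHs]
    rw [pd_comm (hU x hx) a b]
    simp only [hΓs _ a b]
  have hgv : ∀ y ∈ Ω, ∀ a, ∑ e, g y a e * gradUp g U y e = pd a U y := by
    intro y hy a
    exact sum_mul_sum_invMetric (hdet y hy) (fun d => pd d U y) a
  have hdgd : ∀ a b c, pd c (fun y => g y a b) x = ∑ e, g x a e * Γ e c b + ∑ e, g x b e * Γ e c a :=
    fun a b c => pd_metric_eq hΩ hx hs (hdet x hx) a b c
  have hlow : ∀ a c, ∑ e, g x a e * Hm e c = Hs c a := by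
    intro a c
    have h1 : pd c (fun y => pd a U y) x = pd c (fun y => ∑ e, g y a e * gradUp g U y e) x := by
      apply pd_congr
      filter_upwards [hΩ.mem_nhds hx] with y hy using (hgv y hy a).symm
    rw [pd_sum (f := fun e y => g y a e * gradUp g U y e) _
      (fun e _ => (hgd x hx a e).mul (hgrad e))] at h1
    simp only [pd_mul (hgd x hx _ _) (hgrad _), hdgd, Finset.sum_add_distrib, add_mul] at h1
    simp only [hHm, hHs, mul_add, Finset.sum_add_distrib, h1]
    have h2 : ∑ k, (∑ e, g x a e * Γ e c k) * gradUp g U x k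
        = ∑ e, g x a e * ∑ k, Γ e c k * v k := by
      simp only [Finset.sum_mul, Finset.mul_sum]
      rw [Finset.sum_comm]
      exact Finset.sum_congr rfl fun i _ => Finset.sum_congr rfl fun j _ => by rw [hv]; ring
    have h3 : ∑ k, (∑ e, g x k e * Γ e c a) * gradUp g U x k = ∑ e, Γ e c a * u e := by
      simp only [Finset.sum_mul]
      rw [Finset.sum_comm]
      refine Finset.sum_congr rfl fun e _ => ?_
      rw [hu]
      simp only
      rw [← hgv x hx e, Finset.mul_sum]
      exact Finset.sum_congr rfl fun j _ => by rw [hs x hx e j]; ring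
    rw [h2, h3]
    ring
  have hK : ∀ y ∈ Ω, ∀ a b c, christoffel g' y a b c = christoffel g y a b c
      + ((if a = b then pd c U y else 0) + (if a = c then pd b U y else 0)
        - g y b c * gradUp g U y a) := fun y hy =>
    christoffel_conformal hΩ hy (hgd y hy) (hdet y hy) (hUd y hy) hg'
  have hpdΓ : ∀ a b c d, pd c (fun y => christoffel g' y a d b) x
      = pd c (fun y => christoffel g y a d b) x
        + ((if a = d then pd c (fun y => pd b U y) x else 0)
          + (if a = b then pd c (fun y => pd d U y) x else 0)
          - (pd c (fun y => g y d b) x * v a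
            + g x d b * pd c (fun y => gradUp g U y a) x)) := by
    intro a b c d
    have h1 : pd c (fun y => christoffel g' y a d b) x = pd c (fun y => christoffel g y a d b
      + ((if a = d then pd b U y else 0) + (if a = b then pd d U y else 0)
        - g y d b * gradUp g U y a)) x := by
      apply pd_congr
      filter_upwards [hΩ.mem_nhds hx] with y hy using hK y hy a d b
    have hite : ∀ (q : Prop) [Decidable q] (i : Fin 4),
        DifferentiableAt ℝ (fun y => if q then pd i U y else 0) x := by
      intro q _ i
      split_ifs
      · exact hUi i
      · exact differentiableAt_const _
    have hpite : ∀ (q : Prop) [Decidable q] (i : Fin 4),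
        pd c (fun y => if q then pd i U y else 0) x
          = if q then pd c (fun y => pd i U y) x else 0 := by
      intro q _ i
      split_ifs
      · rfl
      · exact pd_const _ _ _
    rw [h1, pd_add (hΓ a d b) (((hite _ _).fun_add (hite _ _)).fun_sub ((hgd x hx d b).fun_mul (hgrad a))),
      pd_sub ((hite _ _).fun_add (hite _ _)) ((hgd x hx d b).fun_mul (hgrad a)),
      pd_add (hite _ _) (hite _ _), hpite, hpite, pd_mul (hgd x hx d b) (hgrad a)]
  have hup : ∀ a b c d, riemannUp g' x a b c d = riemannUp g x a b c d
      - ((if a = c then 1 else 0) * (Hs b d - u b * u d + s / 2 * g x b d)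
        - (if a = d then 1 else 0) * (Hs b c - u b * u c + s / 2 * g x b c)
        + g x b d * (Hm a c - v a * u c + s / 2 * (if a = c then 1 else 0))
        - g x b c * (Hm a d - v a * u d + s / 2 * (if a = d then 1 else 0))) := by
    intro a b c d
    -- The products of two new Christoffel symbols, sorted by degree in dU: the old product, the
    -- terms linear in dU that complete ∂∂U and ∂(U^a) to Hessians, and the quadratic terms.
    have hq : ∀ c d, ∑ e, (christoffel g' x a c e * christoffel g' x e d b)
        = ∑ e, Γ a c e * Γ e d b
          + (Γ a c d * u b + Γ a c b * u d - g x d b * ∑ e, Γ a c e * v e)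
          + ((if a = c then 1 else 0) * (∑ e, Γ e d b * u e) + Γ a d b * u c
            - v a * ∑ e, g x c e * Γ e d b)
          + ((if a = c then 1 else 0) * (2 * u d * u b - g x d b * s)
            + u c * ((if a = d then 1 else 0) * u b + (if a = b then 1 else 0) * u d - g x d b * v a)
            - v a * (g x c d * u b + g x c b * u d - g x d b * u c)) := by
      intro c d
      have hgvc : ∑ e, g x c e * v e = u c := hgv x hx c
      have hterm : ∀ e, christoffel g' x a c e * christoffel g' x e d b
          = Γ a c e * Γ e d b + ((if e = d then Γ a c e * u b else 0)
            + (if e = b then Γ a c e * u d else 0) - g x d b * (Γ a c e * v e))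
            + ((if a = c then 1 else 0) * (Γ e d b * u e)
              + (if a = e then Γ e d b * u c else 0) - v a * (g x c e * Γ e d b))
            + ((if a = c then 1 else 0) * ((if e = d then u e * u b else 0)
                + (if e = b then u e * u d else 0) - g x d b * (u e * v e))
              + (if a = e then u c * ((if e = d then 1 else 0) * u b
                + (if e = b then 1 else 0) * u d - g x d b * v e) else 0)
              - v a * ((if e = d then g x c e * u b else 0)
                + (if e = b then g x c e * u d else 0) - g x d b * (g x c e * v e))) := by
        intro e
        rw [hK x hx, hK x hx]
        split_ifs <;> ring
      simp only [hterm, Finset.sum_add_distrib, Finset.sum_sub_distrib, ← Finset.mul_sum,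
        Finset.sum_ite_eq, Finset.sum_ite_eq', Finset.mem_univ, if_true, hgvc]
      rw [← hsdef]
      ring
    have hΓpd1 := hdgd d b c
    have hΓpd2 := hdgd c b d
    simp only [riemannUp, Finset.sum_sub_distrib, hq, hpdΓ]
    have hac1 : ∀ c d e, (if a = c then pd d (fun y => pd e U y) x else 0)
        = (if a = c then 1 else 0) * pd d (fun y => pd e U y) x := by
      intro c d e; split_ifs <;> simp
    simp only [hac1]
    rw [hΓpd1, hΓpd2, pd_comm (hU x hx) c d]
    have hS1 : Hs b d = pd d (fun y => pd b U y) x - ∑ e, Γ e d b * u e := by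
      rw [hHsymm b d]
    have hS2 : Hs b c = pd c (fun y => pd b U y) x - ∑ e, Γ e c b * u e := by
      rw [hHsymm b c]
    rw [hS1, hS2, hs x hx d b, hs x hx c b, hs x hx d c]
    simp only [hHm, hΓs _ d c]
    ring
  -- The tensor ∇∇U - dU⊗dU + ½|dU|² g, by which the Schouten tensor decreases.
  refine ⟨fun a b => Hs a b - u a * u b + s / 2 * g x a b, fun a b c d => ?_⟩
  have hgdel : ∀ c, ∑ e, g x a e * (if e = c then (1 : ℝ) else 0) = g x a c := by
    intro c; simp
  have hgv' : ∑ e, g x a e * v e = u a := hgv x hx a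
  have hlow1 : ∀ (c d : Fin 4) (k : ℝ), ∑ e, g x a e * (k * (Hm e c - v e * u c
      + s / 2 * (if e = c then 1 else 0))) = k * (Hs c a - u a * u c + s / 2 * g x a c) := by
    intro c d k
    rw [← hlow a c, ← hgv', ← hgdel c]
    simp only [Finset.mul_sum, Finset.sum_mul, ← Finset.sum_add_distrib,
      ← Finset.sum_sub_distrib]
    exact Finset.sum_congr rfl fun e _ => by ring
  have hlow2 : ∀ (c : Fin 4) (k : ℝ), ∑ e, g x a e * ((if e = c then 1 else 0) * k)
      = g x a c * k := by
    intro c k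
    rw [← hgdel c, Finset.sum_mul]
    exact Finset.sum_congr rfl fun e _ => by ring
  have h0 : riemann g' x a b c d = Real.exp (2 * U x) * ∑ e, g x a e * riemannUp g' x e b c d := by
    rw [riemann, Finset.mul_sum]
    refine Finset.sum_congr rfl fun e _ => ?_
    rw [hg' x hx, Matrix.smul_apply, smul_eq_mul]; ring
  rw [h0]
  simp only [hup, mul_sub, mul_add] at *
  simp only [riemann, Finset.sum_add_distrib, Finset.sum_sub_distrib] at *
  have q1 := hlow1 c d (g x b d)
  have q2 := hlow1 d d (g x b c)
  have q3 := hlow2 c (Hs b d - u b * u d + s / 2 * g x b d)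
  have q4 := hlow2 d (Hs b c - u b * u c + s / 2 * g x b c)
  simp only [mul_sub, mul_add, Finset.sum_add_distrib, Finset.sum_sub_distrib] at q3 q4
  rw [hHsymm a d, hHsymm a c]
  linear_combination Real.exp (2 * U x) * (-q1 + q2 - q3 + q4)

end Conformal

/-! ### Contractions of complex tensors -/

section Contractions

open Matrix

/-- Complex tensors of rank four at a point. -/
abbrev CTensor4 : Type := Fin 4 → Fin 4 → Fin 4 → Fin 4 → ℂ

/-- Complex tensors of rank five at a point. -/
abbrev CTensor5 : Type := Fin 4 → Fin 4 → Fin 4 → Fin 4 → Fin 4 → ℂ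

variable (G : Matrix (Fin 4) (Fin 4) ℂ)

/-- The full contraction of two tensors of rank four. -/
def fullContr4 : CTensor4 →ₗ[ℂ] CTensor4 →ₗ[ℂ] ℂ :=
  LinearMap.mk₂ ℂ (fun S T => ∑ a, ∑ b, ∑ c, ∑ d, S a b c d *
      ∑ a', ∑ b', ∑ c', ∑ d', G a a' * G b b' * G c c' * G d d' * T a' b' c' d')
    (fun _ _ _ => by simp only [Pi.add_apply, add_mul, Finset.sum_add_distrib])
    (fun _ _ _ => by simp only [Pi.smul_apply, smul_eq_mul, mul_assoc, Finset.mul_sum])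
    (fun _ _ _ => by simp only [Pi.add_apply, mul_add, Finset.sum_add_distrib])
    (fun k _ _ => by simp only [Pi.smul_apply, smul_eq_mul, mul_left_comm _ k, ← Finset.mul_sum])

/-- The full contraction of two tensors of rank five. -/
def fullContr5 : CTensor5 →ₗ[ℂ] CTensor5 →ₗ[ℂ] ℂ :=
  LinearMap.mk₂ ℂ (fun S T => ∑ a, ∑ b, ∑ c, ∑ d, ∑ e, S a b c d e *
      ∑ a', ∑ b', ∑ c', ∑ d', ∑ e', G a a' * G b b' * G c c' * G d d' * G e e'
        * T a' b' c' d' e')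
    (fun _ _ _ => by simp only [Pi.add_apply, add_mul, Finset.sum_add_distrib])
    (fun _ _ _ => by simp only [Pi.smul_apply, smul_eq_mul, mul_assoc, Finset.mul_sum])
    (fun _ _ _ => by simp only [Pi.add_apply, mul_add, Finset.sum_add_distrib])
    (fun k _ _ => by simp only [Pi.smul_apply, smul_eq_mul, mul_left_comm _ k, ← Finset.mul_sum])

/-- The contraction of two tensors of rank five in which the first and the last index of the
second tensor are interchanged. -/
def swapContr5 : CTensor5 →ₗ[ℂ] CTensor5 →ₗ[ℂ] ℂ :=
  LinearMap.mk₂ ℂ (fun S T => ∑ a, ∑ b, ∑ c, ∑ d, ∑ e, S a b c d e *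
      ∑ a', ∑ b', ∑ c', ∑ d', ∑ e', G e a' * G b b' * G c c' * G d d' * G a e'
        * T a' b' c' d' e')
    (fun _ _ _ => by simp only [Pi.add_apply, add_mul, Finset.sum_add_distrib])
    (fun _ _ _ => by simp only [Pi.smul_apply, smul_eq_mul, mul_assoc, Finset.mul_sum])
    (fun _ _ _ => by simp only [Pi.add_apply, mul_add, Finset.sum_add_distrib])
    (fun k _ _ => by simp only [Pi.smul_apply, smul_eq_mul, mul_left_comm _ k, ← Finset.mul_sum])

/-- The contraction `s_{ab} t^{ab}`. -/
def formContr (s t : Matrix (Fin 4) (Fin 4) ℂ) : ℂ := (sᵀ * (G * t * Gᵀ)).trace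

/-- The contraction `p_a q^a`. -/
def covContr (p q : Fin 4 → ℂ) : ℂ := p ⬝ᵥ (G *ᵥ q)

/-- The contraction `s_{ab} p_e t^{eb} q^a`. -/
def swapContr (s t : Matrix (Fin 4) (Fin 4) ℂ) (p q : Fin 4 → ℂ) : ℂ :=
  (G *ᵥ q) ⬝ᵥ ((s * (G * t * Gᵀ)ᵀ) *ᵥ p)

variable {G}

theorem mul_mul_transpose_apply (t : Matrix (Fin 4) (Fin 4) ℂ) (a b : Fin 4) :
    (G * t * Gᵀ) a b = ∑ a', ∑ b', G a a' * G b b' * t a' b' := by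
  simp only [Matrix.mul_apply, transpose_apply, Finset.sum_mul]
  rw [Finset.sum_comm]
  exact Finset.sum_congr rfl fun _ _ => Finset.sum_congr rfl fun _ _ => by ring

theorem formContr_eq_sum (s t : Matrix (Fin 4) (Fin 4) ℂ) :
    formContr G s t = ∑ a, ∑ b, s a b * (G * t * Gᵀ) a b := by
  rw [formContr, trace, Finset.sum_comm]
  simp only [diag_apply, Matrix.mul_apply (M := sᵀ), transpose_apply]

theorem swapContr_eq_sum (s t : Matrix (Fin 4) (Fin 4) ℂ) (p q : Fin 4 → ℂ) :
    swapContr G s t p q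
      = ∑ a, ∑ b, ∑ e, s a b * p e * ((G * t * Gᵀ) e b * (G *ᵥ q) a) := by
  have h : ∀ a, ((s * (G * t * Gᵀ)ᵀ) *ᵥ p) a = ∑ b, ∑ e, s a b * p e * (G * t * Gᵀ) e b := by
    intro a
    rw [mulVec, dotProduct, Finset.sum_comm]
    simp only [Matrix.mul_apply (M := s), transpose_apply (M := G * t * Gᵀ), Finset.sum_mul]
    exact Finset.sum_congr rfl fun _ _ => Finset.sum_congr rfl fun _ _ => by ring
  rw [swapContr, dotProduct]
  simp only [h, Finset.mul_sum]
  exact Finset.sum_congr rfl fun _ _ => Finset.sum_congr rfl fun _ _ =>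
    Finset.sum_congr rfl fun _ _ => by ring

theorem fullContr4_tmul (s t s' t' : Matrix (Fin 4) (Fin 4) ℂ) :
    fullContr4 G (fun a b c d => s a b * t c d) (fun a b c d => s' a b * t' c d)
      = formContr G s s' * formContr G t t' := by
  have h1 : ∀ a b c d, (∑ a', ∑ b', ∑ c', ∑ d',
      G a a' * G b b' * G c c' * G d d' * (s' a' b' * t' c' d'))
      = (G * s' * Gᵀ) a b * (G * t' * Gᵀ) c d := by
    intro a b c d
    have h2 : ∀ a' b' c' d', G a a' * G b b' * G c c' * G d d' * (s' a' b' * t' c' d')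
        = (G a a' * G b b' * s' a' b') * (G c c' * G d d' * t' c' d') := by intros; ring
    simp only [h2, ← Finset.mul_sum, ← Finset.sum_mul, ← mul_mul_transpose_apply]
  have h3 : ∀ a b c d, s a b * t c d * ((G * s' * Gᵀ) a b * (G * t' * Gᵀ) c d)
      = (s a b * (G * s' * Gᵀ) a b) * (t c d * (G * t' * Gᵀ) c d) := by intros; ring
  rw [fullContr4, LinearMap.mk₂_apply]
  simp only [h1, h3, ← Finset.mul_sum, ← Finset.sum_mul, ← formContr_eq_sum]

theorem fullContr5_tmul (s t s' t' : Matrix (Fin 4) (Fin 4) ℂ) (p q : Fin 4 → ℂ) :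
    fullContr5 G (fun a b c d e => s a b * t c d * p e) (fun a b c d e => s' a b * t' c d * q e)
      = formContr G s s' * formContr G t t' * covContr G p q := by
  have h1 : ∀ a b c d e, (∑ a', ∑ b', ∑ c', ∑ d', ∑ e',
      G a a' * G b b' * G c c' * G d d' * G e e' * (s' a' b' * t' c' d' * q e'))
      = (G * s' * Gᵀ) a b * (G * t' * Gᵀ) c d * (G *ᵥ q) e := by
    intro a b c d e
    have h2 : ∀ a' b' c' d' e',
        G a a' * G b b' * G c c' * G d d' * G e e' * (s' a' b' * t' c' d' * q e')
        = (G a a' * G b b' * s' a' b') * (G c c' * G d d' * t' c' d') * (G e e' * q e') := by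
      intros; ring
    have h4 : (∑ e', G e e' * q e') = (G *ᵥ q) e := rfl
    simp only [h2, ← Finset.mul_sum, ← Finset.sum_mul, ← mul_mul_transpose_apply, h4]
  have h3 : ∀ a b c d e, s a b * t c d * p e *
      ((G * s' * Gᵀ) a b * (G * t' * Gᵀ) c d * (G *ᵥ q) e)
      = (s a b * (G * s' * Gᵀ) a b) * (t c d * (G * t' * Gᵀ) c d) * (p e * (G *ᵥ q) e) := by
    intros; ring
  have h5 : (∑ e, p e * (G *ᵥ q) e) = covContr G p q := rfl
  rw [fullContr5, LinearMap.mk₂_apply]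
  simp only [h1, h3, ← Finset.mul_sum, ← Finset.sum_mul, ← formContr_eq_sum, h5]

/-- Interchanging the first and the last index leaves the pair c, d alone, so an ordinary
contraction of t with t' splits off. This factor alone makes swapped contractions of self-dual with
anti-self-dual tensors vanish. -/
theorem swapContr5_tmul (s t s' t' : Matrix (Fin 4) (Fin 4) ℂ) (p q : Fin 4 → ℂ) :
    swapContr5 G (fun a b c d e => s a b * t c d * p e) (fun a b c d e => s' a b * t' c d * q e)
      = formContr G t t' * swapContr G s s' p q := by
  have h1 : ∀ a b c d e, (∑ a', ∑ b', ∑ c', ∑ d', ∑ e',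
      G e a' * G b b' * G c c' * G d d' * G a e' * (s' a' b' * t' c' d' * q e'))
      = (G * s' * Gᵀ) e b * (G * t' * Gᵀ) c d * (G *ᵥ q) a := by
    intro a b c d e
    have h2 : ∀ a' b' c' d' e',
        G e a' * G b b' * G c c' * G d d' * G a e' * (s' a' b' * t' c' d' * q e')
        = (G e a' * G b b' * s' a' b') * (G c c' * G d d' * t' c' d') * (G a e' * q e') := by
      intros; ring
    have h4 : (∑ e', G a e' * q e') = (G *ᵥ q) a := rfl
    simp only [h2, ← Finset.mul_sum, ← Finset.sum_mul, ← mul_mul_transpose_apply, h4]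
  have h3 : ∀ a b c d e, s a b * t c d * p e *
      ((G * s' * Gᵀ) e b * (G * t' * Gᵀ) c d * (G *ᵥ q) a)
      = (t c d * (G * t' * Gᵀ) c d) * (s a b * p e * ((G * s' * Gᵀ) e b * (G *ᵥ q) a)) := by
    intros; ring
  rw [swapContr5, LinearMap.mk₂_apply]
  simp only [h1, h3, swapContr_eq_sum, ← Finset.mul_sum, ← Finset.sum_mul, ← formContr_eq_sum]

variable {E : Matrix (Fin 4) (Fin 4) ℂ}

/-- By cyclicity of the trace the frame moves from the tensors to the inverse metric. Since E G Eᵀ =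
`nullEta`, contractions at a point become contractions of constant matrices. -/
theorem formContr_frame (s t : Matrix (Fin 4) (Fin 4) ℂ) :
    formContr G (Eᵀ * s * E) (Eᵀ * t * E) = formContr (E * G * Eᵀ) s t := by
  simp only [formContr, transpose_mul, transpose_transpose]
  rw [Matrix.mul_assoc, trace_mul_comm]
  simp only [Matrix.mul_assoc]

theorem covContr_frame (p q : Fin 4 → ℂ) :
    covContr G (p ᵥ* E) (q ᵥ* E) = covContr (E * G * Eᵀ) p q := by
  simp only [covContr, ← mulVec_transpose, ← mulVec_mulVec]
  rw [mulVec_transpose, ← dotProduct_mulVec]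

theorem swapContr_frame (s t : Matrix (Fin 4) (Fin 4) ℂ) (p q : Fin 4 → ℂ) :
    swapContr G (Eᵀ * s * E) (Eᵀ * t * E) (p ᵥ* E) (q ᵥ* E) = swapContr (E * G * Eᵀ) s t p q := by
  simp only [swapContr, transpose_mul, transpose_transpose, ← mulVec_transpose, ← mulVec_mulVec]
  rw [dotProduct_mulVec, ← mulVec_transpose, transpose_transpose]

/-- A contraction of tensors with `⟨D, D̄⟩ = 0` is determined by its complex value on `D`. -/
theorem contr_re_add_im {V : Type*} [AddCommGroup V] [Module ℂ V] (B : V →ₗ[ℂ] V →ₗ[ℂ] ℂ)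
    {D D' R J : V} (hD : D = R + Complex.I • J) (hD' : D' = R - Complex.I • J)
    (h1 : B D D' = 0) (h2 : B D' D = 0) :
    B R R + Complex.I * B J R = 1 / 2 * B D D := by
  subst hD hD'
  simp only [map_add, map_sub, map_smul, LinearMap.add_apply, LinearMap.sub_apply,
    LinearMap.smul_apply, smul_eq_mul] at *
  -- The difference of the two sides is ½(⟨R,R⟩ + ⟨J,J⟩) + (i/2)(⟨J,R⟩ - ⟨R,J⟩), which is ½⟨D,D'⟩.
  -- No symmetry of B is needed.
  linear_combination 1 / 2 * h1

end Contractions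

/-! ### Null frames and self-dual bivectors -/

section NullFrames

open Matrix

/-- The components of the metric in a null frame `(ℓ, n, m, m̃)`. -/
def nullEta : Matrix (Fin 4) (Fin 4) ℂ := !![0, -1, 0, 0; -1, 0, 0, 0; 0, 0, 0, 1; 0, 0, 1, 0]

/-- The bivector `ℓ ∧ m`. -/
def bivX : Matrix (Fin 4) (Fin 4) ℂ := !![0, 0, 1, 0; 0, 0, 0, 0; -1, 0, 0, 0; 0, 0, 0, 0]

/-- The bivector `n ∧ m̃`. -/
def bivY : Matrix (Fin 4) (Fin 4) ℂ := !![0, 0, 0, 0; 0, 0, 0, 1; 0, 0, 0, 0; 0, -1, 0, 0]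

/-- The bivector `ℓ ∧ n - m ∧ m̃`. -/
def bivZ : Matrix (Fin 4) (Fin 4) ℂ := !![0, 1, 0, 0; -1, 0, 0, 0; 0, 0, 0, -1; 0, 0, 1, 0]

/-- The bivector `ℓ ∧ m̃`. -/
def bivX' : Matrix (Fin 4) (Fin 4) ℂ := !![0, 0, 0, 1; 0, 0, 0, 0; 0, 0, 0, 0; -1, 0, 0, 0]

/-- The bivector `n ∧ m`. -/
def bivY' : Matrix (Fin 4) (Fin 4) ℂ := !![0, 0, 0, 0; 0, 0, 1, 0; 0, -1, 0, 0; 0, 0, 0, 0]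

/-- The bivector `ℓ ∧ n + m ∧ m̃`. -/
def bivZ' : Matrix (Fin 4) (Fin 4) ℂ := !![0, 1, 0, 0; -1, 0, 0, 0; 0, 0, 0, 1; 0, 0, -1, 0]

theorem nullEta_mul_self : nullEta * nullEta = 1 := by
  ext i j; fin_cases i <;> fin_cases j <;> simp [nullEta, Matrix.mul_apply, Fin.sum_univ_four]

theorem nullEta_transpose : nullEtaᵀ = nullEta := by
  ext i j; fin_cases i <;> fin_cases j <;> simp [nullEta]

/-- The type D combination `X Y + Y X - Z Z` of bivectors. -/
def typeD (X Y Z : Matrix (Fin 4) (Fin 4) ℂ) : CTensor4 := fun a b c d =>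
  X a b * Y c d + Y a b * X c d - Z a b * Z c d

/-- The first covariant derivative of a type D tensor, in terms of the covectors that appear in
the derivatives of its amplitude and of its bivectors. -/
def typeDDeriv (X Y Z : Matrix (Fin 4) (Fin 4) ℂ) (u N L : Fin 4 → ℂ) : CTensor5 :=
  fun a b c d e => typeD X Y Z a b c d * u e
    + 3 * ((Y a b * Z c d + Z a b * Y c d) * N e - (X a b * Z c d + Z a b * X c d) * L e)

/-- The tensor product of two bivectors and a covector. -/
def tens (s t : Matrix (Fin 4) (Fin 4) ℂ) (p : Fin 4 → ℂ) : CTensor5 :=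
  fun a b c d e => s a b * t c d * p e

theorem typeDDeriv_eq (X Y Z : Matrix (Fin 4) (Fin 4) ℂ) (u N L : Fin 4 → ℂ) :
    typeDDeriv X Y Z u N L = tens X Y u + tens Y X u - tens Z Z u
      + (3 : ℂ) • (tens Y Z N + tens Z Y N - tens X Z L - tens Z X L) := by
  funext a b c d e
  simp only [typeDDeriv, typeD, tens, Pi.add_apply, Pi.sub_apply, Pi.smul_apply, smul_eq_mul]
  ring

theorem fullContr5_tens {G : Matrix (Fin 4) (Fin 4) ℂ} (s t s' t' : Matrix (Fin 4) (Fin 4) ℂ)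
    (p q : Fin 4 → ℂ) : fullContr5 G (tens s t p) (tens s' t' q)
      = formContr G s s' * formContr G t t' * covContr G p q := fullContr5_tmul s t s' t' p q

theorem swapContr5_tens {G : Matrix (Fin 4) (Fin 4) ℂ} (s t s' t' : Matrix (Fin 4) (Fin 4) ℂ)
    (p q : Fin 4 → ℂ) : swapContr5 G (tens s t p) (tens s' t' q)
      = formContr G t t' * swapContr G s s' p q := swapContr5_tmul s t s' t' p q


theorem formContr_self_dual :
    formContr nullEta bivX bivX = 0 ∧ formContr nullEta bivX bivY = -2 ∧
    formContr nullEta bivX bivZ = 0 ∧ formContr nullEta bivY bivX = -2 ∧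
    formContr nullEta bivY bivY = 0 ∧ formContr nullEta bivY bivZ = 0 ∧
    formContr nullEta bivZ bivX = 0 ∧ formContr nullEta bivZ bivY = 0 ∧
    formContr nullEta bivZ bivZ = -4 := by
  refine ⟨?_, ?_, ?_, ?_, ?_, ?_, ?_, ?_, ?_⟩ <;>
  · rw [formContr, nullEta_transpose]
    simp [nullEta, bivX, bivY, bivZ, Matrix.trace, Fin.sum_univ_four, Matrix.mul_apply]
    try norm_num

theorem formContr_self_dual_antiself_dual :
    (∀ t ∈ [bivX', bivY', bivZ'], formContr nullEta bivX t = 0 ∧ formContr nullEta bivY t = 0 ∧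
      formContr nullEta bivZ t = 0) ∧
    ∀ t ∈ [bivX', bivY', bivZ'], formContr nullEta t bivX = 0 ∧ formContr nullEta t bivY = 0 ∧
      formContr nullEta t bivZ = 0 := by
  simp only [List.forall_mem_cons, List.not_mem_nil, false_implies, implies_true, and_true]
  refine ⟨⟨⟨?_, ?_, ?_⟩, ⟨?_, ?_, ?_⟩, ⟨?_, ?_, ?_⟩⟩, ⟨?_, ?_, ?_⟩, ⟨?_, ?_, ?_⟩, ⟨?_, ?_, ?_⟩⟩ <;>
  · rw [formContr, nullEta_transpose]
    simp [nullEta, bivX, bivY, bivZ, bivX', bivY', bivZ', Matrix.trace, Fin.sum_univ_four,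
      Matrix.mul_apply]

theorem covContr_nullEta (p q : Fin 4 → ℂ) :
    covContr nullEta p q = -p 0 * q 1 - p 1 * q 0 + p 2 * q 3 + p 3 * q 2 := by
  simp [covContr, nullEta, dotProduct, mulVec, Fin.sum_univ_four]
  ring

theorem swapContr_nullEta (s t : Matrix (Fin 4) (Fin 4) ℂ) (p q : Fin 4 → ℂ) :
    swapContr nullEta s t p q
      = ![-q 1, -q 0, q 3, q 2] ⬝ᵥ
        ((s * nullEta * tᵀ) *ᵥ ![-p 1, -p 0, p 3, p 2]) := by
  have h : ∀ v : Fin 4 → ℂ, nullEta *ᵥ v = ![-v 1, -v 0, v 3, v 2] := by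
    intro v
    funext i
    fin_cases i <;> simp [nullEta, mulVec, dotProduct, Fin.sum_univ_four]
  rw [swapContr, h]
  simp only [transpose_mul, nullEta_transpose]
  rw [← h p, mulVec_mulVec]
  simp only [Matrix.mul_assoc]

variable {G E : Matrix (Fin 4) (Fin 4) ℂ}

/-- The products XY and YX are paired with each other and give 4 + 4, and ZZ with itself gives 16.
-/
theorem fullContr4_typeD (hG : E * G * Eᵀ = nullEta) :
    fullContr4 G (typeD (Eᵀ * bivX * E) (Eᵀ * bivY * E) (Eᵀ * bivZ * E))
      (typeD (Eᵀ * bivX * E) (Eᵀ * bivY * E) (Eᵀ * bivZ * E)) = 24 := by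
  have h : ∀ X Y Z : Matrix (Fin 4) (Fin 4) ℂ, typeD X Y Z = (fun a b c d => X a b * Y c d)
      + (fun a b c d => Y a b * X c d) - (fun a b c d => Z a b * Z c d) := fun _ _ _ => rfl
  obtain ⟨h1, h2, h3, h4, h5, h6, h7, h8, h9⟩ := formContr_self_dual
  simp only [h, map_add, map_sub, LinearMap.add_apply, LinearMap.sub_apply, fullContr4_tmul,
    formContr_frame, hG, h1, h2, h3, h4, h5, h6, h7, h8, h9]
  norm_num

/-- The two covectors built from w are null and their mutual product is -½ψ² w·w. As YZ + ZY pairs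
only with XZ + ZX, and neither with the type D tensor, amplitude and bivector parts do not mix. -/
theorem fullContr5_typeDDeriv (hG : E * G * Eᵀ = nullEta) (ψ : ℂ) (u w : Fin 4 → ℂ) :
    fullContr5 G
      (typeDDeriv (Eᵀ * bivX * E) (Eᵀ * bivY * E) (Eᵀ * bivZ * E) (u ᵥ* E)
        ((ψ • ![-w 3, 0, -w 1, 0]) ᵥ* E) ((ψ • ![0, -w 2, 0, -w 0]) ᵥ* E))
      (typeDDeriv (Eᵀ * bivX * E) (Eᵀ * bivY * E) (Eᵀ * bivZ * E) (u ᵥ* E)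
        ((ψ • ![-w 3, 0, -w 1, 0]) ᵥ* E) ((ψ • ![0, -w 2, 0, -w 0]) ᵥ* E))
      = 24 * (covContr nullEta u u + 6 * ψ ^ 2 * covContr nullEta w w) := by
  obtain ⟨h1, h2, h3, h4, h5, h6, h7, h8, h9⟩ := formContr_self_dual
  simp only [typeDDeriv_eq, map_add, map_sub, map_smul, LinearMap.add_apply, LinearMap.sub_apply,
    LinearMap.smul_apply, smul_eq_mul, fullContr5_tens,
    formContr_frame, covContr_frame, hG, h1, h2, h3, h4, h5, h6, h7, h8, h9]
  simp only [covContr_nullEta, Pi.smul_apply, smul_eq_mul, cons_val]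
  ring

/-- Here a bivector index is contracted with a derivative index, so the two parts mix. The resulting
cross term u·w is what later completes the square. -/
theorem swapContr5_typeDDeriv (hG : E * G * Eᵀ = nullEta) (ψ : ℂ) (u w : Fin 4 → ℂ) :
    swapContr5 G
      (typeDDeriv (Eᵀ * bivX * E) (Eᵀ * bivY * E) (Eᵀ * bivZ * E) (u ᵥ* E)
        ((ψ • ![-w 3, 0, -w 1, 0]) ᵥ* E) ((ψ • ![0, -w 2, 0, -w 0]) ᵥ* E))
      (typeDDeriv (Eᵀ * bivX * E) (Eᵀ * bivY * E) (Eᵀ * bivZ * E) (u ᵥ* E)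
        ((ψ • ![-w 3, 0, -w 1, 0]) ᵥ* E) ((ψ • ![0, -w 2, 0, -w 0]) ᵥ* E))
      = 6 * covContr nullEta u u - 36 * ψ * covContr nullEta u w
        + 18 * ψ ^ 2 * covContr nullEta w w := by
  obtain ⟨h1, h2, h3, h4, h5, h6, h7, h8, h9⟩ := formContr_self_dual
  simp only [typeDDeriv_eq, map_add, map_sub, map_smul, LinearMap.add_apply, LinearMap.sub_apply,
    LinearMap.smul_apply, smul_eq_mul, swapContr5_tens,
    formContr_frame, swapContr_frame, hG, h1, h2, h3, h4, h5, h6, h7, h8, h9]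
  simp only [covContr_nullEta, swapContr_nullEta, zero_mul, add_zero, zero_add, sub_zero,
    zero_sub]
  simp [bivX, bivY, bivZ, nullEta, Matrix.mul_apply, mulVec, dotProduct, Fin.sum_univ_four]
  ring

end NullFrames

/-! ### Contractions under rescaling of the inverse metric. -/

section ScaledContractions

open Matrix

variable (G : Matrix (Fin 4) (Fin 4) ℂ) (k : ℂ)

theorem fullContr4_smul (S T : CTensor4) :
    fullContr4 (k • G) S T = k ^ 4 * fullContr4 G S T := by
  have h : ∀ x₁ x₂ x₃ x₄ t : ℂ, k * x₁ * (k * x₂) * (k * x₃) * (k * x₄) * t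
      = k ^ 4 * (x₁ * x₂ * x₃ * x₄ * t) := by intros; ring
  simp only [fullContr4, LinearMap.mk₂_apply, Matrix.smul_apply, smul_eq_mul, h, ← Finset.mul_sum,
    mul_left_comm _ (k ^ 4)]

theorem fullContr5_smul (S T : CTensor5) :
    fullContr5 (k • G) S T = k ^ 5 * fullContr5 G S T := by
  have h : ∀ x₁ x₂ x₃ x₄ x₅ t : ℂ, k * x₁ * (k * x₂) * (k * x₃) * (k * x₄) * (k * x₅) * t
      = k ^ 5 * (x₁ * x₂ * x₃ * x₄ * x₅ * t) := by intros; ring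
  simp only [fullContr5, LinearMap.mk₂_apply, Matrix.smul_apply, smul_eq_mul, h, ← Finset.mul_sum,
    mul_left_comm _ (k ^ 5)]

theorem swapContr5_smul (S T : CTensor5) :
    swapContr5 (k • G) S T = k ^ 5 * swapContr5 G S T := by
  have h : ∀ x₁ x₂ x₃ x₄ x₅ t : ℂ, k * x₁ * (k * x₂) * (k * x₃) * (k * x₄) * (k * x₅) * t
      = k ^ 5 * (x₁ * x₂ * x₃ * x₄ * x₅ * t) := by intros; ring
  simp only [swapContr5, LinearMap.mk₂_apply, Matrix.smul_apply, smul_eq_mul, h, ← Finset.mul_sum,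
    mul_left_comm _ (k ^ 5)]

end ScaledContractions

/-! ### The invariants in terms of the complex Weyl tensor -/

section ComplexInvariants

/-- The complex tensor `C + i C*`. -/
def weylC (g : MetricField) (x : Coords) : CTensor4 := fun a b c d =>
  (weyl g x a b c d : ℂ) + Complex.I * (weylDual g x a b c d : ℂ)

/-- The tensor `C - i C*`. -/
def weylCConj (g : MetricField) (x : Coords) : CTensor4 := fun a b c d =>
  (weyl g x a b c d : ℂ) - Complex.I * (weylDual g x a b c d : ℂ)

/-- The covariant derivative of `C + i C*`. -/
def weylCDeriv (g : MetricField) (x : Coords) : CTensor5 := fun a b c d e =>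
  (covDeriv4 g (weyl g) x a b c d e : ℂ) + Complex.I * (covDeriv4 g (weylDual g) x a b c d e : ℂ)

/-- The covariant derivative of `C - i C*`. -/
def weylCDerivConj (g : MetricField) (x : Coords) : CTensor5 := fun a b c d e =>
  (covDeriv4 g (weyl g) x a b c d e : ℂ) - Complex.I * (covDeriv4 g (weylDual g) x a b c d e : ℂ)

variable {g : MetricField} {x : Coords}

theorem ofReal_contract4 (S T : Tensor4) : (contract4 g S T x : ℂ)
    = fullContr4 (invMetricC g x) (fun a b c d => (S x a b c d : ℂ))
      (fun a b c d => (T x a b c d : ℂ)) := by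
  simp only [contract4, raise4, Complex.ofReal_sum, Complex.ofReal_mul]
  rfl

theorem ofReal_contract5 (S T : Tensor5) : (contract5 g S T x : ℂ)
    = fullContr5 (invMetricC g x) (fun a b c d e => (S x a b c d e : ℂ))
      (fun a b c d e => (T x a b c d e : ℂ)) := by
  simp only [contract5, raise5, Complex.ofReal_sum, Complex.ofReal_mul]
  rfl

theorem ofReal_contract5swap (S T : Tensor5) : (contract5swap g S T x : ℂ)
    = swapContr5 (invMetricC g x) (fun a b c d e => (S x a b c d e : ℂ))
      (fun a b c d e => (T x a b c d e : ℂ)) := by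
  simp only [contract5swap, raise5, Complex.ofReal_sum, Complex.ofReal_mul]
  rfl

theorem I1_add_I2 (h1 : fullContr4 (invMetricC g x) (weylC g x) (weylCConj g x) = 0)
    (h2 : fullContr4 (invMetricC g x) (weylCConj g x) (weylC g x) = 0) :
    (I1 g x : ℂ) + Complex.I * (I2 g x : ℂ)
      = 1 / 2 * fullContr4 (invMetricC g x) (weylC g x) (weylC g x) := by
  rw [I1, I2, ofReal_contract4, ofReal_contract4]
  exact contr_re_add_im _ rfl rfl h1 h2

theorem I3_add_I4 (h1 : fullContr5 (invMetricC g x) (weylCDeriv g x) (weylCDerivConj g x) = 0)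
    (h2 : fullContr5 (invMetricC g x) (weylCDerivConj g x) (weylCDeriv g x) = 0) :
    (I3 g x : ℂ) + Complex.I * (I4 g x : ℂ)
      = 1 / 2 * fullContr5 (invMetricC g x) (weylCDeriv g x) (weylCDeriv g x) := by
  rw [I3, I4, ofReal_contract5, ofReal_contract5]
  exact contr_re_add_im _ rfl rfl h1 h2

theorem I3a_add_I4a (h1 : swapContr5 (invMetricC g x) (weylCDeriv g x) (weylCDerivConj g x) = 0)
    (h2 : swapContr5 (invMetricC g x) (weylCDerivConj g x) (weylCDeriv g x) = 0) :
    (I3a g x : ℂ) + Complex.I * (I4a g x : ℂ)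
      = 1 / 2 * swapContr5 (invMetricC g x) (weylCDeriv g x) (weylCDeriv g x) := by
  rw [I3a, I4a, ofReal_contract5swap, ofReal_contract5swap]
  exact contr_re_add_im _ rfl rfl h1 h2

theorem covContr_eq_sum (G : Matrix (Fin 4) (Fin 4) ℂ) (p q : Fin 4 → ℂ) :
    covContr G p q = ∑ a, ∑ b, G a b * p a * q b := by
  simp only [covContr, dotProduct, Matrix.mulVec, Finset.mul_sum]
  exact Finset.sum_congr rfl fun _ _ => Finset.sum_congr rfl fun _ _ => by ring

/-- `J_ergo` as the real part of one complex invariant. -/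
theorem Jergo_eq_re {I W Wa : ℂ} {F : Coords → ℂ} (hF : DifferentiableAt ℝ F x)
    (hI : ∀ᶠ y in 𝓝 x, (I1 g y : ℂ) + Complex.I * (I2 g y : ℂ) = F y) (hIx : F x = I)
    (hW : (I3 g x : ℂ) + Complex.I * (I4 g x : ℂ) = W)
    (hWa : (I3a g x : ℂ) + Complex.I * (I4a g x : ℂ) = Wa) :
    Jergo g x = -(6 * I * W - 16 * I * Wa
      + covContr (invMetricC g x) (fun a => pd a F x) (fun a => pd a F x)).re / 6912 := by
  have h1 : I1 g =ᶠ[𝓝 x] fun y => (F y).re := by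
    filter_upwards [hI] with y hy
    rw [← hy]; simp
  have h2 : I2 g =ᶠ[𝓝 x] fun y => (F y).im := by
    filter_upwards [hI] with y hy
    rw [← hy]; simp
  have h3 : ∀ a, pd a (I1 g) x = (pd a F x).re := fun a => by
    rw [pd_congr h1, pd_re hF]
  have h4 : ∀ a, pd a (I2 g) x = (pd a F x).im := fun a => by
    rw [pd_congr h2, pd_im hF]
  -- Since Re(z z') = Re z Re z' - Im z Im z', the real part of a complex product appears as a
  -- difference. This matches the opposite signs of J₄ and K₄ in J₊ and J₋.
  have h5 : I5 g x - I6 g x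
      = (covContr (invMetricC g x) (fun a => pd a F x) (fun a => pd a F x)).re := by
    simp only [I5, I6, gradSq, h3, h4, covContr_eq_sum, Complex.re_sum, ← Finset.sum_sub_distrib]
    refine Finset.sum_congr rfl fun a _ => Finset.sum_congr rfl fun b _ => ?_
    simp [invMetricC, Matrix.of_apply, Complex.mul_re, Complex.mul_im]
  have h6 : I = (I1 g x : ℂ) + Complex.I * (I2 g x : ℂ) := by rw [← hIx, hI.self_of_nhds]
  subst hW hWa h6
  simp only [Complex.add_re, ← h5]
  simp [Jergo, Jplus, Jminus, J4, K4, Complex.mul_re, Complex.mul_im]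
  ring

end ComplexInvariants

/-! ### Type D metrics with an integrable pair of null congruences -/

section TypeD

open Matrix

/-- The connection matrix `ω^i_j` in a null frame `(ℓ, n, m, m̃)`, in terms of
`A = ω_{ℓn}`, `B = ω_{mm̃}`, `N = ω_{nm̃}`, `L = ω_{ℓm}`, `N' = ω_{nm}`, `L' = ω_{ℓm̃}`. -/
def connMat (A B N L N' L' : ℂ) : Matrix (Fin 4) (Fin 4) ℂ :=
  !![A, 0, -N', -N; 0, -A, -L, -L'; -L', -N, -B, 0; -L, -N', 0, B]

theorem connMat_antisymm (A B N L N' L' : ℂ) :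
    (connMat A B N L N' L')ᵀ * nullEta + nullEta * connMat A B N L N' L' = 0 := by
  ext i j
  fin_cases i <;> fin_cases j <;>
    simp [connMat, nullEta, Matrix.mul_apply, Fin.sum_univ_four]

/-- The complexified Lorentz algebra is a sum of two copies of sl₂. Only the copy with coordinates A
- B, N, L acts on the span of X, Y, Z. -/
theorem connMat_bivX (A B N L N' L' : ℂ) :
    (connMat A B N L N' L')ᵀ * bivX + bivX * connMat A B N L N' L'
      = (A - B) • bivX - N • bivZ := by
  ext i j
  fin_cases i <;> fin_cases j <;>
    simp [connMat, bivX, bivZ, Matrix.mul_apply, Fin.sum_univ_four] <;> ring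

theorem connMat_bivY (A B N L N' L' : ℂ) :
    (connMat A B N L N' L')ᵀ * bivY + bivY * connMat A B N L N' L'
      = (B - A) • bivY + L • bivZ := by
  ext i j
  fin_cases i <;> fin_cases j <;>
    simp [connMat, bivY, bivZ, Matrix.mul_apply, Fin.sum_univ_four] <;> ring

theorem connMat_bivZ (A B N L N' L' : ℂ) :
    (connMat A B N L N' L')ᵀ * bivZ + bivZ * connMat A B N L N' L'
      = (2 * N) • bivY - (2 * L) • bivX := by
  ext i j
  fin_cases i <;> fin_cases j <;>
    simp [connMat, bivX, bivY, bivZ, Matrix.mul_apply, Fin.sum_univ_four] <;> ring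

/-- The left side is the connection matrix after g ↦ e^{2U}g, with u the components of dU and ε the
frame components of a coordinate vector. The frame is kept rather than rescaled, which accounts for
the multiple of the identity. N and L are shifted by the same combinations of covectors through
which ξ will enter them, so only u - ξ remains. -/
theorem connMat_conformal (A B N L N' L' k : ℂ) (ε u : Fin 4 → ℂ) :
    connMat A B N L N' L' + vecMulVec ε u + k • (1 : Matrix (Fin 4) (Fin 4) ℂ)
      - vecMulVec (nullEta *ᵥ u) (nullEta *ᵥ ε)
    = connMat (A - ε 1 * u 1 + ε 0 * u 0) (B + ε 3 * u 3 - ε 2 * u 2)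
        (N - ε 0 * u 3 - ε 2 * u 1) (L - ε 1 * u 2 - ε 3 * u 0)
        (N' - ε 0 * u 2 - ε 3 * u 1) (L' - ε 1 * u 3 - ε 2 * u 0)
      + k • (1 : Matrix (Fin 4) (Fin 4) ℂ) := by
  ext i j
  fin_cases i <;> fin_cases j <;>
    simp [connMat, nullEta, vecMulVec_apply, dotProduct, Fin.sum_univ_four] <;> ring

variable {g g' : MetricField} {E : Coords → Matrix (Fin 4) (Fin 4) ℂ} {x : Coords}

/-- The moving frame of `g` with respect to the Levi-Civita connection of a conformal metric. -/
theorem pdMat_eq_conformal {η e : Matrix (Fin 4) (Fin 4) ℂ} {W : Fin 4 → Matrix (Fin 4) (Fin 4) ℂ}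
    {U : Coords → ℝ} {u : Fin 4 → ℂ}
    (hg : metricC g x = (E x)ᵀ * η * E x) (he : E x * e = 1) (hη : η * η = 1) (hηt : ηᵀ = η)
    (hstr : ∀ c, pdMat c E x = E x * christoffelMat g x c - W c * E x)
    (hΓ : ∀ a b c, christoffel g' x a b c = christoffel g x a b c
      + ((if a = b then pd c U x else 0) + (if a = c then pd b U x else 0)
        - g x b c * gradUp g U x a))
    (hu : ∀ a, ((pd a U x : ℝ) : ℂ) = (u ᵥ* E x) a) (c : Fin 4) :
    pdMat c E x = E x * christoffelMat g' x c
      - (W c + vecMulVec (fun i => E x i c) u + ((pd c U x : ℝ) : ℂ) • 1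
        - vecMulVec (η *ᵥ u) (η *ᵥ fun i => E x i c)) * E x := by
  have hG := invMetricC_eq_of_frame hg he hη
  have hEt : eᵀ * (E x)ᵀ = 1 := by rw [← transpose_mul, he, transpose_one]
  have h1 : E x *ᵥ (fun a => (gradUp g U x a : ℂ)) = η *ᵥ u := by
    have h2 : (fun a => (gradUp g U x a : ℂ)) = invMetricC g x *ᵥ (u ᵥ* E x) := by
      funext a
      simp only [gradUp, Complex.ofReal_sum, Complex.ofReal_mul, mulVec, dotProduct, ← hu]
      rfl
    rw [h2, ← mulVec_transpose, mulVec_mulVec, mulVec_mulVec, hG]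
    congr 1
    calc E x * (e * η * eᵀ) * (E x)ᵀ = (E x * e) * η * (eᵀ * (E x)ᵀ) := by
          simp only [Matrix.mul_assoc]
      _ = η := by rw [he, hEt, Matrix.one_mul, Matrix.mul_one]
  have h3 : christoffelMat g' x c = christoffelMat g x c
      + (vecMulVec (Pi.single c 1) (u ᵥ* E x) + ((pd c U x : ℝ) : ℂ) • 1
        - vecMulVec (fun a => (gradUp g U x a : ℂ)) (metricC g x c)) := by
    ext a b
    simp only [christoffelMat, of_apply, hΓ, Matrix.add_apply, Matrix.sub_apply, vecMulVec_apply,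
      Matrix.smul_apply, Matrix.one_apply, smul_eq_mul, metricC, Pi.single_apply, ← hu]
    push_cast
    split_ifs <;> simp <;> ring
  have h4 : (η *ᵥ fun i => E x i c) ᵥ* E x = metricC g x c := by
    rw [hg]
    funext b
    have hs : ∀ i j, η i j = η j i := fun i j => congrFun (congrFun hηt j) i
    simp only [vecMul, mulVec, dotProduct, Matrix.mul_apply, transpose_apply]
    exact Finset.sum_congr rfl fun i _ => by
      congr 1
      exact Finset.sum_congr rfl fun j _ => by rw [hs i j, mul_comm]
  have h5 : E x *ᵥ (Pi.single c 1) = fun i => E x i c := by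
    funext i; simp [mulVec_single]
  rw [hstr c, h3]
  simp only [Matrix.mul_add, Matrix.mul_sub, Matrix.add_mul, Matrix.sub_mul, mul_vecMulVec,
    vecMulVec_mul, h1, h4, h5, Matrix.mul_smul, Matrix.smul_mul, Matrix.mul_one, Matrix.one_mul]
  abel

/-- Substituting the structure equation for both factors E separates the Christoffel terms, which a
covariant derivative removes, from the action of W on the constant bivector σ. -/
theorem pd_bivector {W Γ : Fin 4 → Matrix (Fin 4) (Fin 4) ℂ}
    (hE : ∀ i a, DifferentiableAt ℝ (fun y => E y i a) x)
    (hstr : ∀ c, pdMat c E x = E x * Γ c - W c * E x) (σ : Matrix (Fin 4) (Fin 4) ℂ) (c : Fin 4) :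
    pdMat c (fun y => (E y)ᵀ * σ * E y) x
      = (Γ c)ᵀ * ((E x)ᵀ * σ * E x) + ((E x)ᵀ * σ * E x) * Γ c
        - (E x)ᵀ * ((W c)ᵀ * σ + σ * W c) * E x := by
  have h1 : pdMat c (fun y => (E y)ᵀ * σ) x = (pdMat c E x)ᵀ * σ := by
    rw [pdMat_mul (M := fun y => (E y)ᵀ) (N := fun _ => σ) (fun i j => hE j i)
      (fun i j => differentiableAt_const _)]
    have h2 : pdMat c (fun _ : Coords => σ) x = 0 := by
      ext i j; exact pd_const c (σ i j) x
    rw [h2, Matrix.mul_zero, add_zero]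
    rfl
  rw [pdMat_mul (M := fun y => (E y)ᵀ * σ) (N := E) _ hE, h1, hstr c]
  · simp only [transpose_sub, transpose_mul, Matrix.mul_sub, Matrix.sub_mul, Matrix.mul_add,
      Matrix.add_mul, Matrix.mul_assoc]
    abel
  · intro i j
    simp only [Matrix.mul_apply, transpose_apply]
    exact DifferentiableAt.fun_sum fun k _ => (hE k i).mul_const _

end TypeD

/-! ### The invariants of a metric conformal to one of type D. -/

section TypeDInvariants

open Matrix

variable {g g' : MetricField} {E e : Coords → Matrix (Fin 4) (Fin 4) ℂ} {x : Coords}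
  {ψ : Coords → ℂ} {U : Coords → ℝ} {Ω : Set Coords}

theorem sum_christoffel_typeD (Γ X Y Z : Matrix (Fin 4) (Fin 4) ℂ) (k : ℂ) (a b c d : Fin 4) :
    ∑ f, (Γ f a * (k * typeD X Y Z f b c d) + Γ f b * (k * typeD X Y Z a f c d)
      + Γ f c * (k * typeD X Y Z a b f d) + Γ f d * (k * typeD X Y Z a b c f))
    = k * ((Γᵀ * X + X * Γ) a b * Y c d + X a b * (Γᵀ * Y + Y * Γ) c d
      + (Γᵀ * Y + Y * Γ) a b * X c d + Y a b * (Γᵀ * X + X * Γ) c d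
      - (Γᵀ * Z + Z * Γ) a b * Z c d - Z a b * (Γᵀ * Z + Z * Γ) c d) := by
  simp only [typeD, Matrix.add_apply, Matrix.mul_apply, transpose_apply, Finset.sum_mul,
    Finset.mul_sum, ← Finset.sum_add_distrib, ← Finset.sum_sub_distrib]
  exact Finset.sum_congr rfl fun f _ => by ring

theorem differentiableAt_bivector (hE : ∀ i a, DifferentiableAt ℝ (fun y => E y i a) x)
    (σ : Matrix (Fin 4) (Fin 4) ℂ) (a b : Fin 4) :
    DifferentiableAt ℝ (fun y => ((E y)ᵀ * σ * E y) a b) x := by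
  simp only [Matrix.mul_apply, transpose_apply]
  exact DifferentiableAt.fun_sum fun k _ =>
    (DifferentiableAt.fun_sum fun j _ => (hE j a).mul_const _).mul (hE k b)

/-- The covariant derivative of the complex Weyl tensor of type D. -/
theorem weylCDeriv_eq_typeDDeriv {A B N L N' L' : Fin 4 → ℂ} {φ : Coords → ℂ} {υ : Fin 4 → ℂ}
    (hE : ∀ i a, DifferentiableAt ℝ (fun y => E y i a) x) (hφ : DifferentiableAt ℝ φ x)
    (hstr : ∀ c, pdMat c E x = E x * christoffelMat g x c
      - (connMat (A c) (B c) (N c) (L c) (N' c) (L' c) + υ c • 1) * E x)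
    (hC : ∀ᶠ y in 𝓝 x, ∀ a b c d, weylC g y a b c d = φ y * typeD ((E y)ᵀ * bivX * E y)
      ((E y)ᵀ * bivY * E y) ((E y)ᵀ * bivZ * E y) a b c d) :
    weylCDeriv g x = typeDDeriv ((E x)ᵀ * bivX * E x) ((E x)ᵀ * bivY * E x)
      ((E x)ᵀ * bivZ * E x) (fun c => pd c φ x - 4 * φ x * υ c) (fun c => φ x * N c)
      (fun c => φ x * L c) := by
  set X : Coords → Matrix (Fin 4) (Fin 4) ℂ := fun y => (E y)ᵀ * bivX * E y with hX
  set Y : Coords → Matrix (Fin 4) (Fin 4) ℂ := fun y => (E y)ᵀ * bivY * E y with hY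
  set Z : Coords → Matrix (Fin 4) (Fin 4) ℂ := fun y => (E y)ᵀ * bivZ * E y with hZ
  have hXd : ∀ a b, DifferentiableAt ℝ (fun y => X y a b) x := differentiableAt_bivector hE bivX
  have hYd : ∀ a b, DifferentiableAt ℝ (fun y => Y y a b) x := differentiableAt_bivector hE bivY
  have hZd : ∀ a b, DifferentiableAt ℝ (fun y => Z y a b) x := differentiableAt_bivector hE bivZ
  have hW : ∀ c (σ : Matrix (Fin 4) (Fin 4) ℂ),
      (connMat (A c) (B c) (N c) (L c) (N' c) (L' c) + υ c • 1)ᵀ * σ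
        + σ * (connMat (A c) (B c) (N c) (L c) (N' c) (L' c) + υ c • 1)
      = ((connMat (A c) (B c) (N c) (L c) (N' c) (L' c))ᵀ * σ
        + σ * connMat (A c) (B c) (N c) (L c) (N' c) (L' c)) + (2 * υ c) • σ := by
    intro c σ
    simp only [transpose_add, transpose_smul, transpose_one, Matrix.add_mul, Matrix.mul_add,
      Matrix.smul_mul, Matrix.mul_smul, Matrix.one_mul, Matrix.mul_one, two_mul, add_smul]
    abel
  -- X and Y have opposite weights under A - B and Z has weight zero, so A and B cancel in XY + YX -
  -- ZZ. The trace part contributes -2υ per bivector, hence -4υ in total.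
  have hX' : ∀ c a b, pd c (fun y => X y a b) x
      = ((christoffelMat g x c)ᵀ * X x + X x * christoffelMat g x c) a b
        + ((B c - A c - 2 * υ c) * X x a b + N c * Z x a b) := by
    intro c a b
    have := congrFun (congrFun (pd_bivector hE hstr bivX c) a) b
    rw [hW, connMat_bivX] at this
    simp only [pdMat, of_apply, Matrix.mul_add, Matrix.mul_sub, Matrix.add_mul, Matrix.sub_mul,
      Matrix.mul_smul, Matrix.smul_mul, Matrix.add_apply, Matrix.sub_apply, Matrix.smul_apply,
      smul_eq_mul] at this
    simp only [hX, hZ, Matrix.add_apply, this]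
    ring
  have hY' : ∀ c a b, pd c (fun y => Y y a b) x
      = ((christoffelMat g x c)ᵀ * Y x + Y x * christoffelMat g x c) a b
        + ((A c - B c - 2 * υ c) * Y x a b - L c * Z x a b) := by
    intro c a b
    have := congrFun (congrFun (pd_bivector hE hstr bivY c) a) b
    rw [hW, connMat_bivY] at this
    simp only [pdMat, of_apply, Matrix.mul_add, Matrix.add_mul,
      Matrix.mul_smul, Matrix.smul_mul, Matrix.add_apply, Matrix.sub_apply, Matrix.smul_apply,
      smul_eq_mul] at this
    simp only [hY, hZ, Matrix.add_apply, this]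
    ring
  have hZ' : ∀ c a b, pd c (fun y => Z y a b) x
      = ((christoffelMat g x c)ᵀ * Z x + Z x * christoffelMat g x c) a b
        + (2 * L c * X x a b - 2 * N c * Y x a b - 2 * υ c * Z x a b) := by
    intro c a b
    have := congrFun (congrFun (pd_bivector hE hstr bivZ c) a) b
    rw [hW, connMat_bivZ] at this
    simp only [pdMat, of_apply, Matrix.mul_add, Matrix.mul_sub, Matrix.add_mul, Matrix.sub_mul,
      Matrix.mul_smul, Matrix.smul_mul, Matrix.add_apply, Matrix.sub_apply, Matrix.smul_apply,
      smul_eq_mul] at this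
    simp only [hX, hY, hZ, Matrix.add_apply, this]
    ring
  have hTd : ∀ a b c d, DifferentiableAt ℝ (fun y => typeD (X y) (Y y) (Z y) a b c d) x :=
    fun a b c d => (((hXd a b).mul (hYd c d)).add ((hYd a b).mul (hXd c d))).sub
      ((hZd a b).mul (hZd c d))
  have hT : ∀ a b c d i, pd i (fun y => typeD (X y) (Y y) (Z y) a b c d) x
      = pd i (fun y => X y a b) x * Y x c d + X x a b * pd i (fun y => Y y c d) x
        + (pd i (fun y => Y y a b) x * X x c d + Y x a b * pd i (fun y => X y c d) x)
        - (pd i (fun y => Z y a b) x * Z x c d + Z x a b * pd i (fun y => Z y c d) x) := by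
    intro a b c d i
    simp only [typeD]
    rw [pd_sub (((hXd a b).fun_mul (hYd c d)).fun_add ((hYd a b).fun_mul (hXd c d)))
        ((hZd a b).fun_mul (hZd c d)),
      pd_add ((hXd a b).fun_mul (hYd c d)) ((hYd a b).fun_mul (hXd c d)),
      pd_mul (hXd a b) (hYd c d), pd_mul (hYd a b) (hXd c d), pd_mul (hZd a b) (hZd c d)]
  have hre : ∀ a b c d, (fun y => weyl g y a b c d)
      =ᶠ[𝓝 x] fun y => (φ y * typeD (X y) (Y y) (Z y) a b c d).re := by
    intro a b c d
    filter_upwards [hC] with y hy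
    rw [← hy a b c d, weylC]; simp
  have him : ∀ a b c d, (fun y => weylDual g y a b c d)
      =ᶠ[𝓝 x] fun y => (φ y * typeD (X y) (Y y) (Z y) a b c d).im := by
    intro a b c d
    filter_upwards [hC] with y hy
    rw [← hy a b c d, weylC]; simp
  have hpd : ∀ a b c d i, ((pd i (fun y => weyl g y a b c d) x : ℝ) : ℂ)
      + Complex.I * ((pd i (fun y => weylDual g y a b c d) x : ℝ) : ℂ)
      = pd i φ x * typeD (X x) (Y x) (Z x) a b c d
        + φ x * pd i (fun y => typeD (X y) (Y y) (Z y) a b c d) x := by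
    intro a b c d i
    rw [pd_congr (hre a b c d), pd_congr (him a b c d), pd_re (hφ.fun_mul (hTd a b c d)),
      pd_im (hφ.fun_mul (hTd a b c d)), mul_comm Complex.I, Complex.re_add_im,
      pd_mul hφ (hTd a b c d)]
  funext a b c d i
  have hsum := sum_christoffel_typeD (christoffelMat g x i) (X x) (Y x) (Z x) (φ x) a b c d
  have hC0 : ∀ a b c d, weylC g x a b c d = φ x * typeD (X x) (Y x) (Z x) a b c d :=
    hC.self_of_nhds
  simp only [← hC0] at hsum
  have hexp : weylCDeriv g x a b c d i
      = ((pd i (fun y => weyl g y a b c d) x : ℝ) : ℂ)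
      + Complex.I * ((pd i (fun y => weylDual g y a b c d) x : ℝ) : ℂ)
      - ∑ f, (christoffelMat g x i f a * weylC g x f b c d
        + christoffelMat g x i f b * weylC g x a f c d
        + christoffelMat g x i f c * weylC g x a b f d
        + christoffelMat g x i f d * weylC g x a b c f) := by
    simp only [weylCDeriv, covDeriv4, weylC, christoffelMat, of_apply, Complex.ofReal_sub,
      Complex.ofReal_sum, Complex.ofReal_add, Complex.ofReal_mul, mul_sub, Finset.mul_sum]
    rw [sub_add_sub_comm, ← Finset.sum_add_distrib]
    congr 1
    exact Finset.sum_congr rfl fun f _ => by ring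
  -- XY + YX contributes each N and L term once and -ZZ contributes it twice. This is the factor 3
  -- in `typeDDeriv`.
  rw [hexp, hsum, hpd, hT]
  simp only [hX', hY', hZ', typeDDeriv, typeD]
  ring

/-- Invariance under boosts and complex spins. It absorbs the factor by which m̃ differs from the
conjugate of m. -/
theorem typeD_scale {X Y Z : Matrix (Fin 4) (Fin 4) ℂ} {k : ℂ} (hk : k ≠ 0) :
    typeD (k • X) (k⁻¹ • Y) Z = typeD X Y Z := by
  funext a b c d
  simp only [typeD, Matrix.smul_apply, smul_eq_mul]
  field_simp

theorem typeDDeriv_scale {X Y Z : Matrix (Fin 4) (Fin 4) ℂ} {k : ℂ} (hk : k ≠ 0)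
    (u N L : Fin 4 → ℂ) :
    typeDDeriv (k • X) (k⁻¹ • Y) Z u N L = typeDDeriv X Y Z u (k⁻¹ • N) (k • L) := by
  funext a b c d e
  simp only [typeDDeriv, typeD, Matrix.smul_apply, Pi.smul_apply, smul_eq_mul]
  field_simp

/-- Self-dual and anti-self-dual bivectors are orthogonal. -/
structure BivOrthogonal (G X Y Z X' Y' Z' : Matrix (Fin 4) (Fin 4) ℂ) : Prop where
  hX : ∀ t ∈ [X', Y', Z'], formContr G X t = 0
  hY : ∀ t ∈ [X', Y', Z'], formContr G Y t = 0
  hZ : ∀ t ∈ [X', Y', Z'], formContr G Z t = 0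

variable {G X Y Z X' Y' Z' : Matrix (Fin 4) (Fin 4) ℂ}

theorem BivOrthogonal.fullContr4_eq_zero (h : BivOrthogonal G X Y Z X' Y' Z') :
    fullContr4 G (typeD X Y Z) (typeD X' Y' Z') = 0 := by
  have hd : ∀ X Y Z : Matrix (Fin 4) (Fin 4) ℂ, typeD X Y Z = (fun a b c d => X a b * Y c d)
      + (fun a b c d => Y a b * X c d) - (fun a b c d => Z a b * Z c d) := fun _ _ _ => rfl
  obtain ⟨h1, h2, h3⟩ := h
  simp only [List.forall_mem_cons, List.not_mem_nil, false_implies, implies_true, and_true]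
    at h1 h2 h3
  simp [hd, fullContr4_tmul, h1, h2, h3]

theorem BivOrthogonal.fullContr5_eq_zero (h : BivOrthogonal G X Y Z X' Y' Z')
    (u N L u' N' L' : Fin 4 → ℂ) :
    fullContr5 G (typeDDeriv X Y Z u N L) (typeDDeriv X' Y' Z' u' N' L') = 0 := by
  obtain ⟨h1, h2, h3⟩ := h
  simp only [List.forall_mem_cons, List.not_mem_nil, false_implies, implies_true, and_true]
    at h1 h2 h3
  simp [typeDDeriv_eq, fullContr5_tens, h1, h2, h3]

theorem BivOrthogonal.swapContr5_eq_zero (h : BivOrthogonal G X Y Z X' Y' Z')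
    (u N L u' N' L' : Fin 4 → ℂ) :
    swapContr5 G (typeDDeriv X Y Z u N L) (typeDDeriv X' Y' Z' u' N' L') = 0 := by
  obtain ⟨h1, h2, h3⟩ := h
  simp only [List.forall_mem_cons, List.not_mem_nil, false_implies, implies_true, and_true]
    at h1 h2 h3
  simp [typeDDeriv_eq, swapContr5_tens, h1, h2, h3]

theorem bivOrthogonal_frame {E : Matrix (Fin 4) (Fin 4) ℂ} (hG : E * G * Eᵀ = nullEta) :
    BivOrthogonal G (Eᵀ * bivX * E) (Eᵀ * bivY * E) (Eᵀ * bivZ * E)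
      (Eᵀ * bivX' * E) (Eᵀ * bivY' * E) (Eᵀ * bivZ' * E) ∧
    BivOrthogonal G (Eᵀ * bivX' * E) (Eᵀ * bivY' * E) (Eᵀ * bivZ' * E)
      (Eᵀ * bivX * E) (Eᵀ * bivY * E) (Eᵀ * bivZ * E) := by
  obtain ⟨h1, h2⟩ := formContr_self_dual_antiself_dual
  simp only [List.forall_mem_cons, List.not_mem_nil, false_implies, implies_true, and_true]
    at h1 h2
  constructor <;> constructor <;>
    simp [formContr_frame, hG, h1, h2]

/-- The complex frame is compatible with complex conjugation: `ℓ`, `n` are real and `m̄`, `m̃` are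
proportional. -/
def IsConjFrame (E : Matrix (Fin 4) (Fin 4) ℂ) : Prop :=
  ∃ k : ℂ, k ≠ 0 ∧ ∀ a b,
    (starRingEnd ℂ) ((Eᵀ * bivX * E) a b) = (k • (Eᵀ * bivX' * E)) a b ∧
    (starRingEnd ℂ) ((Eᵀ * bivY * E) a b) = (k⁻¹ • (Eᵀ * bivY' * E)) a b ∧
    (starRingEnd ℂ) ((Eᵀ * bivZ * E) a b) = (Eᵀ * bivZ' * E) a b

theorem weylCConj_eq (g : MetricField) (x : Coords) : weylCConj g x
    = fun a b c d => (starRingEnd ℂ) (weylC g x a b c d) := by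
  funext a b c d
  simp only [weylC, weylCConj, map_add, map_mul, Complex.conj_I, Complex.conj_ofReal]
  ring

theorem weylCDerivConj_eq (g : MetricField) (x : Coords) : weylCDerivConj g x
    = fun a b c d e => (starRingEnd ℂ) (weylCDeriv g x a b c d e) := by
  funext a b c d e
  simp only [weylCDeriv, weylCDerivConj, map_add, map_mul, Complex.conj_I, Complex.conj_ofReal]
  ring

theorem conj_typeD {E : Matrix (Fin 4) (Fin 4) ℂ} (hE : IsConjFrame E) (a b c d : Fin 4) :
    (starRingEnd ℂ) (typeD (Eᵀ * bivX * E) (Eᵀ * bivY * E) (Eᵀ * bivZ * E) a b c d)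
      = typeD (Eᵀ * bivX' * E) (Eᵀ * bivY' * E) (Eᵀ * bivZ' * E) a b c d := by
  obtain ⟨k, hk, h⟩ := hE
  rw [← typeD_scale (X := Eᵀ * bivX' * E) hk]
  simp only [typeD, map_sub, map_add, map_mul, (h _ _).1, (h _ _).2.1, (h _ _).2.2]

theorem conj_typeDDeriv {E : Matrix (Fin 4) (Fin 4) ℂ} (hE : IsConjFrame E)
    (u N L : Fin 4 → ℂ) : ∃ u' N' L' : Fin 4 → ℂ,
    (fun a b c d e => (starRingEnd ℂ)
      (typeDDeriv (Eᵀ * bivX * E) (Eᵀ * bivY * E) (Eᵀ * bivZ * E) u N L a b c d e))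
      = typeDDeriv (Eᵀ * bivX' * E) (Eᵀ * bivY' * E) (Eᵀ * bivZ' * E) u' N' L' := by
  obtain ⟨k, hk, h⟩ := hE
  refine ⟨fun e => (starRingEnd ℂ) (u e), k⁻¹ • fun e => (starRingEnd ℂ) (N e),
    k • fun e => (starRingEnd ℂ) (L e), ?_⟩
  rw [← typeDDeriv_scale (X := Eᵀ * bivX' * E) hk]
  funext a b c d e
  simp only [typeDDeriv, typeD, map_sub, map_add, map_mul, map_ofNat, (h _ _).1, (h _ _).2.1,
    (h _ _).2.2]

/-- The invariant `J_ergo` of a metric conformal to a type D metric. The one-form `ξ` describes the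
derivatives of the two null congruences, and the amplitude `ψ` of the Weyl tensor satisfies the
Bianchi identity `dψ = 3 ψ ξ`. -/
theorem Jergo_conformal_typeD {A B N L N' L' ξ : Fin 4 → ℂ}
    (hΩ : IsOpen Ω) (hx : x ∈ Ω)
    (hg : ∀ y ∈ Ω, metricC g y = (E y)ᵀ * nullEta * E y) (he : ∀ y ∈ Ω, E y * e y = 1)
    (hgd : ∀ a b, DifferentiableAt ℝ (fun y => g y a b) x)
    (hE : ∀ i a, DifferentiableAt ℝ (fun y => E y i a) x)
    (hconj : ∀ y ∈ Ω, IsConjFrame (E y))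
    (hU : DifferentiableAt ℝ U x) (hψ : DifferentiableAt ℝ ψ x)
    (hg' : ∀ y ∈ Ω, g' y = Real.exp (2 * U y) • g y)
    (hstr : ∀ c, pdMat c E x = E x * christoffelMat g x c
      - connMat (A c) (B c) (N c) (L c) (N' c) (L' c) * E x)
    (hN : ∀ c, N c = ξ 3 * E x 0 c + ξ 1 * E x 2 c)
    (hL : ∀ c, L c = ξ 2 * E x 1 c + ξ 0 * E x 3 c)
    (hdψ : ∀ c, pd c ψ x = 3 * ψ x * (ξ ᵥ* E x) c)
    (hC : ∀ y ∈ Ω, ∀ a b c d, weylC g' y a b c d = -2 * (Real.exp (2 * U y) : ℂ) * ψ y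
      * typeD ((E y)ᵀ * bivX * E y) ((E y)ᵀ * bivY * E y) ((E y)ᵀ * bivZ * E y) a b c d) :
    Jergo g' x = Real.exp (-10 * U x) * (-2 * (ψ x ^ 4 * covContr nullEta ξ ξ).re) := by
  have hdet : ∀ y ∈ Ω, (g y).det ≠ 0 := fun y hy =>
    det_ne_zero_of_frame (hg y hy) (he y hy) nullEta_mul_self
  have hG : ∀ y ∈ Ω, invMetricC g y = e y * nullEta * (e y)ᵀ := fun y hy =>
    invMetricC_eq_of_frame (hg y hy) (he y hy) nullEta_mul_self
  have hEG : ∀ y ∈ Ω, E y * invMetricC g y * (E y)ᵀ = nullEta := by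
    intro y hy
    have h1 : (e y)ᵀ * (E y)ᵀ = 1 := by rw [← transpose_mul, he y hy, transpose_one]
    calc E y * invMetricC g y * (E y)ᵀ = (E y * e y) * nullEta * ((e y)ᵀ * (E y)ᵀ) := by
          rw [hG y hy]; simp only [Matrix.mul_assoc]
      _ = nullEta := by rw [he y hy, h1, Matrix.one_mul, Matrix.mul_one]
  have hG' : ∀ y ∈ Ω, invMetricC g' y = (Real.exp (-2 * U y) : ℂ) • invMetricC g y := by
    intro y hy
    ext a b
    simp only [invMetricC, of_apply, Matrix.smul_apply, smul_eq_mul,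
      invMetric_conformal (hg' y hy) (hdet y hy), Complex.ofReal_mul]
  set u : Fin 4 → ℂ := (fun a => ((pd a U x : ℝ) : ℂ)) ᵥ* e x with hudef
  have heE : e x * E x = 1 := mul_eq_one_comm.mp (he x hx)
  have hu : ∀ a, ((pd a U x : ℝ) : ℂ) = (u ᵥ* E x) a := by
    intro a
    rw [hudef, vecMul_vecMul, heE, vecMul_one]
  have hexpd : DifferentiableAt ℝ (fun y => Real.exp (2 * U y)) x := by fun_prop
  set φ : Coords → ℂ := fun y => -2 * (Real.exp (2 * U y) : ℂ) * ψ y with hφdef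
  have hφ : DifferentiableAt ℝ φ x :=
    ((differentiableAt_const _).mul (differentiableAt_ofReal hexpd)).mul hψ
  have hpdexp : ∀ (k : ℝ) c, pd c (fun y => ((Real.exp (k * U y) : ℝ) : ℂ)) x
      = k * (Real.exp (k * U x) : ℂ) * ((pd c U x : ℝ) : ℂ) := by
    intro k c
    have hd : DifferentiableAt ℝ (fun y => Real.exp (k * U y)) x := by fun_prop
    rw [pd_ofReal hd]
    have h1 : pd c (fun y => Real.exp (k * U y)) x = k * Real.exp (k * U x) * pd c U x := by
      have := ((hU.hasFDerivAt.const_mul k).exp).fderiv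
      rw [pd, this]
      simp [pd]; ring
    rw [h1]; push_cast; ring
  have hpdφ : ∀ c, pd c φ x = φ x * (3 * (ξ ᵥ* E x) c + 2 * (u ᵥ* E x) c) := by
    intro c
    have hd1 : DifferentiableAt ℝ (fun y => (Real.exp (2 * U y) : ℂ)) x :=
      differentiableAt_ofReal hexpd
    simp only [hφdef]
    rw [pd_mul (hd1.const_mul (-2)) hψ, pd_const_mul hd1, hpdexp, hdψ, hu]
    push_cast
    ring
  have hstr' : ∀ c, pdMat c E x = E x * christoffelMat g' x c
      - (connMat (A c - E x 1 c * u 1 + E x 0 c * u 0) (B c + E x 3 c * u 3 - E x 2 c * u 2)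
        (N c - E x 0 c * u 3 - E x 2 c * u 1) (L c - E x 1 c * u 2 - E x 3 c * u 0)
        (N' c - E x 0 c * u 2 - E x 3 c * u 1) (L' c - E x 1 c * u 3 - E x 2 c * u 0)
        + ((pd c U x : ℝ) : ℂ) • 1) * E x := by
    intro c
    have h := pdMat_eq_conformal (hg x hx) (he x hx) nullEta_mul_self nullEta_transpose hstr
      (fun a b c => christoffel_conformal hΩ hx hgd (hdet x hx) hU hg' a b c) hu c
    rwa [connMat_conformal] at h
  have hCe : ∀ᶠ y in 𝓝 x, ∀ a b c d, weylC g' y a b c d = φ y * typeD ((E y)ᵀ * bivX * E y)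
      ((E y)ᵀ * bivY * E y) ((E y)ᵀ * bivZ * E y) a b c d := by
    filter_upwards [hΩ.mem_nhds hx] with y hy using hC y hy
  have hD0 := weylCDeriv_eq_typeDDeriv hE hφ hstr' hCe
  -- The logarithmic gradient of the amplitude is 3ξ + 2u, and the trace part of the connection
  -- subtracts 4u, which leaves the 3ξ - 2u in v. In N and L the covector ξ is replaced by ξ - u =
  -- -w.
  set w : Fin 4 → ℂ := u - ξ with hw
  set v : Fin 4 → ℂ := φ x • ((3 : ℂ) • ξ - (2 : ℂ) • u) with hv
  have hD : weylCDeriv g' x = typeDDeriv ((E x)ᵀ * bivX * E x) ((E x)ᵀ * bivY * E x)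
      ((E x)ᵀ * bivZ * E x) (v ᵥ* E x) ((φ x • ![-w 3, 0, -w 1, 0]) ᵥ* E x)
      ((φ x • ![0, -w 2, 0, -w 0]) ᵥ* E x) := by
    rw [hD0]
    congr 1
    · funext c
      rw [hpdφ, hu, hv, smul_vecMul, sub_vecMul, smul_vecMul, smul_vecMul]
      simp only [Pi.smul_apply, Pi.sub_apply, smul_eq_mul]
      ring
    · funext c
      rw [smul_vecMul]
      simp only [hN, hw, vecMul, dotProduct, Fin.sum_univ_four, Pi.smul_apply, smul_eq_mul,
        Pi.sub_apply, cons_val]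
      ring
    · funext c
      rw [smul_vecMul]
      simp only [hL, hw, vecMul, dotProduct, Fin.sum_univ_four, Pi.smul_apply, smul_eq_mul,
        Pi.sub_apply, cons_val]
      ring
  obtain ⟨u', N'', L'', hDc⟩ := conj_typeDDeriv (hconj x hx) (v ᵥ* E x)
    ((φ x • ![-w 3, 0, -w 1, 0]) ᵥ* E x) ((φ x • ![0, -w 2, 0, -w 0]) ᵥ* E x)
  have hDconj : weylCDerivConj g' x = typeDDeriv ((E x)ᵀ * bivX' * E x) ((E x)ᵀ * bivY' * E x)
      ((E x)ᵀ * bivZ' * E x) u' N'' L'' := by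
    rw [weylCDerivConj_eq, hD, ← hDc]
  have horth := fun y hy => bivOrthogonal_frame (hEG y hy)
  have hexp : ∀ (k : ℕ) (c : ℝ) (y : Coords), ((Real.exp (c * U y) : ℝ) : ℂ) ^ k
      = ((Real.exp (k * c * U y) : ℝ) : ℂ) := by
    intro k c y
    rw [← Complex.ofReal_pow, ← Real.exp_nat_mul, mul_assoc]
  -- The constant is ½ · 24 · (-2)² = 48. The exponent combines e^{4U} from two Weyl tensors with
  -- e^{-8U} from four inverse metrics. The formula is needed on all of Ω because its gradient
  -- enters.
  have hI : ∀ y ∈ Ω, (I1 g' y : ℂ) + Complex.I * (I2 g' y : ℂ)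
      = 48 * (ψ y ^ 2 * (Real.exp (-4 * U y) : ℂ)) := by
    intro y hy
    have hCy : weylC g' y = φ y • typeD ((E y)ᵀ * bivX * E y) ((E y)ᵀ * bivY * E y)
        ((E y)ᵀ * bivZ * E y) := by
      funext a b c d
      exact hC y hy a b c d
    have hCyc : weylCConj g' y = (starRingEnd ℂ) (φ y) • typeD ((E y)ᵀ * bivX' * E y)
        ((E y)ᵀ * bivY' * E y) ((E y)ᵀ * bivZ' * E y) := by
      funext a b c d
      rw [weylCConj_eq, hCy]
      simp only [Pi.smul_apply, smul_eq_mul, map_mul, conj_typeD (hconj y hy)]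
    rw [I1_add_I2]
    · rw [hCy, hG' y hy, fullContr4_smul]
      simp only [map_smul, LinearMap.smul_apply, smul_eq_mul, fullContr4_typeD (hEG y hy)]
      have h1 : (Real.exp (2 * U y) : ℂ) * (Real.exp (2 * U y) : ℂ)
          * (Real.exp (-2 * U y) : ℂ) ^ 4 = (Real.exp (-4 * U y) : ℂ) := by
        rw [hexp, ← Complex.ofReal_mul, ← Complex.ofReal_mul, ← Real.exp_add, ← Real.exp_add]
        push_cast; ring_nf
      rw [← h1]
      ring
    · rw [hCy, hCyc, hG' y hy, fullContr4_smul]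
      simp [(horth y hy).1.fullContr4_eq_zero]
    · rw [hCy, hCyc, hG' y hy, fullContr4_smul]
      simp [(horth y hy).2.fullContr4_eq_zero]
  set F : Coords → ℂ := fun y => 48 * (ψ y ^ 2 * (Real.exp (-4 * U y) : ℂ)) with hF
  have hexpd4 : DifferentiableAt ℝ (fun y => ((Real.exp (-4 * U y) : ℝ) : ℂ)) x :=
    differentiableAt_ofReal (by fun_prop)
  have hψ2 : DifferentiableAt ℝ (fun y => ψ y * ψ y) x := hψ.fun_mul hψ
  have hF' : F = fun y => 48 * (ψ y * ψ y * (Real.exp (-4 * U y) : ℂ)) := by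
    funext y; simp only [hF]; ring
  have hFd : DifferentiableAt ℝ F x := by
    rw [hF']
    exact (hψ2.fun_mul hexpd4).const_mul 48
  have hpdF : (fun c => pd c F x) = ((96 * ψ x ^ 2 * (Real.exp (-4 * U x) : ℂ)) •
      ((3 : ℂ) • ξ - (2 : ℂ) • u)) ᵥ* E x := by
    funext c
    rw [hF', pd_const_mul (hψ2.fun_mul hexpd4), pd_mul hψ2 hexpd4, pd_mul hψ hψ, hdψ, hpdexp, hu,
      smul_vecMul, sub_vecMul, smul_vecMul, smul_vecMul]
    simp only [Pi.smul_apply, Pi.sub_apply, smul_eq_mul]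
    push_cast
    ring
  have hJ := Jergo_eq_re (g := g') (x := x) hFd
    (by filter_upwards [hΩ.mem_nhds hx] with y hy using hI y hy) rfl
    (I3_add_I4
      (by rw [hD, hDconj, hG' x hx, fullContr5_smul, (horth x hx).1.fullContr5_eq_zero, mul_zero])
      (by rw [hD, hDconj, hG' x hx, fullContr5_smul, (horth x hx).2.fullContr5_eq_zero, mul_zero]))
    (I3a_add_I4a
      (by rw [hD, hDconj, hG' x hx, swapContr5_smul, (horth x hx).1.swapContr5_eq_zero, mul_zero])
      (by rw [hD, hDconj, hG' x hx, swapContr5_smul, (horth x hx).2.swapContr5_eq_zero, mul_zero]))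
  have hcov : ∀ (k : ℂ) (p : Fin 4 → ℂ), covContr (k • invMetricC g x) (p ᵥ* E x) (p ᵥ* E x)
      = k * covContr nullEta p p := by
    intro k p
    rw [← hEG x hx, ← covContr_frame]
    simp only [covContr, smul_mulVec, dotProduct_smul, smul_eq_mul]
  rw [hJ, hD, hpdF, hG' x hx, fullContr5_smul, swapContr5_smul,
    fullContr5_typeDDeriv (hEG x hx), swapContr5_typeDDeriv (hEG x hx), hcov]
  -- With t = 3ξ - 2u the three terms are 13824(t·t + 6 w·w), -1536(6 t·t - 36 t·w + 18 w·w) and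
  -- 9216 t·t, each times e^{-10U}ψ⁴. Their sum is 13824(t + 2w)·(t + 2w), and t + 2w = ξ.
  have hval : 6 * F x * (1 / 2 * ((Real.exp (-2 * U x) : ℂ) ^ 5 * (24 * (covContr nullEta v v
        + 6 * φ x ^ 2 * covContr nullEta w w))))
      - 16 * F x * (1 / 2 * ((Real.exp (-2 * U x) : ℂ) ^ 5 * (6 * covContr nullEta v v
        - 36 * φ x * covContr nullEta v w + 18 * φ x ^ 2 * covContr nullEta w w)))
      + (Real.exp (-2 * U x) : ℂ) * covContr nullEta
        ((96 * ψ x ^ 2 * (Real.exp (-4 * U x) : ℂ)) • ((3 : ℂ) • ξ - (2 : ℂ) • u))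
        ((96 * ψ x ^ 2 * (Real.exp (-4 * U x) : ℂ)) • ((3 : ℂ) • ξ - (2 : ℂ) • u))
      = ((Real.exp (-10 * U x) : ℝ) : ℂ) * (13824 * (ψ x ^ 4 * covContr nullEta ξ ξ)) := by
    have e1 : (Real.exp (-10 * U x) : ℂ) = (Real.exp (-2 * U x) : ℂ) ^ 5 := by
      rw [hexp]; push_cast; ring_nf
    have e2 : (Real.exp (-4 * U x) : ℂ) = (Real.exp (-2 * U x) : ℂ) ^ 2 := by
      rw [hexp]; push_cast; ring_nf
    have e3 : (Real.exp (2 * U x) : ℂ) * (Real.exp (-2 * U x) : ℂ) = 1 := by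
      rw [← Complex.ofReal_mul, ← Real.exp_add]; simp
    simp only [hF, hv, hw, hφdef, e1, e2, covContr_nullEta, Pi.smul_apply, Pi.sub_apply,
      smul_eq_mul]
    set q := (Real.exp (-2 * U x) : ℂ)
    set s := (Real.exp (2 * U x) : ℂ)
    -- In the first two terms φ² carries s², F carries q² and the five inverse metrics carry q⁵. The
    -- gradient term is already a multiple of q⁵, so it is absent from the coefficient below.
    have e4 : s ^ 2 * q ^ 7 = q ^ 5 := by
      linear_combination (s * q + 1) * q ^ 5 * e3
    linear_combination (ψ x ^ 4 * (
      13824 * (-2 * ((3 * ξ 0 - 2 * u 0) * (3 * ξ 1 - 2 * u 1))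
        + 2 * ((3 * ξ 2 - 2 * u 2) * (3 * ξ 3 - 2 * u 3))
        + 6 * (-2 * ((u 0 - ξ 0) * (u 1 - ξ 1)) + 2 * ((u 2 - ξ 2) * (u 3 - ξ 3))))
      - 1536 * (6 * (-2 * ((3 * ξ 0 - 2 * u 0) * (3 * ξ 1 - 2 * u 1))
        + 2 * ((3 * ξ 2 - 2 * u 2) * (3 * ξ 3 - 2 * u 3)))
        - 36 * (-((3 * ξ 0 - 2 * u 0) * (u 1 - ξ 1)) - (3 * ξ 1 - 2 * u 1) * (u 0 - ξ 0)
          + (3 * ξ 2 - 2 * u 2) * (u 3 - ξ 3) + (3 * ξ 3 - 2 * u 3) * (u 2 - ξ 2))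
        + 18 * (-2 * ((u 0 - ξ 0) * (u 1 - ξ 1)) + 2 * ((u 2 - ξ 2) * (u 3 - ξ 3)))))) * e4
  rw [hval, Complex.re_ofReal_mul, Complex.mul_re]
  norm_num
  ring

end TypeDInvariants

/-! ### Functions of `r` and `θ` -/

section Functions

/-- The function `i sin θ`. -/
def iSin (x : Coords) : ℂ := Complex.I * (Real.sin (x 2) : ℂ)

/-- The function `i cos θ`. -/
def iCos (x : Coords) : ℂ := Complex.I * (Real.cos (x 2) : ℂ)

/-- `F` is a differentiable function of `r` and `θ` with `∂F/∂r = Fr` and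
`i ∂F/∂(cos θ) = Fy`. -/
structure HasRC (F : Coords → ℂ) (Fr Fy : ℂ) (x : Coords) : Prop where
  diff : DifferentiableAt ℝ F x
  pd_eq : ∀ i, pd i F x = ![0, Fr, iSin x * Fy, 0] i

variable {F G : Coords → ℂ} {Fr Fy Gr Gy : ℂ} {x : Coords}

theorem HasRC.congr (h : HasRC F Fr Fy x) (h1 : Fr = Gr) (h2 : Fy = Gy) : HasRC F Gr Gy x := by
  subst h1 h2; exact h

theorem HasRC.const (k : ℂ) : HasRC (fun _ => k) 0 0 x :=
  ⟨differentiableAt_const _, fun i => by rw [pd_const]; fin_cases i <;> simp⟩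

theorem HasRC.add (hF : HasRC F Fr Fy x) (hG : HasRC G Gr Gy x) :
    HasRC (fun y => F y + G y) (Fr + Gr) (Fy + Gy) x :=
  ⟨hF.diff.fun_add hG.diff, fun i => by
    rw [pd_add hF.diff hG.diff, hF.pd_eq, hG.pd_eq]; fin_cases i <;> simp; ring⟩

theorem HasRC.sub (hF : HasRC F Fr Fy x) (hG : HasRC G Gr Gy x) :
    HasRC (fun y => F y - G y) (Fr - Gr) (Fy - Gy) x :=
  ⟨hF.diff.fun_sub hG.diff, fun i => by
    rw [pd_sub hF.diff hG.diff, hF.pd_eq, hG.pd_eq]; fin_cases i <;> simp; ring⟩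

theorem HasRC.neg (hF : HasRC F Fr Fy x) : HasRC (fun y => -F y) (-Fr) (-Fy) x :=
  ⟨hF.diff.fun_neg, fun i => by rw [pd_neg, hF.pd_eq]; fin_cases i <;> simp⟩

theorem HasRC.mul (hF : HasRC F Fr Fy x) (hG : HasRC G Gr Gy x) :
    HasRC (fun y => F y * G y) (Fr * G x + F x * Gr) (Fy * G x + F x * Gy) x :=
  ⟨hF.diff.fun_mul hG.diff, fun i => by
    rw [pd_mul hF.diff hG.diff, hF.pd_eq, hG.pd_eq]; fin_cases i <;> simp; ring⟩

theorem HasRC.inv (hF : HasRC F Fr Fy x) (h0 : F x ≠ 0) :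
    HasRC (fun y => (F y)⁻¹) (-Fr / F x ^ 2) (-Fy / F x ^ 2) x := by
  have hd : DifferentiableAt ℝ (fun y => (F y)⁻¹) x := hF.diff.fun_inv h0
  refine ⟨hd, fun i => ?_⟩
  have h1 : pd i (fun y => F y * (F y)⁻¹) x = 0 := by
    rw [← pd_const i (1 : ℂ) x]
    apply pd_congr
    filter_upwards [hF.diff.continuousAt.eventually_ne h0] with y hy using mul_inv_cancel₀ hy
  rw [pd_mul hF.diff hd] at h1
  have h2 : pd i (fun y => (F y)⁻¹) x = -pd i F x / F x ^ 2 := by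
    field_simp at h1 ⊢
    linear_combination h1
  rw [h2, hF.pd_eq]
  fin_cases i <;> simp
  ring

theorem HasRC.div (hF : HasRC F Fr Fy x) (hG : HasRC G Gr Gy x) (h0 : G x ≠ 0) :
    HasRC (fun y => F y / G y) ((Fr * G x - F x * Gr) / G x ^ 2)
      ((Fy * G x - F x * Gy) / G x ^ 2) x := by
  simp only [div_eq_mul_inv (F _)]
  refine (hF.mul (hG.inv h0)).congr ?_ ?_ <;> field_simp <;> ring

theorem contDiff_coord (i : Fin 4) : ContDiff ℝ ∞ (fun y : Coords => ((y i : ℝ) : ℂ)) :=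
  Complex.ofRealCLM.contDiff.comp (contDiff_apply ℝ ℝ i)

theorem contDiff_iSin : ContDiff ℝ ∞ iSin :=
  contDiff_const.mul (Complex.ofRealCLM.contDiff.comp
    (Real.contDiff_sin.comp (contDiff_apply ℝ ℝ (2 : Fin 4))))

theorem contDiff_iCos : ContDiff ℝ ∞ iCos :=
  contDiff_const.mul (Complex.ofRealCLM.contDiff.comp
    (Real.contDiff_cos.comp (contDiff_apply ℝ ℝ (2 : Fin 4))))

theorem pd_coord (i j : Fin 4) (x : Coords) :
    pd i (fun y : Coords => y j) x = if i = j then 1 else 0 := by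
  have : (fun y : Coords => y j) = ContinuousLinearMap.proj (R := ℝ) j := rfl
  rw [pd, this, ContinuousLinearMap.fderiv]
  simp [Pi.single_apply, eq_comm]

theorem hasRC_r (x : Coords) : HasRC (fun y => ((y 1 : ℝ) : ℂ)) 1 0 x := by
  have hd : DifferentiableAt ℝ (fun y : Coords => y 1) x := by fun_prop
  refine ⟨differentiableAt_ofReal hd, fun i => ?_⟩
  rw [pd_ofReal hd, pd_coord]
  fin_cases i <;> simp

/-- The second slot of `HasRC` is minus the derivative with respect to i cos θ. The functions
`polyP'` and `knFrameY` follow this sign. -/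
theorem hasRC_iCos (x : Coords) : HasRC iCos 0 (-1) x := by
  have hd : DifferentiableAt ℝ (fun y : Coords => Real.cos (y 2)) x := by fun_prop
  refine ⟨(contDiff_iCos.differentiable (by simp)).differentiableAt, fun i => ?_⟩
  have h1 : pd i (fun y : Coords => Real.cos (y 2)) x = -Real.sin (x 2) * if i = 2 then 1 else 0 := by
    have hc : DifferentiableAt ℝ (fun y : Coords => y 2) x := by fun_prop
    rw [← pd_coord i 2 x, pd, hc.hasFDerivAt.cos.fderiv]
    simp [pd]
  have h2 : pd i iCos x = Complex.I * pd i (fun y : Coords => ((Real.cos (y 2) : ℝ) : ℂ)) x :=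
    pd_const_mul (differentiableAt_ofReal hd) Complex.I i
  rw [h2, pd_ofReal hd, h1]
  fin_cases i <;> simp [iSin]

end Functions

/-! ### The Kerr-NUT-(Anti)-de Sitter metric in a null frame -/

section KerrNUT

variable (p : Params)

/-- `i l`. -/
def iL : ℂ := Complex.I * (p.l : ℂ)

/-- `ζ = r + i (l + a cos θ)`. -/
def zeta (x : Coords) : ℂ := ((x 1 : ℝ) : ℂ) + (iL p + p.a * iCos x)

/-- The complex conjugate of `ζ`. -/
def zetaBar (x : Coords) : ℂ := ((x 1 : ℝ) : ℂ) - (iL p + p.a * iCos x)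

/-- `Q`, as a polynomial in `r`. -/
def polyQ (x : Coords) : ℂ :=
  (p.a ^ 2 + iL p ^ 2) - 2 * p.m * ((x 1 : ℝ) : ℂ) + ((x 1 : ℝ) : ℂ) * ((x 1 : ℝ) : ℂ)
    - p.Λ / 3 * ((p.a ^ 2 - 3 * iL p ^ 2) * (((x 1 : ℝ) : ℂ) * ((x 1 : ℝ) : ℂ))
      + ((x 1 : ℝ) : ℂ) * ((x 1 : ℝ) : ℂ) * (((x 1 : ℝ) : ℂ) * ((x 1 : ℝ) : ℂ)))

/-- The derivative of `Q`. -/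
def polyQ' (x : Coords) : ℂ :=
  -2 * p.m + 2 * ((x 1 : ℝ) : ℂ) - p.Λ / 3 * ((p.a ^ 2 - 3 * iL p ^ 2) * (2 * ((x 1 : ℝ) : ℂ))
      + 4 * (((x 1 : ℝ) : ℂ) * ((x 1 : ℝ) : ℂ) * ((x 1 : ℝ) : ℂ)))

/-- `P`, as a polynomial in `i cos θ`. -/
def polyP (x : Coords) : ℂ :=
  (1 + iCos x * iCos x) * (1 - p.Λ / 3 * ((3 * iL p + p.a * iCos x) * (iL p + p.a * iCos x)))

/-- The derivative of `P`. -/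
def polyP' (x : Coords) : ℂ :=
  -2 * iCos x * (1 - p.Λ / 3 * ((3 * iL p + p.a * iCos x) * (iL p + p.a * iCos x)))
    + (1 + iCos x * iCos x) * (p.Λ / 3 * (p.a * (4 * iL p + 2 * p.a * iCos x)))

/-- `a sin²θ + 4 l sin²(θ/2)`, as a polynomial in `i cos θ`. -/
def polyF (x : Coords) : ℂ := p.a * (1 + iCos x * iCos x) + 2 * p.l + 2 * iL p * iCos x

theorem iL_sq : iL p ^ 2 = -(p.l : ℂ) ^ 2 := by
  rw [iL, mul_pow, Complex.I_sq]; ring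

theorem iCos_sq (x : Coords) : iCos x ^ 2 = -(Real.cos (x 2) : ℂ) ^ 2 := by
  rw [iCos, mul_pow, Complex.I_sq]; ring

theorem iSin_sq (x : Coords) : iSin x ^ 2 = -(Real.sin (x 2) : ℂ) ^ 2 := by
  rw [iSin, mul_pow, Complex.I_sq]; ring

theorem iL_mul_iCos (x : Coords) : iL p * iCos x = -(p.l : ℂ) * (Real.cos (x 2) : ℂ) := by
  rw [iL, iCos]; linear_combination (p.l : ℂ) * (Real.cos (x 2) : ℂ) * Complex.I_sq

theorem ofReal_knQ (x : Coords) : (knQ p x : ℂ) = polyQ p x := by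
  simp only [knQ, polyQ]
  push_cast
  linear_combination (-1 - p.Λ * ((x 1 : ℝ) : ℂ) ^ 2) * iL_sq p

theorem ofReal_knR2 (x : Coords) : (knR2 p x : ℂ) = zeta p x * zetaBar p x := by
  simp only [knR2, zeta, zetaBar]
  push_cast [-Complex.ofReal_cos]
  linear_combination iL_sq p + (p.a : ℂ) ^ 2 * iCos_sq x + 2 * (p.a : ℂ) * iL_mul_iCos p x

theorem ofReal_knP (x : Coords) : (knP p x : ℂ) = polyP p x := by
  have h : Real.sin (x 2) ^ 2 = 1 - Real.cos (x 2) ^ 2 := Real.sin_sq _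
  have h2 : (3 * iL p + p.a * iCos x) * (iL p + p.a * iCos x)
      = -((3 * p.l + p.a * (Real.cos (x 2) : ℂ)) * (p.l + p.a * (Real.cos (x 2) : ℂ))) := by
    linear_combination 3 * iL_sq p + (p.a : ℂ) ^ 2 * iCos_sq x + 4 * (p.a : ℂ) * iL_mul_iCos p x
  simp only [knP, polyP, h, h2]
  push_cast [-Complex.ofReal_cos]
  linear_combination -(1 + (3 * p.l + p.a * (Real.cos (x 2) : ℂ))
    * (p.l + p.a * (Real.cos (x 2) : ℂ)) * p.Λ / 3) * iCos_sq x

theorem ofReal_form (x : Coords) :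
    ((p.a * Real.sin (x 2) ^ 2 + 4 * p.l * Real.sin (x 2 / 2) ^ 2 : ℝ) : ℂ) = polyF p x := by
  have h : Real.sin (x 2) ^ 2 = 1 - Real.cos (x 2) ^ 2 := Real.sin_sq _
  have h' : Real.sin (x 2 / 2) ^ 2 = (1 - Real.cos (x 2)) / 2 := by
    have := Real.cos_two_mul (x 2 / 2)
    rw [mul_div_cancel₀ _ (two_ne_zero)] at this
    rw [Real.sin_sq]; linarith
  rw [h, h', polyF]
  push_cast [-Complex.ofReal_cos]
  linear_combination -(p.a : ℂ) * iCos_sq x - 2 * iL_mul_iCos p x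

/-- The relation r² + (a + l)² = R² + aF between the coefficients of the two one-forms. It makes
their determinant in dt, dφ equal to -R², so the frame is invertible off the ring singularity. -/
theorem ofReal_form' (x : Coords) :
    ((x 1 ^ 2 + (p.a + p.l) ^ 2 : ℝ) : ℂ) = zeta p x * zetaBar p x + p.a * polyF p x := by
  simp only [zeta, zetaBar, polyF]
  push_cast
  linear_combination iL_sq p

variable {p} {x : Coords}

theorem zeta_ne_zero (hx : x ∈ knDomain p) : zeta p x ≠ 0 := by
  have h : (knR2 p x : ℂ) ≠ 0 := Complex.ofReal_ne_zero.mpr hx.2.2.1.ne'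
  rw [ofReal_knR2] at h
  exact left_ne_zero_of_mul h

theorem zetaBar_ne_zero (hx : x ∈ knDomain p) : zetaBar p x ≠ 0 := by
  have h : (knR2 p x : ℂ) ≠ 0 := Complex.ofReal_ne_zero.mpr hx.2.2.1.ne'
  rw [ofReal_knR2] at h
  exact right_ne_zero_of_mul h

theorem polyQ_ne_zero (hx : x ∈ knDomain p) : polyQ p x ≠ 0 := by
  rw [← ofReal_knQ]; exact Complex.ofReal_ne_zero.mpr hx.2.2.2.2

theorem polyP_ne_zero (hx : x ∈ knDomain p) : polyP p x ≠ 0 := by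
  rw [← ofReal_knP]; exact Complex.ofReal_ne_zero.mpr hx.2.2.2.1.ne'

theorem iSin_ne_zero (hx : x ∈ knDomain p) : iSin x ≠ 0 :=
  mul_ne_zero Complex.I_ne_zero
    (Complex.ofReal_ne_zero.mpr (Real.sin_pos_of_pos_of_lt_pi hx.1 hx.2.1).ne')

theorem isOpen_knDomain (p : Params) : IsOpen (knDomain p) := by
  have h0 : Continuous fun x : Coords => x 2 := continuous_apply 2
  have h1 : Continuous (knR2 p) := by unfold knR2; fun_prop
  have h2 : Continuous (knP p) := by unfold knP; fun_prop
  have h3 : Continuous (knQ p) := by unfold knQ; fun_prop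
  exact (isOpen_lt continuous_const h0).inter ((isOpen_lt h0 continuous_const).inter
    ((isOpen_lt continuous_const h1).inter ((isOpen_lt continuous_const h2).inter
      (isOpen_ne_fun h3 continuous_const))))

theorem hasRC_zeta (x : Coords) : HasRC (zeta p) 1 (-p.a) x :=
  ((hasRC_r x).add ((HasRC.const (iL p)).add ((HasRC.const (p.a : ℂ)).mul (hasRC_iCos x)))).congr
    (by ring) (by ring)

theorem hasRC_zetaBar (x : Coords) : HasRC (zetaBar p) 1 p.a x :=
  ((hasRC_r x).sub ((HasRC.const (iL p)).add ((HasRC.const (p.a : ℂ)).mul (hasRC_iCos x)))).congr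
    (by ring) (by ring)

theorem hasRC_polyQ (x : Coords) : HasRC (polyQ p) (polyQ' p x) 0 x := by
  have hr := hasRC_r x
  have h := (((HasRC.const ((p.a : ℂ) ^ 2 + iL p ^ 2)).sub
    ((HasRC.const (2 * (p.m : ℂ))).mul hr)).add (hr.mul hr)).sub
    ((HasRC.const ((p.Λ : ℂ) / 3)).mul (((HasRC.const ((p.a : ℂ) ^ 2 - 3 * iL p ^ 2)).mul
      (hr.mul hr)).add ((hr.mul hr).mul (hr.mul hr))))
  exact h.congr (by rw [polyQ']; ring) (by ring)

theorem hasRC_polyP (x : Coords) : HasRC (polyP p) 0 (polyP' p x) x := by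
  have hc := hasRC_iCos x
  have h := ((HasRC.const (x := x) 1).add (hc.mul hc)).mul ((HasRC.const 1).sub
    ((HasRC.const ((p.Λ : ℂ) / 3)).mul (((HasRC.const (3 * iL p)).add
      ((HasRC.const (p.a : ℂ)).mul hc)).mul ((HasRC.const (iL p)).add
      ((HasRC.const (p.a : ℂ)).mul hc)))))
  exact h.congr (by ring) (by rw [polyP']; ring)

theorem hasRC_polyF (x : Coords) : HasRC (polyF p) 0 (zetaBar p x - zeta p x) x := by
  have hc := hasRC_iCos x
  have h := (((HasRC.const (p.a : ℂ)).mul ((HasRC.const (x := x) 1).add (hc.mul hc))).add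
    (HasRC.const (2 * (p.l : ℂ)))).add ((HasRC.const (2 * iL p)).mul hc)
  exact h.congr (by ring) (by rw [zeta, zetaBar]; ring)

/-- The form in which the field equations enter. -/
theorem vacuum_identity (x : Coords) :
    -zeta p x * polyQ' p x + 2 * polyQ p x - p.a * zeta p x * polyP' p x
      - 2 * p.a ^ 2 * polyP p x
    = -2 * (p.m + Complex.I * knL p) * zetaBar p x
      + 2 * p.Λ / 3 * zeta p x ^ 3 * zetaBar p x := by
  -- Once L is written through i l, both sides are polynomials in r, i cos θ, i l and the real
  -- parameters. The identity then holds without the relation i² = -1.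
  have h : Complex.I * (knL p : ℂ) = iL p * (1 + (p.a ^ 2 + iL p ^ 2) * p.Λ / 3) := by
    rw [iL_sq, iL, knL]; push_cast; ring
  rw [h]
  simp only [zeta, zetaBar, polyQ, polyQ', polyP, polyP']
  ring

end KerrNUT

open Matrix

/-! ### A null frame without square roots, and its first derivatives. -/

section NullFrame

variable (p : Params)

/-- A null frame of the Kerr-NUT-(Anti)-de Sitter metric that is smooth across the zeros of `√Q`:
the rows are the covectors `ℓ`, `n`, `m`, `m̃`. -/
def knFrame (x : Coords) : Matrix (Fin 4) (Fin 4) ℂ :=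
  !![1, -(zeta p x * zetaBar p x / polyQ p x), 0, -polyF p x;
     polyQ p x / (2 * (zeta p x * zetaBar p x)), 1 / 2, 0,
       -(polyF p x * (polyQ p x / (2 * (zeta p x * zetaBar p x))));
     p.a, 0, -(zeta p x * zetaBar p x * iSin x / polyP p x),
       -(zeta p x * zetaBar p x + p.a * polyF p x);
     p.a * (polyP p x / (2 * (zeta p x * zetaBar p x))), 0, 1 / 2 * iSin x,
       -(1 / 2 * polyP p x + p.a * (polyF p x * (polyP p x / (2 * (zeta p x * zetaBar p x)))))]

/-- The inverse of `knFrame`: the columns are the dual vectors. -/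
def knCoframe (x : Coords) : Matrix (Fin 4) (Fin 4) ℂ :=
  !![(zeta p x * zetaBar p x + p.a * polyF p x) / (2 * (zeta p x * zetaBar p x)),
       (zeta p x * zetaBar p x + p.a * polyF p x) / polyQ p x,
       -polyF p x / (2 * (zeta p x * zetaBar p x)), -polyF p x / polyP p x;
     -polyQ p x / (2 * (zeta p x * zetaBar p x)), 1, 0, 0;
     0, 0, -polyP p x / (2 * (zeta p x * zetaBar p x) * iSin x), 1 / iSin x;
     p.a / (2 * (zeta p x * zetaBar p x)), p.a / polyQ p x,
       -1 / (2 * (zeta p x * zetaBar p x)), -1 / polyP p x]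

/-- The derivative of the frame with respect to `r`. -/
def knFrameR (x : Coords) : Matrix (Fin 4) (Fin 4) ℂ :=
  !![0, -(((zeta p x + zetaBar p x) * polyQ p x - zeta p x * zetaBar p x * polyQ' p x)
        / polyQ p x ^ 2), 0, 0;
     (polyQ' p x * (zeta p x * zetaBar p x) - polyQ p x * (zeta p x + zetaBar p x))
        / (2 * (zeta p x * zetaBar p x) ^ 2), 0, 0,
       -(polyF p x * ((polyQ' p x * (zeta p x * zetaBar p x)
          - polyQ p x * (zeta p x + zetaBar p x)) / (2 * (zeta p x * zetaBar p x) ^ 2)));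
     0, 0, -((zeta p x + zetaBar p x) * iSin x / polyP p x), -(zeta p x + zetaBar p x);
     -(p.a * (polyP p x * (zeta p x + zetaBar p x) / (2 * (zeta p x * zetaBar p x) ^ 2))), 0, 0,
       p.a * (polyF p x * (polyP p x * (zeta p x + zetaBar p x)
         / (2 * (zeta p x * zetaBar p x) ^ 2)))]

/-- The derivative of the frame with respect to `-i cos θ`. -/
def knFrameY (x : Coords) : Matrix (Fin 4) (Fin 4) ℂ :=
  !![0, -(p.a * (zeta p x - zetaBar p x) / polyQ p x), 0, -(zetaBar p x - zeta p x);
     -(polyQ p x * (p.a * (zeta p x - zetaBar p x))) / (2 * (zeta p x * zetaBar p x) ^ 2), 0, 0,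
       -((zetaBar p x - zeta p x) * (polyQ p x / (2 * (zeta p x * zetaBar p x)))
         - polyF p x * (polyQ p x * (p.a * (zeta p x - zetaBar p x))
           / (2 * (zeta p x * zetaBar p x) ^ 2)));
     0, 0, -(((p.a * (zeta p x - zetaBar p x) * iSin x
         + zeta p x * zetaBar p x * (iCos x / iSin x)) * polyP p x
         - zeta p x * zetaBar p x * iSin x * polyP' p x) / polyP p x ^ 2), 0;
     p.a * ((polyP' p x * (zeta p x * zetaBar p x)
         - polyP p x * (p.a * (zeta p x - zetaBar p x))) / (2 * (zeta p x * zetaBar p x) ^ 2)), 0,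
       1 / 2 * (iCos x / iSin x),
       -(1 / 2 * polyP' p x + p.a * ((zetaBar p x - zeta p x)
         * (polyP p x / (2 * (zeta p x * zetaBar p x)))
         + polyF p x * ((polyP' p x * (zeta p x * zetaBar p x)
         - polyP p x * (p.a * (zeta p x - zetaBar p x))) / (2 * (zeta p x * zetaBar p x) ^ 2))))]

variable {p} {x : Coords}

theorem contDiff_zeta : ContDiff ℝ ∞ (zeta p) :=
  (contDiff_coord 1).add (contDiff_const.add (contDiff_const.mul contDiff_iCos))

theorem contDiff_zetaBar : ContDiff ℝ ∞ (zetaBar p) :=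
  (contDiff_coord 1).sub (contDiff_const.add (contDiff_const.mul contDiff_iCos))

theorem contDiff_polyQ : ContDiff ℝ ∞ (polyQ p) := by
  have := contDiff_coord 1
  unfold polyQ
  fun_prop

theorem contDiff_polyP : ContDiff ℝ ∞ (polyP p) := by
  have := contDiff_iCos
  unfold polyP
  fun_prop

theorem contDiff_polyF : ContDiff ℝ ∞ (polyF p) := by
  have := contDiff_iCos
  unfold polyF
  fun_prop

theorem hasRC_iSin (hs : iSin x ≠ 0) : HasRC iSin 0 (iCos x / iSin x) x := by
  have hd : DifferentiableAt ℝ (fun y : Coords => Real.sin (y 2)) x := by fun_prop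
  refine ⟨(contDiff_iSin.differentiable (by simp)).differentiableAt, fun i => ?_⟩
  have h1 : pd i (fun y : Coords => Real.sin (y 2)) x = Real.cos (x 2) * if i = 2 then 1 else 0 := by
    have hc : DifferentiableAt ℝ (fun y : Coords => y 2) x := by fun_prop
    rw [← pd_coord i 2 x, pd, hc.hasFDerivAt.sin.fderiv]
    simp [pd]
  have h2 : pd i iSin x = Complex.I * pd i (fun y : Coords => ((Real.sin (y 2) : ℝ) : ℂ)) x :=
    pd_const_mul (differentiableAt_ofReal hd) Complex.I i
  rw [h2, pd_ofReal hd, h1, mul_div_cancel₀ _ hs]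
  fin_cases i <;> simp [iCos]

theorem knFrame_mul_knCoframe (hx : x ∈ knDomain p) : knFrame p x * knCoframe p x = 1 := by
  have hz := zeta_ne_zero hx
  have hw := zetaBar_ne_zero hx
  have hQ := polyQ_ne_zero hx
  have hP := polyP_ne_zero hx
  have hs := iSin_ne_zero hx
  ext i j
  fin_cases i <;> fin_cases j <;>
    simp [knFrame, knCoframe, Matrix.mul_apply, Fin.sum_univ_four] <;> field_simp <;> ring

theorem ofReal_knForm0 (i : Fin 4) : (knForm0 p x i : ℂ) = ![1, 0, 0, -polyF p x] i := by
  rw [← ofReal_form]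
  fin_cases i <;> simp [knForm0]

theorem ofReal_knForm2 (i : Fin 4) : (knForm2 p x i : ℂ)
    = ![(p.a : ℂ), 0, 0, -(zeta p x * zetaBar p x + p.a * polyF p x)] i := by
  rw [← ofReal_form']
  fin_cases i <;> simp [knForm2]

theorem ofReal_knMetric (i j : Fin 4) : (knMetric p x i j : ℂ)
    = -(polyQ p x / (zeta p x * zetaBar p x))
        * (![1, 0, 0, -polyF p x] i * ![1, 0, 0, -polyF p x] j)
      + polyP p x / (zeta p x * zetaBar p x)
        * (![(p.a : ℂ), 0, 0, -(zeta p x * zetaBar p x + p.a * polyF p x)] i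
          * ![(p.a : ℂ), 0, 0, -(zeta p x * zetaBar p x + p.a * polyF p x)] j)
      + zeta p x * zetaBar p x / polyQ p x * ((![0, 1, 0, 0] : Fin 4 → ℂ) i * ![0, 1, 0, 0] j)
      - zeta p x * zetaBar p x / polyP p x * iSin x ^ 2
        * ((![0, 0, 1, 0] : Fin 4 → ℂ) i * ![0, 0, 1, 0] j) := by
  have h1 : ∀ i, (formR i : ℂ) = (![0, 1, 0, 0] : Fin 4 → ℂ) i := by
    intro i; fin_cases i <;> simp [formR]
  have h3 : ∀ i, (formTheta i : ℂ) = (![0, 0, 1, 0] : Fin 4 → ℂ) i := by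
    intro i; fin_cases i <;> simp [formTheta]
  rw [← ofReal_knForm0, ← ofReal_knForm0, ← h1, ← h1, ← ofReal_knForm2, ← ofReal_knForm2, ← h3,
    ← h3, iSin_sq, ← ofReal_knQ, ← ofReal_knP,
    ← ofReal_knR2, knMetric, Matrix.of_apply]
  push_cast [-Complex.ofReal_sin]
  ring

theorem metricC_knMetric (hx : x ∈ knDomain p) :
    metricC (knMetric p) x = (knFrame p x)ᵀ * nullEta * knFrame p x := by
  have hz := zeta_ne_zero hx
  have hw := zetaBar_ne_zero hx
  have hQ := polyQ_ne_zero hx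
  have hP := polyP_ne_zero hx
  ext i j
  rw [metricC, Matrix.of_apply, ofReal_knMetric]
  fin_cases i <;> fin_cases j <;>
    simp [knFrame, nullEta, Matrix.mul_apply, Fin.sum_univ_four] <;> field_simp <;> ring

theorem contDiffAt_knFrame (hx : x ∈ knDomain p) (i j : Fin 4) :
    ContDiffAt ℝ ∞ (fun y => knFrame p y i j) x := by
  have hz := zeta_ne_zero hx
  have hw := zetaBar_ne_zero hx
  have hQ := polyQ_ne_zero hx
  have hP := polyP_ne_zero hx
  have cz := (contDiff_zeta (p := p)).contDiffAt (x := x)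
  have cw := (contDiff_zetaBar (p := p)).contDiffAt (x := x)
  have cQ := (contDiff_polyQ (p := p)).contDiffAt (x := x)
  have cP := (contDiff_polyP (p := p)).contDiffAt (x := x)
  have cF := (contDiff_polyF (p := p)).contDiffAt (x := x)
  have cs := contDiff_iSin.contDiffAt (x := x)
  have ciQ := cQ.inv hQ
  have ciP := cP.inv hP
  have ciR := (contDiffAt_const.mul (cz.mul cw)).inv (mul_ne_zero two_ne_zero (mul_ne_zero hz hw))
  have c1 : ContDiffAt ℝ ∞ (fun y => -(zeta p y * zetaBar p y * (polyQ p y)⁻¹)) x :=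
    ((cz.mul cw).mul ciQ).neg
  have c2 : ContDiffAt ℝ ∞ (fun y => polyQ p y * (2 * (zeta p y * zetaBar p y))⁻¹) x := cQ.mul ciR
  have c3 : ContDiffAt ℝ ∞ (fun y => polyP p y * (2 * (zeta p y * zetaBar p y))⁻¹) x := cP.mul ciR
  have c4 : ContDiffAt ℝ ∞ (fun y => -(zeta p y * zetaBar p y * iSin y * (polyP p y)⁻¹)) x :=
    (((cz.mul cw).mul cs).mul ciP).neg
  simp only [knFrame, div_eq_mul_inv (zeta _ _ * _), div_eq_mul_inv (polyQ _ _),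
    div_eq_mul_inv (polyP _ _), div_eq_mul_inv (_ * iSin _)]
  fin_cases i <;> fin_cases j
  exacts [contDiffAt_const, c1, contDiffAt_const, cF.neg, c2, contDiffAt_const, contDiffAt_const,
    (cF.mul c2).neg, contDiffAt_const, contDiffAt_const, c4,
    ((cz.mul cw).add (contDiffAt_const.mul cF)).neg, contDiffAt_const.mul c3, contDiffAt_const,
    contDiffAt_const.mul cs,
    ((contDiffAt_const.mul cP).add (contDiffAt_const.mul (cF.mul c3))).neg]

theorem hasRC_knFrame (hx : x ∈ knDomain p) (i j : Fin 4) :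
    HasRC (fun y => knFrame p y i j) (knFrameR p x i j) (knFrameY p x i j) x := by
  have hz := zeta_ne_zero hx
  have hw := zetaBar_ne_zero hx
  have hQ := polyQ_ne_zero hx
  have hP := polyP_ne_zero hx
  have hs := iSin_ne_zero hx
  have dz := hasRC_zeta (p := p) x
  have dw := hasRC_zetaBar (p := p) x
  have dQ := hasRC_polyQ (p := p) x
  have dP := hasRC_polyP (p := p) x
  have dF := hasRC_polyF (p := p) x
  have ds := hasRC_iSin hs
  have da := HasRC.const (x := x) (p.a : ℂ)
  have dhalf := HasRC.const (x := x) (1 / 2 : ℂ)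
  have dR : HasRC (fun y => zeta p y * zetaBar p y) (zeta p x + zetaBar p x)
      (p.a * (zeta p x - zetaBar p x)) x := (dz.mul dw).congr (by ring) (by ring)
  have d2R := (HasRC.const (x := x) 2).mul dR
  have h2R : 2 * (zeta p x * zetaBar p x) ≠ 0 := mul_ne_zero two_ne_zero (mul_ne_zero hz hw)
  have dq : HasRC (fun y => polyQ p y / (2 * (zeta p y * zetaBar p y)))
      ((polyQ' p x * (zeta p x * zetaBar p x) - polyQ p x * (zeta p x + zetaBar p x))
        / (2 * (zeta p x * zetaBar p x) ^ 2))
      (-(polyQ p x * (p.a * (zeta p x - zetaBar p x))) / (2 * (zeta p x * zetaBar p x) ^ 2)) x :=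
    (dQ.div d2R h2R).congr (by field_simp; ring) (by field_simp; ring)
  have dp : HasRC (fun y => polyP p y / (2 * (zeta p y * zetaBar p y)))
      (-(polyP p x * (zeta p x + zetaBar p x)) / (2 * (zeta p x * zetaBar p x) ^ 2))
      ((polyP' p x * (zeta p x * zetaBar p x) - polyP p x * (p.a * (zeta p x - zetaBar p x)))
        / (2 * (zeta p x * zetaBar p x) ^ 2)) x :=
    (dP.div d2R h2R).congr (by field_simp; ring) (by field_simp; ring)
  fin_cases i <;> fin_cases j
  exacts [HasRC.const _,
    (dR.div dQ hQ).neg.congr (by simp [knFrameR]) (by simp [knFrameY]; field_simp; try ring),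
    HasRC.const _,
    dF.neg.congr (by simp [knFrameR]) (by simp [knFrameY]),
    dq.congr (by simp [knFrameR]) (by simp [knFrameY]),
    HasRC.const _, HasRC.const _,
    (dF.mul dq).neg.congr (by simp [knFrameR]) (by simp [knFrameY]; ring),
    HasRC.const _, HasRC.const _,
    ((dR.mul ds).div dP hP).neg.congr (by simp [knFrameR]; field_simp) (by simp [knFrameY]; try ring),
    (dR.add (da.mul dF)).neg.congr (by simp [knFrameR]) (by simp [knFrameY]; ring),
    (da.mul dp).congr (by simp [knFrameR]; try ring) (by simp [knFrameY]),
    HasRC.const _,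
    (dhalf.mul ds).congr (by simp [knFrameR]) (by simp [knFrameY]),
    ((dhalf.mul dP).add (da.mul (dF.mul dp))).neg.congr (by simp [knFrameR]; ring)
      (by simp [knFrameY]; try ring)]

end NullFrame

/-! ### The connection form of the null frame. -/

section Connection

variable (p : Params)

/-- `Ψ₂`, as a function of `ζ`. -/
def psi (x : Coords) : ℂ := -(p.m + Complex.I * knL p) / zeta p x ^ 3

/-- The complex conjugate of `Ψ₂`. -/
def psiBar (x : Coords) : ℂ := -(p.m - Complex.I * knL p) / zetaBar p x ^ 3

/-- The coefficient of `dt` in the connection form `S`. -/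
def connK (x : Coords) : ℂ :=
  -(p.m + Complex.I * knL p) / (zeta p x * zeta p x) + p.Λ / 3 * zeta p x

/-- The coefficient of `dt` in the connection form `T`. -/
def connK' (x : Coords) : ℂ :=
  -(p.m - Complex.I * knL p) / (zetaBar p x * zetaBar p x) + p.Λ / 3 * zetaBar p x

/-- The connection form `N` of the null frame. -/
def connN (x : Coords) : Fin 4 → ℂ :=
  ![0, -(p.a * zetaBar p x / polyQ p x), zetaBar p x * iSin x / polyP p x, zetaBar p x]

/-- The connection form `L` of the null frame. -/
def connL (x : Coords) : Fin 4 → ℂ :=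
  ![0, -(p.a * polyP p x / (4 * (zeta p x * zeta p x * zetaBar p x))),
    polyQ p x * iSin x / (4 * (zeta p x * zeta p x * zetaBar p x)),
    -(polyP p x * polyQ p x / (4 * (zeta p x * zeta p x * zetaBar p x)))]

/-- The connection form `N'` of the null frame. -/
def connN' (x : Coords) : Fin 4 → ℂ :=
  ![0, -(p.a * polyP p x / (2 * zetaBar p x * polyQ p x)), -(iSin x / (2 * zetaBar p x)),
    polyP p x / (2 * zetaBar p x)]

/-- The connection form `L'` of the null frame. -/
def connL' (x : Coords) : Fin 4 → ℂ :=
  ![0, -(p.a / (2 * zetaBar p x)), -(polyQ p x * iSin x / (2 * zetaBar p x * polyP p x)),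
    -(polyQ p x / (2 * zetaBar p x))]

/-- The connection form `S` of the null frame. -/
def connS (x : Coords) : Fin 4 → ℂ :=
  ![connK p x, 1 / 2 * polyQ' p x / polyQ p x - (zeta p x + zetaBar p x) / (zeta p x * zetaBar p x),
    iSin x * (1 / 2 * polyP' p x / polyP p x
      - p.a * (zeta p x - zetaBar p x) / (zeta p x * zetaBar p x)),
    1 / 2 * polyP' p x + p.a * polyP p x / zeta p x - polyF p x * connK p x]

/-- The connection form `T` of the null frame. -/
def connT (x : Coords) : Fin 4 → ℂ :=
  ![connK' p x, 1 / 2 * polyQ' p x / polyQ p x, -(iSin x * (1 / 2 * polyP' p x / polyP p x)),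
    p.a * polyP p x / zetaBar p x - 1 / 2 * polyP' p x - polyF p x * connK' p x]

/-- The connection form of the null frame. -/
def knConn (x : Coords) (c : Fin 4) : Matrix (Fin 4) (Fin 4) ℂ :=
  connMat (1 / 2 * (connS p x c + connT p x c)) (1 / 2 * (connT p x c - connS p x c))
    (connN p x c) (connL p x c) (connN' p x c) (connL' p x c)

/-- The complex conjugate of `vacuum_identity`. -/
theorem vacuum_identity' (x : Coords) :
    -zetaBar p x * polyQ' p x + 2 * polyQ p x + p.a * zetaBar p x * polyP' p x
      - 2 * p.a ^ 2 * polyP p x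
    = -2 * (p.m - Complex.I * knL p) * zeta p x
      + 2 * p.Λ / 3 * zetaBar p x ^ 3 * zeta p x := by
  have h : Complex.I * (knL p : ℂ) = iL p * (1 + (p.a ^ 2 + iL p ^ 2) * p.Λ / 3) := by
    rw [iL_sq, iL, knL]; push_cast; ring
  rw [h]
  simp only [zeta, zetaBar, polyQ, polyQ', polyP, polyP']
  ring

variable {p} {x : Coords}

/-- Absence of torsion demands the expression on the right. The field equations reduce it to
`connK`, from which P and Q have disappeared, and this simple form makes the exterior derivative of
S tractable. -/
theorem connK_eq (hx : x ∈ knDomain p) : connK p x =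
    (-zeta p x * polyQ' p x + 2 * polyQ p x - p.a * zeta p x * polyP' p x
      - 2 * p.a ^ 2 * polyP p x) / (2 * (zeta p x * zeta p x * zetaBar p x)) := by
  have hz := zeta_ne_zero hx
  have hw := zetaBar_ne_zero hx
  rw [vacuum_identity, connK]
  field_simp

theorem connK'_eq (hx : x ∈ knDomain p) : connK' p x =
    (-zetaBar p x * polyQ' p x + 2 * polyQ p x + p.a * zetaBar p x * polyP' p x
      - 2 * p.a ^ 2 * polyP p x) / (2 * (zetaBar p x * zetaBar p x * zeta p x)) := by
  have hz := zeta_ne_zero hx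
  have hw := zetaBar_ne_zero hx
  rw [vacuum_identity', connK']
  field_simp

/-- The connection form is not derived but verified. By antisymmetry six coordinate planes remain,
and in each the claim is a rational identity in ζ, ζ̄, P, Q, F, i sin θ, i cos θ and the first
derivatives of P and Q. -/
theorem knFrame_torsion (hx : x ∈ knDomain p) (c d i : Fin 4) :
    pd c (fun y => knFrame p y i d) x + ∑ j, knConn p x c i j * knFrame p x j d
      = pd d (fun y => knFrame p y i c) x + ∑ j, knConn p x d i j * knFrame p x j c := by
  have hz := zeta_ne_zero hx
  have hw := zetaBar_ne_zero hx
  have hQ := polyQ_ne_zero hx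
  have hP := polyP_ne_zero hx
  have hs := iSin_ne_zero hx
  have key : ∀ c d : Fin 4, c < d →
    pd c (fun y => knFrame p y i d) x + ∑ j, knConn p x c i j * knFrame p x j d
      = pd d (fun y => knFrame p y i c) x + ∑ j, knConn p x d i j * knFrame p x j c := by
    intro c d hcd
    rw [(hasRC_knFrame hx i d).pd_eq, (hasRC_knFrame hx i c).pd_eq]
    fin_cases c <;> fin_cases d <;> first | exact absurd hcd (by decide) | skip
    all_goals
      fin_cases i <;>
      simp [knFrame, knFrameR, knFrameY, knConn, connMat, connN, connL, connN', connL', connS,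
        connT, Fin.sum_univ_four, connK_eq hx, connK'_eq hx] <;> field_simp <;> ring
  rcases lt_trichotomy c d with h | h | h
  · exact key c d h
  · rw [h]
  · exact (key d c h).symm

end Connection

/-! ### The curvature of the Kerr-NUT-(Anti)-de Sitter metric -/

section Forms

/-- The exterior derivative of a complex covector field. -/
def extD (Θ : Coords → Fin 4 → ℂ) (x : Coords) (c d : Fin 4) : ℂ :=
  pd c (fun y => Θ y d) x - pd d (fun y => Θ y c) x

/-- The wedge product of two covectors. -/
def wedge (α β : Fin 4 → ℂ) (c d : Fin 4) : ℂ := α c * β d - α d * β c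

theorem eq_of_antisymm {F G : Fin 4 → Fin 4 → ℂ} (hF : ∀ c d, F c d = -F d c)
    (hG : ∀ c d, G c d = -G d c) (h01 : F 0 1 = G 0 1) (h02 : F 0 2 = G 0 2) (h03 : F 0 3 = G 0 3)
    (h12 : F 1 2 = G 1 2) (h13 : F 1 3 = G 1 3) (h23 : F 2 3 = G 2 3) (c d : Fin 4) :
    F c d = G c d := by
  have hF0 : ∀ c, F c c = 0 := fun c => self_eq_neg.mp (hF c c)
  have hG0 : ∀ c, G c c = 0 := fun c => self_eq_neg.mp (hG c c)
  fin_cases c <;> fin_cases d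
  exacts [(hF0 0).trans (hG0 0).symm, h01, h02, h03, by rw [hF, hG]; exact congrArg _ h01,
    (hF0 1).trans (hG0 1).symm, h12, h13, by rw [hF, hG]; exact congrArg _ h02,
    by rw [hF, hG]; exact congrArg _ h12, (hF0 2).trans (hG0 2).symm, h23,
    by rw [hF, hG]; exact congrArg _ h03, by rw [hF, hG]; exact congrArg _ h13,
    by rw [hF, hG]; exact congrArg _ h23, (hF0 3).trans (hG0 3).symm]

variable {Θ : Coords → Fin 4 → ℂ} {x : Coords} {R0 R1 R2 R3 Y0 Y1 Y2 Y3 : ℂ}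

theorem extD_eq {G : Fin 4 → Fin 4 → ℂ}
    (h0 : HasRC (fun y => Θ y 0) R0 Y0 x) (h1 : HasRC (fun y => Θ y 1) R1 Y1 x)
    (h2 : HasRC (fun y => Θ y 2) R2 Y2 x) (h3 : HasRC (fun y => Θ y 3) R3 Y3 x)
    (hG : ∀ c d, G c d = -G d c) (h01 : -R0 = G 0 1) (h02 : -(iSin x * Y0) = G 0 2)
    (h03 : 0 = G 0 3) (h12 : R2 - iSin x * Y1 = G 1 2) (h13 : R3 = G 1 3)
    (h23 : iSin x * Y3 = G 2 3) :
    (∀ i, DifferentiableAt ℝ (fun y => Θ y i) x) ∧ ∀ c d, extD Θ x c d = G c d := by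
  refine ⟨fun i => by
    fin_cases i
    exacts [h0.diff, h1.diff, h2.diff, h3.diff], fun c d => ?_⟩
  refine eq_of_antisymm (F := extD Θ x) (fun c d => by rw [extD, extD]; ring) hG ?_ ?_ ?_ ?_ ?_ ?_
    c d <;>
  simp only [extD, h0.pd_eq, h1.pd_eq, h2.pd_eq, h3.pd_eq, cons_val]
  · rw [← h01]; ring
  · rw [← h02]; ring
  · rw [← h03]; ring
  · rw [← h12]
  · rw [← h13]; ring
  · rw [← h23]; ring

variable (E : Matrix (Fin 4) (Fin 4) ℂ) (a b : Fin 4)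

theorem bivX_apply : (Eᵀ * bivX * E) a b = wedge (E 0) (E 2) a b := by
  simp [bivX, Matrix.mul_apply, Fin.sum_univ_four, wedge]; ring

theorem bivY_apply : (Eᵀ * bivY * E) a b = wedge (E 1) (E 3) a b := by
  simp [bivY, Matrix.mul_apply, Fin.sum_univ_four, wedge]; ring

theorem bivZ_apply : (Eᵀ * bivZ * E) a b = wedge (E 0) (E 1) a b - wedge (E 2) (E 3) a b := by
  simp [bivZ, Matrix.mul_apply, Fin.sum_univ_four, wedge]; ring

theorem bivX'_apply : (Eᵀ * bivX' * E) a b = wedge (E 0) (E 3) a b := by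
  simp [bivX', Matrix.mul_apply, Fin.sum_univ_four, wedge]; ring

theorem bivY'_apply : (Eᵀ * bivY' * E) a b = wedge (E 1) (E 2) a b := by
  simp [bivY', Matrix.mul_apply, Fin.sum_univ_four, wedge]; ring

theorem bivZ'_apply : (Eᵀ * bivZ' * E) a b = wedge (E 0) (E 1) a b + wedge (E 2) (E 3) a b := by
  simp [bivZ', Matrix.mul_apply, Fin.sum_univ_four, wedge]; ring

end Forms

section Curvature

variable {p : Params} {x : Coords}

/-- The second derivative of `P`. -/
def polyP'' (p : Params) (x : Coords) : ℂ :=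
  2 * (1 - p.Λ / 3 * ((3 * iL p + p.a * iCos x) * (iL p + p.a * iCos x)))
    - 4 * iCos x * (p.Λ / 3 * (p.a * (4 * iL p + 2 * p.a * iCos x)))
    - (1 + iCos x * iCos x) * (p.Λ / 3 * (2 * p.a ^ 2))

theorem hasRC_polyP' (x : Coords) : HasRC (polyP' p) 0 (polyP'' p x) x := by
  have hc := hasRC_iCos x
  have h := ((((HasRC.const (x := x) (-2)).mul hc).mul ((HasRC.const 1).sub
    ((HasRC.const ((p.Λ : ℂ) / 3)).mul (((HasRC.const (3 * iL p)).add
      ((HasRC.const (p.a : ℂ)).mul hc)).mul ((HasRC.const (iL p)).add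
      ((HasRC.const (p.a : ℂ)).mul hc)))))).add
    (((HasRC.const (x := x) 1).add (hc.mul hc)).mul ((HasRC.const ((p.Λ : ℂ) / 3)).mul
      ((HasRC.const (p.a : ℂ)).mul ((HasRC.const (4 * iL p)).add
        ((HasRC.const (2 * (p.a : ℂ))).mul hc))))))
  exact h.congr (by ring) (by rw [polyP'']; ring)

/-- The value of Q'' is irrelevant. Q' occurs only in the dr components of S and T, and an exterior
derivative discards ∂_r of a dr component. -/
theorem exists_hasRC_polyQ' (x : Coords) : ∃ q, HasRC (polyQ' p) q 0 x := by
  have hr := hasRC_r x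
  have h := ((HasRC.const (-2 * (p.m : ℂ))).add ((HasRC.const 2).mul hr)).sub
    ((HasRC.const ((p.Λ : ℂ) / 3)).mul (((HasRC.const ((p.a : ℂ) ^ 2 - 3 * iL p ^ 2)).mul
      ((HasRC.const 2).mul hr)).add ((HasRC.const 4).mul ((hr.mul hr).mul hr))))
  exact ⟨_, h.congr rfl (by ring)⟩

theorem polyQ'_eq (hx : x ∈ knDomain p) : polyQ' p x =
    (2 * polyQ p x - p.a * zeta p x * polyP' p x - 2 * p.a ^ 2 * polyP p x
      + 2 * (p.m + Complex.I * knL p) * zetaBar p x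
      - 2 * p.Λ / 3 * zeta p x ^ 3 * zetaBar p x) / zeta p x := by
  have hz := zeta_ne_zero hx
  have h := vacuum_identity (p := p) x
  field_simp
  linear_combination -3 * h

theorem polyQ'_eq' (hx : x ∈ knDomain p) : polyQ' p x =
    (2 * polyQ p x + p.a * zetaBar p x * polyP' p x - 2 * p.a ^ 2 * polyP p x
      + 2 * (p.m - Complex.I * knL p) * zeta p x
      - 2 * p.Λ / 3 * zetaBar p x ^ 3 * zeta p x) / zetaBar p x := by
  have hz := zetaBar_ne_zero hx
  have h := vacuum_identity' p x
  field_simp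
  linear_combination -3 * h

/-- This is the derivative of `vacuum_identity` in the angular variable, divided by a. It is checked
as a polynomial identity so that a = 0 is covered. -/
theorem polyP''_eq (hx : x ∈ knDomain p) : polyP'' p x =
    (polyQ' p x - p.a * polyP' p x + 2 * (p.m + Complex.I * knL p)
      - 2 * p.Λ / 3 * (zeta p x ^ 3 - 3 * zeta p x ^ 2 * zetaBar p x)) / zeta p x := by
  have hz := zeta_ne_zero hx
  have h : Complex.I * (knL p : ℂ) = iL p * (1 + (p.a ^ 2 + iL p ^ 2) * p.Λ / 3) := by
    rw [iL_sq, iL, knL]; push_cast; ring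
  rw [h, eq_div_iff hz]
  simp only [zeta, zetaBar, polyQ', polyP', polyP'']
  ring

theorem polyP''_eq' (hx : x ∈ knDomain p) : polyP'' p x =
    (polyQ' p x + p.a * polyP' p x + 2 * (p.m - Complex.I * knL p)
      - 2 * p.Λ / 3 * (zetaBar p x ^ 3 - 3 * zetaBar p x ^ 2 * zeta p x)) / zetaBar p x := by
  have hz := zetaBar_ne_zero hx
  have h : Complex.I * (knL p : ℂ) = iL p * (1 + (p.a ^ 2 + iL p ^ 2) * p.Λ / 3) := by
    rw [iL_sq, iL, knL]; push_cast; ring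
  rw [h, eq_div_iff hz]
  simp only [zeta, zetaBar, polyQ', polyP', polyP'']
  ring

theorem wedge_antisymm (α β : Fin 4 → ℂ) (c d : Fin 4) : wedge α β c d = -wedge α β d c := by
  rw [wedge, wedge]; ring

/-- The combination dN + S∧N is the N entry of the curvature matrix. Eliminating Q' by the field
equation leaves a multiple of ℓ∧m, as type D requires. -/
theorem extD_connN (hx : x ∈ knDomain p) :
    (∀ i, DifferentiableAt ℝ (fun y => connN p y i) x) ∧ ∀ c d,
    extD (connN p) x c d = -(psi p x + p.Λ / 3) * wedge (knFrame p x 0) (knFrame p x 2) c d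
      - wedge (connS p x) (connN p x) c d := by
  have hz := zeta_ne_zero hx
  have hw := zetaBar_ne_zero hx
  have hQ := polyQ_ne_zero hx
  have hP := polyP_ne_zero hx
  have hs := iSin_ne_zero hx
  have da := HasRC.const (x := x) (p.a : ℂ)
  have dw := hasRC_zetaBar (p := p) x
  refine extD_eq (Θ := connN p) (HasRC.const 0) (((da.mul dw).div (hasRC_polyQ (p := p) x) hQ).neg)
    ((dw.mul (hasRC_iSin hs)).div (hasRC_polyP (p := p) x) hP) dw
    (fun c d => by rw [wedge_antisymm, wedge_antisymm (connS p x)]; ring) ?_ ?_ ?_ ?_ ?_ ?_ <;>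
  · simp [wedge, knFrame, connN, connS, connK, psi, polyQ'_eq hx]
    try field_simp
    try ring

theorem extD_connL (hx : x ∈ knDomain p) :
    (∀ i, DifferentiableAt ℝ (fun y => connL p y i) x) ∧ ∀ c d,
    extD (connL p) x c d = -(psi p x + p.Λ / 3) * wedge (knFrame p x 1) (knFrame p x 3) c d
      + wedge (connS p x) (connL p x) c d := by
  have hz := zeta_ne_zero hx
  have hw := zetaBar_ne_zero hx
  have hQ := polyQ_ne_zero hx
  have hP := polyP_ne_zero hx
  have hs := iSin_ne_zero hx
  have da := HasRC.const (x := x) (p.a : ℂ)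
  have dz := hasRC_zeta (p := p) x
  have dw := hasRC_zetaBar (p := p) x
  have dQ := hasRC_polyQ (p := p) x
  have dP := hasRC_polyP (p := p) x
  have dM := (HasRC.const (x := x) 4).mul ((dz.mul dz).mul dw)
  have hM : 4 * (zeta p x * zeta p x * zetaBar p x) ≠ 0 :=
    mul_ne_zero (by norm_num) (mul_ne_zero (mul_ne_zero hz hz) hw)
  refine extD_eq (Θ := connL p) (HasRC.const 0) (((da.mul dP).div dM hM).neg)
    ((dQ.mul (hasRC_iSin hs)).div dM hM) (((dP.mul dQ).div dM hM).neg)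
    (fun c d => by rw [wedge_antisymm, wedge_antisymm (connS p x)]; ring) ?_ ?_ ?_ ?_ ?_ ?_ <;>
  · simp [wedge, knFrame, connL, connS, connK, psi, polyQ'_eq hx]
    try field_simp
    try ring

/-- The diagonal part of the same sl₂ curvature. It is the place where P'' enters, through the dθ∧dφ
component, and is eliminated by `polyP''_eq`. -/
theorem extD_connS (hx : x ∈ knDomain p) :
    (∀ i, DifferentiableAt ℝ (fun y => connS p y i) x) ∧ ∀ c d,
    extD (connS p) x c d = (2 * psi p x - p.Λ / 3)
        * (wedge (knFrame p x 0) (knFrame p x 1) c d - wedge (knFrame p x 2) (knFrame p x 3) c d)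
      - 2 * wedge (connN p x) (connL p x) c d := by
  have hz := zeta_ne_zero hx
  have hw := zetaBar_ne_zero hx
  have hQ := polyQ_ne_zero hx
  have hP := polyP_ne_zero hx
  have hs := iSin_ne_zero hx
  have da := HasRC.const (x := x) (p.a : ℂ)
  have dh := HasRC.const (x := x) (1 / 2 : ℂ)
  have dz := hasRC_zeta (p := p) x
  have dw := hasRC_zetaBar (p := p) x
  have dQ := hasRC_polyQ (p := p) x
  have dP := hasRC_polyP (p := p) x
  obtain ⟨q, dQ'⟩ := exists_hasRC_polyQ' (p := p) x
  have dP' := hasRC_polyP' (p := p) x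
  have dR := dz.mul dw
  have hR := mul_ne_zero hz hw
  have dK : HasRC (connK p) _ _ x := ((HasRC.const (-((p.m : ℂ) + Complex.I * knL p))).div
    (dz.mul dz) (mul_ne_zero hz hz)).add ((HasRC.const ((p.Λ : ℂ) / 3)).mul dz)
  refine extD_eq (Θ := connS p) dK (((dh.mul dQ').div dQ hQ).sub ((dz.add dw).div dR hR))
    ((hasRC_iSin hs).mul (((dh.mul dP').div dP hP).sub ((da.mul (dz.sub dw)).div dR hR)))
    (((dh.mul dP').add ((da.mul dP).div dz hz)).sub ((hasRC_polyF (p := p) x).mul dK))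
    (fun c d => by rw [wedge_antisymm, wedge_antisymm (knFrame p x 2),
      wedge_antisymm (connN p x)]; ring) ?_ ?_ ?_ ?_ ?_ ?_ <;>
  · simp [-zero_eq_mul, wedge, knFrame, connN, connL, connK, psi, polyP''_eq hx, polyQ'_eq hx]
    try field_simp
    try ring

theorem extD_connN' (hx : x ∈ knDomain p) :
    (∀ i, DifferentiableAt ℝ (fun y => connN' p y i) x) ∧ ∀ c d,
    extD (connN' p) x c d = -(psiBar p x + p.Λ / 3) * wedge (knFrame p x 0) (knFrame p x 3) c d
      - wedge (connT p x) (connN' p x) c d := by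
  have hz := zeta_ne_zero hx
  have hw := zetaBar_ne_zero hx
  have hQ := polyQ_ne_zero hx
  have hP := polyP_ne_zero hx
  have hs := iSin_ne_zero hx
  have da := HasRC.const (x := x) (p.a : ℂ)
  have dw := hasRC_zetaBar (p := p) x
  have dQ := hasRC_polyQ (p := p) x
  have dP := hasRC_polyP (p := p) x
  have d2w := (HasRC.const (x := x) 2).mul dw
  have h2w := mul_ne_zero (two_ne_zero' ℂ) hw
  refine extD_eq (Θ := connN' p) (HasRC.const 0) (((da.mul dP).div (d2w.mul dQ) (mul_ne_zero h2w hQ)).neg)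
    (((hasRC_iSin hs).div d2w h2w).neg) (dP.div d2w h2w)
    (fun c d => by rw [wedge_antisymm, wedge_antisymm (connT p x)]; ring) ?_ ?_ ?_ ?_ ?_ ?_ <;>
  · simp [wedge, knFrame, connN', connT, connK', psiBar, polyQ'_eq' hx]
    try field_simp
    try ring

theorem extD_connL' (hx : x ∈ knDomain p) :
    (∀ i, DifferentiableAt ℝ (fun y => connL' p y i) x) ∧ ∀ c d,
    extD (connL' p) x c d = -(psiBar p x + p.Λ / 3) * wedge (knFrame p x 1) (knFrame p x 2) c d
      + wedge (connT p x) (connL' p x) c d := by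
  have hz := zeta_ne_zero hx
  have hw := zetaBar_ne_zero hx
  have hQ := polyQ_ne_zero hx
  have hP := polyP_ne_zero hx
  have hs := iSin_ne_zero hx
  have da := HasRC.const (x := x) (p.a : ℂ)
  have dw := hasRC_zetaBar (p := p) x
  have dQ := hasRC_polyQ (p := p) x
  have dP := hasRC_polyP (p := p) x
  have d2w := (HasRC.const (x := x) 2).mul dw
  have h2w := mul_ne_zero (two_ne_zero' ℂ) hw
  refine extD_eq (Θ := connL' p) (HasRC.const 0) ((da.div d2w h2w).neg)
    (((dQ.mul (hasRC_iSin hs)).div (d2w.mul dP) (mul_ne_zero h2w hP)).neg) ((dQ.div d2w h2w).neg)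
    (fun c d => by rw [wedge_antisymm, wedge_antisymm (connT p x)]; ring) ?_ ?_ ?_ ?_ ?_ ?_ <;>
  · simp [wedge, knFrame, connL', connT, connK', psiBar, polyQ'_eq' hx]
    try field_simp
    try ring

theorem extD_connT (hx : x ∈ knDomain p) :
    (∀ i, DifferentiableAt ℝ (fun y => connT p y i) x) ∧ ∀ c d,
    extD (connT p) x c d = (2 * psiBar p x - p.Λ / 3)
        * (wedge (knFrame p x 0) (knFrame p x 1) c d + wedge (knFrame p x 2) (knFrame p x 3) c d)
      - 2 * wedge (connN' p x) (connL' p x) c d := by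
  have hz := zeta_ne_zero hx
  have hw := zetaBar_ne_zero hx
  have hQ := polyQ_ne_zero hx
  have hP := polyP_ne_zero hx
  have hs := iSin_ne_zero hx
  have da := HasRC.const (x := x) (p.a : ℂ)
  have dh := HasRC.const (x := x) (1 / 2 : ℂ)
  have dw := hasRC_zetaBar (p := p) x
  have dQ := hasRC_polyQ (p := p) x
  have dP := hasRC_polyP (p := p) x
  obtain ⟨q, dQ'⟩ := exists_hasRC_polyQ' (p := p) x
  have dP' := hasRC_polyP' (p := p) x
  have dK : HasRC (connK' p) _ _ x := ((HasRC.const (-((p.m : ℂ) - Complex.I * knL p))).div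
    (dw.mul dw) (mul_ne_zero hw hw)).add ((HasRC.const ((p.Λ : ℂ) / 3)).mul dw)
  refine extD_eq (Θ := connT p) dK ((dh.mul dQ').div dQ hQ)
    ((hasRC_iSin hs).mul ((dh.mul dP').div dP hP)).neg
    ((((da.mul dP).div dw hw).sub (dh.mul dP')).sub ((hasRC_polyF (p := p) x).mul dK))
    (fun c d => by rw [wedge_antisymm, wedge_antisymm (knFrame p x 2),
      wedge_antisymm (connN' p x)]; ring) ?_ ?_ ?_ ?_ ?_ ?_ <;>
  · simp [-zero_eq_mul, wedge, knFrame, connN', connL', connK', psiBar, polyP''_eq' hx, polyQ'_eq' hx]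
    try field_simp
    try ring

end Curvature

/-! ### Curvature matrices in terms of bivectors. -/

section CurvatureForm

theorem pdMat_connMat {A B N L N' L' : Coords → ℂ} (c : Fin 4) (x : Coords) :
    pdMat c (fun y => connMat (A y) (B y) (N y) (L y) (N' y) (L' y)) x
      = connMat (pd c A x) (pd c B x) (pd c N x) (pd c L x) (pd c N' x) (pd c L' x) := by
  ext i j
  fin_cases i <;> fin_cases j <;> simp [pdMat, connMat, pd_neg, pd_const]

theorem connMat_add (A B N L N' L' A₁ B₁ N₁ L₁ N₁' L₁' : ℂ) :
    connMat A B N L N' L' + connMat A₁ B₁ N₁ L₁ N₁' L₁'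
      = connMat (A + A₁) (B + B₁) (N + N₁) (L + L₁) (N' + N₁') (L' + L₁') := by
  ext i j
  fin_cases i <;> fin_cases j <;> simp [connMat] <;> ring

theorem connMat_sub (A B N L N' L' A₁ B₁ N₁ L₁ N₁' L₁' : ℂ) :
    connMat A B N L N' L' - connMat A₁ B₁ N₁ L₁ N₁' L₁'
      = connMat (A - A₁) (B - B₁) (N - N₁) (L - L₁) (N' - N₁') (L' - L₁') := by
  ext i j
  fin_cases i <;> fin_cases j <;> simp [connMat] <;> ring

theorem connMat_commutator (A B N L N' L' A₁ B₁ N₁ L₁ N₁' L₁' : ℂ) :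
    connMat A B N L N' L' * connMat A₁ B₁ N₁ L₁ N₁' L₁'
      - connMat A₁ B₁ N₁ L₁ N₁' L₁' * connMat A B N L N' L'
    = connMat (N' * L₁' - N₁' * L' + (N * L₁ - N₁ * L)) (N' * L₁' - N₁' * L' - (N * L₁ - N₁ * L))
        ((A - B) * N₁ - (A₁ - B₁) * N) (-((A - B) * L₁ - (A₁ - B₁) * L))
        ((A + B) * N₁' - (A₁ + B₁) * N') (-((A + B) * L₁' - (A₁ + B₁) * L')) := by
  ext i j
  rw [Matrix.sub_apply, Matrix.mul_apply, Matrix.mul_apply, Fin.sum_univ_four, Fin.sum_univ_four]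
  fin_cases i <;> fin_cases j <;> simp [connMat] <;> ring

/-- With S = A - B and T = A + B the connection splits along the two sl₂ factors. The curvatures of
(S, N, L) and (T, N', L') therefore do not mix. -/
theorem connCurv_connMat {S T N L N' L' : Coords → Fin 4 → ℂ} {x : Coords}
    (hS : ∀ i, DifferentiableAt ℝ (fun y => S y i) x)
    (hT : ∀ i, DifferentiableAt ℝ (fun y => T y i) x) (c d : Fin 4) :
    connCurv (fun y c => connMat (1 / 2 * (S y c + T y c)) (1 / 2 * (T y c - S y c))
      (N y c) (L y c) (N' y c) (L' y c)) x c d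
    = connMat
      (1 / 2 * ((extD S x c d + 2 * wedge (N x) (L x) c d)
        + (extD T x c d + 2 * wedge (N' x) (L' x) c d)))
      (1 / 2 * ((extD T x c d + 2 * wedge (N' x) (L' x) c d)
        - (extD S x c d + 2 * wedge (N x) (L x) c d)))
      (extD N x c d + wedge (S x) (N x) c d) (extD L x c d - wedge (S x) (L x) c d)
      (extD N' x c d + wedge (T x) (N' x) c d) (extD L' x c d - wedge (T x) (L' x) c d) := by
  have h1 : ∀ c d, pd c (fun y => 1 / 2 * (S y d + T y d)) x
      = 1 / 2 * (pd c (fun y => S y d) x + pd c (fun y => T y d) x) := by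
    intro c d
    rw [pd_const_mul ((hS d).fun_add (hT d)), pd_add (hS d) (hT d)]
  have h2 : ∀ c d, pd c (fun y => 1 / 2 * (T y d - S y d)) x
      = 1 / 2 * (pd c (fun y => T y d) x - pd c (fun y => S y d) x) := by
    intro c d
    rw [pd_const_mul ((hT d).fun_sub (hS d)), pd_sub (hT d) (hS d)]
  simp only [connCurv, pdMat_connMat, h1, h2, connMat_commutator, connMat_sub, connMat_add, extD,
    wedge]
  congr 1 <;> ring

theorem nullEta_mul_connMat (S T N L N' L' : ℂ) :
    nullEta * connMat (1 / 2 * (S + T)) (1 / 2 * (T - S)) N L N' L'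
      = L • bivX + N • bivY + (1 / 2 * S) • bivZ
        + (L' • bivX' + N' • bivY' + (1 / 2 * T) • bivZ') := by
  ext i j
  fin_cases i <;> fin_cases j <;>
    simp [connMat, nullEta, bivX, bivY, bivZ, bivX', bivY', bivZ', Matrix.mul_apply,
      Fin.sum_univ_four] <;> ring

/-- The tensor `g_{ac} g_{bd} - g_{ad} g_{bc}` in terms of the bivectors of a null frame. -/
theorem metric_wedge_eq (E : Matrix (Fin 4) (Fin 4) ℂ) (a b c d : Fin 4) :
    (Eᵀ * nullEta * E) a c * (Eᵀ * nullEta * E) b d - (Eᵀ * nullEta * E) a d * (Eᵀ * nullEta * E) b c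
    = -((Eᵀ * bivX * E) a b * (Eᵀ * bivY * E) c d + (Eᵀ * bivY * E) a b * (Eᵀ * bivX * E) c d
        + 1 / 2 * ((Eᵀ * bivZ * E) a b * (Eᵀ * bivZ * E) c d))
      - ((Eᵀ * bivX' * E) a b * (Eᵀ * bivY' * E) c d + (Eᵀ * bivY' * E) a b * (Eᵀ * bivX' * E) c d
        + 1 / 2 * ((Eᵀ * bivZ' * E) a b * (Eᵀ * bivZ' * E) c d)) := by
  have h : ∀ a b, (Eᵀ * nullEta * E) a b
      = -E 0 a * E 1 b - E 1 a * E 0 b + E 2 a * E 3 b + E 3 a * E 2 b := by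
    intro a b
    simp [nullEta, Matrix.mul_apply, Fin.sum_univ_four]; ring
  simp only [h, bivX_apply, bivY_apply, bivZ_apply, bivX'_apply, bivY'_apply, bivZ'_apply, wedge]
  ring

variable {E G : Matrix (Fin 4) (Fin 4) ℂ}

theorem trace_tmul (hG : E * G * Eᵀ = nullEta) (s t : Matrix (Fin 4) (Fin 4) ℂ) (b d : Fin 4) :
    ∑ a, ∑ c, G a c * ((Eᵀ * s * E) a b * (Eᵀ * t * E) c d)
      = (Eᵀ * (sᵀ * nullEta * t) * E) b d := by
  have h : Eᵀ * (sᵀ * nullEta * t) * E = (Eᵀ * s * E)ᵀ * G * (Eᵀ * t * E) := by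
    rw [← hG]; simp only [transpose_mul, transpose_transpose, Matrix.mul_assoc]
  rw [h]
  simp only [Matrix.mul_apply (M := (Eᵀ * s * E)ᵀ * G), Matrix.mul_apply (M := (Eᵀ * s * E)ᵀ),
    Finset.sum_mul, transpose_apply]
  rw [Finset.sum_comm]
  exact Finset.sum_congr rfl fun _ _ => Finset.sum_congr rfl fun _ _ => by ring

/-- Tracing the first index of each pair commutes with the passage to the frame, so tracelessness
becomes an identity between constant 4×4 matrices. -/
theorem trace_typeD (hG : E * G * Eᵀ = nullEta) {X Y Z : Matrix (Fin 4) (Fin 4) ℂ}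
    (h0 : Xᵀ * nullEta * Y + Yᵀ * nullEta * X - Zᵀ * nullEta * Z = 0) (b d : Fin 4) :
    ∑ a, ∑ c, G a c * typeD (Eᵀ * X * E) (Eᵀ * Y * E) (Eᵀ * Z * E) a b c d = 0 := by
  have h1 : Eᵀ * (Xᵀ * nullEta * Y) * E + Eᵀ * (Yᵀ * nullEta * X) * E
      - Eᵀ * (Zᵀ * nullEta * Z) * E = 0 := by
    rw [← Matrix.add_mul, ← Matrix.mul_add, ← Matrix.sub_mul, ← Matrix.mul_sub, h0]; simp
  have h2 := congrFun (congrFun h1 b) d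
  simp only [Matrix.add_apply, Matrix.sub_apply, ← trace_tmul hG, Matrix.zero_apply] at h2
  rw [← h2]
  simp only [typeD, mul_add, mul_sub, Finset.sum_add_distrib, Finset.sum_sub_distrib]

theorem biv_trace : bivXᵀ * nullEta * bivY + bivYᵀ * nullEta * bivX - bivZᵀ * nullEta * bivZ = 0 := by
  ext i j
  fin_cases i <;> fin_cases j <;>
    simp [nullEta, bivX, bivY, bivZ, Matrix.mul_apply, Fin.sum_univ_four]

theorem biv_trace' :
    bivX'ᵀ * nullEta * bivY' + bivY'ᵀ * nullEta * bivX' - bivZ'ᵀ * nullEta * bivZ' = 0 := by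
  ext i j
  fin_cases i <;> fin_cases j <;>
    simp [nullEta, bivX', bivY', bivZ', Matrix.mul_apply, Fin.sum_univ_four]

end CurvatureForm

/-! ### The Riemann tensor of the Kerr-NUT-(Anti)-de Sitter metric. -/

section Weyl

variable {p : Params} {x : Coords}

/-- Smoothness is inherited from the frame: near x the metric is the real part of Eᵀ η E. -/
theorem contDiffAt_knMetric (hx : x ∈ knDomain p) (i j : Fin 4) :
    ContDiffAt ℝ ∞ (fun y => knMetric p y i j) x := by
  have hE := fun i j => contDiffAt_knFrame (p := p) hx i j
  have h : ContDiffAt ℝ ∞ (fun y => ((knFrame p y)ᵀ * nullEta * knFrame p y) i j) x := by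
    simp only [Matrix.mul_apply, transpose_apply]
    exact ContDiffAt.sum fun k _ => (ContDiffAt.sum fun l _ => (hE l i).mul contDiffAt_const).mul
      (hE k j)
  have h2 := Complex.reCLM.contDiff.contDiffAt.comp x h
  refine h2.congr_of_eventuallyEq ?_
  filter_upwards [(isOpen_knDomain p).mem_nhds hx] with y hy
  have := congrFun (congrFun (metricC_knMetric hy) i) j
  simp only [Function.comp, ← this]
  rfl

theorem knMetric_symm (p : Params) (x : Coords) (a b : Fin 4) :
    knMetric p x a b = knMetric p x b a := by
  simp only [knMetric, Matrix.of_apply]; ring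

theorem det_knMetric_ne_zero (hx : x ∈ knDomain p) : (knMetric p x).det ≠ 0 :=
  det_ne_zero_of_frame (metricC_knMetric hx) (knFrame_mul_knCoframe hx) nullEta_mul_self

theorem pdMat_knFrame (hx : x ∈ knDomain p) (c : Fin 4) : pdMat c (knFrame p) x
    = knFrame p x * christoffelMat (knMetric p) x c - knConn p x c * knFrame p x := by
  refine pdMat_eq_of_structure (η := nullEta) (e := knCoframe p x) (W := knConn p) ?_
    (fun a b => (contDiffAt_knMetric hx a b).differentiableAt (by simp))
    (fun i a => (contDiffAt_knFrame hx i a).differentiableAt (by simp))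
    (knFrame_mul_knCoframe hx) nullEta_mul_self nullEta_transpose
    (fun c => connMat_antisymm _ _ _ _ _ _) (fun c d i => knFrame_torsion hx c d i) c
  filter_upwards [(isOpen_knDomain p).mem_nhds hx] with y hy using metricC_knMetric hy

theorem connCurv_knConn (hx : x ∈ knDomain p) (c d : Fin 4) :
    connCurv (knConn p) x c d = connMat
      (1 / 2 * ((2 * psi p x - p.Λ / 3) * ((knFrame p x)ᵀ * bivZ * knFrame p x) c d
        + (2 * psiBar p x - p.Λ / 3) * ((knFrame p x)ᵀ * bivZ' * knFrame p x) c d))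
      (1 / 2 * ((2 * psiBar p x - p.Λ / 3) * ((knFrame p x)ᵀ * bivZ' * knFrame p x) c d
        - (2 * psi p x - p.Λ / 3) * ((knFrame p x)ᵀ * bivZ * knFrame p x) c d))
      (-(psi p x + p.Λ / 3) * ((knFrame p x)ᵀ * bivX * knFrame p x) c d)
      (-(psi p x + p.Λ / 3) * ((knFrame p x)ᵀ * bivY * knFrame p x) c d)
      (-(psiBar p x + p.Λ / 3) * ((knFrame p x)ᵀ * bivX' * knFrame p x) c d)
      (-(psiBar p x + p.Λ / 3) * ((knFrame p x)ᵀ * bivY' * knFrame p x) c d) := by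
  have h := connCurv_connMat (N := connN p) (L := connL p) (N' := connN' p) (L' := connL' p)
    (extD_connS hx).1 (extD_connT hx).1 c d
  simp only [(extD_connS hx).2, (extD_connT hx).2, (extD_connN hx).2, (extD_connL hx).2,
    (extD_connN' hx).2, (extD_connL' hx).2] at h
  simp only [bivX_apply, bivY_apply, bivZ_apply, bivX'_apply, bivY'_apply, bivZ'_apply]
  refine h.trans ?_
  congr 1 <;> ring

theorem differentiableAt_knConn (hx : x ∈ knDomain p) (c i j : Fin 4) :
    DifferentiableAt ℝ (fun y => knConn p y c i j) x := by
  have hS := (extD_connS hx).1 c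
  have hT := (extD_connT hx).1 c
  have hN := (extD_connN hx).1 c
  have hL := (extD_connL hx).1 c
  have hN' := (extD_connN' hx).1 c
  have hL' := (extD_connL' hx).1 c
  fin_cases i <;> fin_cases j <;> simp [knConn, connMat] <;> fun_prop

/-- The Riemann tensor of the Kerr-NUT-(Anti)-de Sitter metric. -/
theorem riemann_knMetric (hx : x ∈ knDomain p) (a b c d : Fin 4) :
    ((riemann (knMetric p) x a b c d : ℝ) : ℂ)
      = -psi p x * typeD ((knFrame p x)ᵀ * bivX * knFrame p x)
            ((knFrame p x)ᵀ * bivY * knFrame p x) ((knFrame p x)ᵀ * bivZ * knFrame p x) a b c d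
        - psiBar p x * typeD ((knFrame p x)ᵀ * bivX' * knFrame p x)
            ((knFrame p x)ᵀ * bivY' * knFrame p x) ((knFrame p x)ᵀ * bivZ' * knFrame p x) a b c d
        + p.Λ / 3 * ((knMetric p x a c : ℂ) * knMetric p x b d
          - (knMetric p x a d : ℂ) * knMetric p x b c) := by
  have hR := frame_mul_riemannUp (fun i a => contDiffAt_knFrame hx i a)
    (fun c i j => differentiableAt_knConn hx c i j)
    (fun a b c => (contDiffAt_christoffel (fun a b => contDiffAt_knMetric hx a b)
      (det_knMetric_ne_zero hx) a b c).differentiableAt (by simp))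
    (by filter_upwards [(isOpen_knDomain p).mem_nhds hx] with y hy using fun c => pdMat_knFrame hy c)
    c d
  have hg : ∀ a b, (knMetric p x a b : ℂ) = ((knFrame p x)ᵀ * nullEta * knFrame p x) a b :=
    fun a b => congrFun (congrFun (metricC_knMetric hx) a) b
  have h1 : ((riemann (knMetric p) x a b c d : ℝ) : ℂ)
      = (metricC (knMetric p) x * (of fun a b => (riemannUp (knMetric p) x a b c d : ℂ))) a b := by
    simp only [riemann, Matrix.mul_apply, metricC, of_apply, Complex.ofReal_sum,
      Complex.ofReal_mul]
  -- In the self-dual half, XY + YX has coefficient -ψ - Λ/3 and ZZ has ψ - Λ/6; the other half is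
  -- the same with ψ̄. The Λ terms of both halves assemble to the constant curvature tensor by
  -- `metric_wedge_eq`.
  rw [h1, metricC_knMetric hx, Matrix.mul_assoc, hR, connCurv_knConn hx, ← Matrix.mul_assoc,
    Matrix.mul_assoc _ nullEta, nullEta_mul_connMat, hg, hg, hg, hg, metric_wedge_eq]
  simp only [Matrix.mul_add, Matrix.add_mul, Matrix.mul_smul, Matrix.smul_mul, Matrix.add_apply,
    Matrix.smul_apply, smul_eq_mul, typeD]
  ring

end Weyl

/-! ### Conformal weight of the Weyl tensor and of its dual. -/

section WeylDual

variable {g g' : MetricField} {x : Coords} {U : Coords → ℝ}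

/-- A conformal change turns S into S - S' and V into e^{2U}V, which is still trace-free for the new
metric. Uniqueness of the decomposition then gives the weight. -/
theorem weyl_conformal_of_decomposition {Ω : Set Coords} (hΩ : IsOpen Ω) (hx : x ∈ Ω)
    (hg : ∀ y ∈ Ω, ∀ a b, ContDiffAt ℝ ∞ (fun z => g z a b) y)
    (hs : ∀ y ∈ Ω, ∀ a b, g y a b = g y b a) (hdet : ∀ y ∈ Ω, (g y).det ≠ 0)
    (hU : ∀ y ∈ Ω, ContDiffAt ℝ ∞ U y)
    (hg' : ∀ y ∈ Ω, g' y = Real.exp (2 * U y) • g y)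
    {V : Fin 4 → Fin 4 → Fin 4 → Fin 4 → ℝ} {S : Fin 4 → Fin 4 → ℝ}
    (hV : ∀ b d, ∑ a, ∑ c, invMetric g x a c * V a b c d = 0)
    (hR : ∀ a b c d, riemann g x a b c d = V a b c d
      + (g x a c * S b d - g x a d * S b c - g x b c * S a d + g x b d * S a c))
    (a b c d : Fin 4) : weyl g' x a b c d = Real.exp (2 * U x) * weyl g x a b c d := by
  obtain ⟨S', hS'⟩ := riemann_conformal hΩ hx hg hs hdet hU hg'
  have hgx : ∀ a b, g' x a b = Real.exp (2 * U x) * g x a b := by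
    intro a b; rw [hg' x hx]; rfl
  have hdet' : (g' x).det ≠ 0 := by
    rw [hg' x hx, Matrix.det_smul]
    exact mul_ne_zero (pow_ne_zero _ (Real.exp_ne_zero _)) (hdet x hx)
  rw [weyl_eq_of_decomposition (hs x hx) (hdet x hx) hV hR]
  refine weyl_eq_of_decomposition (V := fun a b c d => Real.exp (2 * U x) * V a b c d)
    (S := fun a b => S a b - S' a b)
    (fun a b => by rw [hgx, hgx, hs x hx]) hdet' (fun b d => ?_) (fun a b c d => ?_) a b c d
  · simp only [invMetric_conformal (hg' x hx) (hdet x hx)]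
    have h : ∀ a c, Real.exp (-2 * U x) * invMetric g x a c * (Real.exp (2 * U x) * V a b c d)
        = invMetric g x a c * V a b c d := by
      intro a c
      have h1 : Real.exp (-2 * U x) * Real.exp (2 * U x) = 1 := by rw [← Real.exp_add]; simp
      linear_combination invMetric g x a c * V a b c d * h1
    simp only [h, hV]
  · simp only [hS', hR, hgx]; ring

theorem volForm_conformal (hg' : g' x = Real.exp (2 * U x) • g x) (a b c d : Fin 4) :
    volForm g' x a b c d = Real.exp (2 * U x) ^ 2 * volForm g x a b c d := by
  have h : |(g' x).det| = (Real.exp (2 * U x) ^ 2) ^ 2 * |(g x).det| := by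
    rw [hg', Matrix.det_smul, abs_mul, abs_of_pos (pow_pos (Real.exp_pos _) _), ← pow_mul]
    rfl
  rw [volForm, volForm, h, Real.sqrt_mul (by positivity), Real.sqrt_sq (by positivity)]
  ring

theorem weylDual_conformal (hg' : g' x = Real.exp (2 * U x) • g x) (hdet : (g x).det ≠ 0)
    (hC : ∀ a b c d, weyl g' x a b c d = Real.exp (2 * U x) * weyl g x a b c d)
    (a b c d : Fin 4) : weylDual g' x a b c d = Real.exp (2 * U x) * weylDual g x a b c d := by
  have h1 : Real.exp (-2 * U x) * Real.exp (2 * U x) = 1 := by rw [← Real.exp_add]; simp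
  simp only [weylDual, volForm_conformal hg', invMetric_conformal hg' hdet, hC, Finset.mul_sum]
  refine Finset.sum_congr rfl fun e _ => Finset.sum_congr rfl fun f _ => Finset.sum_congr rfl
    fun e' _ => Finset.sum_congr rfl fun f' _ => ?_
  linear_combination (1 / 2 * Real.exp (2 * U x) * volForm g x a b e f * invMetric g x e e'
    * invMetric g x f f' * weyl g x e' f' c d)
    * (Real.exp (-2 * U x) * Real.exp (2 * U x) + 1) * h1

theorem weylC_conformal (hg' : g' x = Real.exp (2 * U x) • g x) (hdet : (g x).det ≠ 0)
    (hC : ∀ a b c d, weyl g' x a b c d = Real.exp (2 * U x) * weyl g x a b c d)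
    (a b c d : Fin 4) : weylC g' x a b c d = (Real.exp (2 * U x) : ℂ) * weylC g x a b c d := by
  rw [weylC, weylC, hC, weylDual_conformal hg' hdet hC]
  push_cast
  ring

/-- The permutation symbol with integer values. -/
def permSymbolInt (a b c d : Fin 4) : ℤ :=
  (Matrix.of fun i j : Fin 4 => if ![a, b, c, d] i = j then (1 : ℤ) else 0).det

theorem permSymbol_eq_cast (a b c d : Fin 4) : permSymbol a b c d = (permSymbolInt a b c d : ℝ) := by
  rw [permSymbol, permSymbolInt, Int.cast_det]
  congr 1
  ext i j
  simp [apply_ite]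

end WeylDual

/-- The sign of a permutation is the product of the signs of its differences, and a repeated index
makes a difference vanish. Over the integers the 256 cases are decidable. -/
theorem permSymbolInt_eq : ∀ a b c d : Fin 4, permSymbolInt a b c d =
    Int.sign ((b : ℤ) - a) * Int.sign ((c : ℤ) - a) * Int.sign ((d : ℤ) - a)
    * (Int.sign ((c : ℤ) - b) * Int.sign ((d : ℤ) - b) * Int.sign ((d : ℤ) - c)) := by
  decide +kernel

/-! ### Hodge duality of bivectors. -/

section Hodge

/-- The dual of an antisymmetric contravariant tensor, without the volume factor. -/
def hodgeMat (B : Matrix (Fin 4) (Fin 4) ℂ) : Matrix (Fin 4) (Fin 4) ℂ :=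
  !![0, B 2 3, -B 1 3, B 1 2; -B 2 3, 0, B 0 3, -B 0 2; B 1 3, -B 0 3, 0, B 0 1;
    -B 1 2, B 0 2, -B 0 1, 0]

theorem sum_permSymbol_mul {B : Matrix (Fin 4) (Fin 4) ℂ} (hB : ∀ e f, B e f = -B f e)
    (a b : Fin 4) :
    1 / 2 * ∑ e, ∑ f, (permSymbol a b e f : ℂ) * B e f = hodgeMat B a b := by
  have h10 := hB 1 0
  have h20 := hB 2 0
  have h30 := hB 3 0
  have h21 := hB 2 1
  have h31 := hB 3 1
  have h32 := hB 3 2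
  simp only [permSymbol_eq_cast, permSymbolInt_eq, Fin.sum_univ_four, h10, h20, h30, h21, h31, h32]
  have s2 : Int.sign 2 = 1 := rfl
  have s3 : Int.sign 3 = 1 := rfl
  fin_cases a <;> fin_cases b <;> simp [hodgeMat, s2, s3] <;> ring

/-- The dual of a complex covariant tensor with respect to its first two indices. -/
def hodgeC (g : MetricField) (x : Coords) (T : CTensor4) : CTensor4 := fun a b c d =>
  1 / 2 * ∑ e, ∑ f, (volForm g x a b e f : ℂ) *
    ∑ e', ∑ f', invMetricC g x e e' * invMetricC g x f f' * T e' f' c d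

variable {g : MetricField} {x : Coords}

theorem ofReal_weylDual (a b c d : Fin 4) : ((weylDual g x a b c d : ℝ) : ℂ)
    = hodgeC g x (fun a b c d => (weyl g x a b c d : ℂ)) a b c d := by
  simp only [weylDual, hodgeC, Complex.ofReal_mul, Complex.ofReal_sum, Complex.ofReal_div,
    Complex.ofReal_one, Complex.ofReal_ofNat, invMetricC, of_apply]

/-- The dual acts on the first index pair only, and X, Y, Z are eigenbivectors with a common
eigenvalue. -/
theorem hodgeC_typeD {X Y Z : Matrix (Fin 4) (Fin 4) ℂ} {k : ℂ}
    (h : ∀ M ∈ [X, Y, Z], ∀ a b, 1 / 2 * ∑ e, ∑ f, (volForm g x a b e f : ℂ) *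
      (∑ e', ∑ f', invMetricC g x e e' * invMetricC g x f f' * M e' f') = k * M a b)
    (a b c d : Fin 4) : hodgeC g x (typeD X Y Z) a b c d = k * typeD X Y Z a b c d := by
  simp only [List.forall_mem_cons, List.not_mem_nil, false_implies, implies_true, and_true] at h
  obtain ⟨hX, hY, hZ⟩ := h
  have e1 : ∀ M M' : Matrix (Fin 4) (Fin 4) ℂ, 1 / 2 * ∑ e, ∑ f, (volForm g x a b e f : ℂ) *
      (∑ e', ∑ f', invMetricC g x e e' * invMetricC g x f f' * (M e' f' * M' c d))
      = (1 / 2 * ∑ e, ∑ f, (volForm g x a b e f : ℂ) *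
      (∑ e', ∑ f', invMetricC g x e e' * invMetricC g x f f' * M e' f')) * M' c d := by
    intro M M'
    simp only [← mul_assoc, ← Finset.sum_mul]
  simp only [hodgeC, typeD, mul_add, mul_sub, Finset.sum_add_distrib, Finset.sum_sub_distrib, e1,
    hX, hY, hZ]
  ring

theorem hodgeC_add_smul (S T : CTensor4) (s t : ℂ) (a b c d : Fin 4) :
    hodgeC g x (fun a b c d => s * S a b c d + t * T a b c d) a b c d
      = s * hodgeC g x S a b c d + t * hodgeC g x T a b c d := by
  simp only [hodgeC, mul_add, Finset.sum_add_distrib, mul_left_comm _ s, mul_left_comm _ t,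
    ← Finset.mul_sum]

variable {E e : Matrix (Fin 4) (Fin 4) ℂ}

/-- Raising both indices turns Eᵀ s E into e (η s η) eᵀ. Up to sign, conjugation by η interchanges X
with Y and fixes Z, which is why the dual of one bivector is computed from another one. -/
theorem sum_volForm_mul {v : ℂ} (hv : (Real.sqrt |(g x).det| : ℂ) = v) (he : E * e = 1)
    (hG : invMetricC g x = e * nullEta * eᵀ) {s t : Matrix (Fin 4) (Fin 4) ℂ}
    (hst : nullEta * s * nullEta = -t) (ht : tᵀ = -t) (a b : Fin 4) :
    1 / 2 * ∑ i, ∑ f, (volForm g x a b i f : ℂ) *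
      (∑ e', ∑ f', invMetricC g x i e' * invMetricC g x f f' * (Eᵀ * s * E) e' f')
    = -(v * hodgeMat (eᵀᵀ * t * eᵀ) a b) := by
  have h1 : invMetricC g x * (Eᵀ * s * E) * (invMetricC g x)ᵀ = -(eᵀᵀ * t * eᵀ) := by
    have h2 : eᵀ * Eᵀ = 1 := by rw [← transpose_mul, he, transpose_one]
    calc invMetricC g x * (Eᵀ * s * E) * (invMetricC g x)ᵀ
        = e * (nullEta * (eᵀ * Eᵀ) * s * (E * e) * nullEta) * eᵀ := by
          rw [hG]
          simp only [transpose_mul, transpose_transpose, nullEta_transpose, Matrix.mul_assoc]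
      _ = e * (nullEta * s * nullEta) * eᵀ := by
          rw [h2, he, Matrix.mul_one, Matrix.mul_one]
      _ = -(eᵀᵀ * t * eᵀ) := by rw [hst, transpose_transpose]; simp
  have h3 : ∀ i f, ∑ e', ∑ f', invMetricC g x i e' * invMetricC g x f f' * (Eᵀ * s * E) e' f'
      = -(eᵀᵀ * t * eᵀ) i f := by
    intro i f
    rw [← Matrix.neg_apply, ← h1, Matrix.mul_apply]
    simp only [Matrix.mul_apply (M := invMetricC g x), Finset.sum_mul, transpose_apply]
    rw [Finset.sum_comm]
    exact Finset.sum_congr rfl fun _ _ => Finset.sum_congr rfl fun _ _ => by ring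
  have h4 : ∀ i f, (eᵀᵀ * t * eᵀ) i f = -(eᵀᵀ * t * eᵀ) f i := by
    intro i f
    have : (eᵀᵀ * t * eᵀ)ᵀ = -(eᵀᵀ * t * eᵀ) := by
      simp only [transpose_mul, transpose_transpose, ht, Matrix.neg_mul, Matrix.mul_neg,
        Matrix.mul_assoc]
    rw [← Matrix.neg_apply, ← this, transpose_apply]
  rw [← sum_permSymbol_mul h4, ← hv]
  simp only [h3, volForm, Complex.ofReal_mul, Finset.mul_sum, ← Finset.sum_neg_distrib]
  exact Finset.sum_congr rfl fun _ _ => Finset.sum_congr rfl fun _ _ => by ring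

end Hodge

/-! ### Self-duality of the frame bivectors and the complex Weyl tensor. -/

section KerrNUTWeyl

variable {p : Params} {x : Coords}

theorem det_nullEta : nullEta.det = 1 := by
  simp [nullEta, Matrix.det_succ_row_zero, Fin.sum_univ_succ, Fin.succAbove]

theorem det_knFrame (hx : x ∈ knDomain p) :
    (knFrame p x).det = zeta p x * zetaBar p x * iSin x := by
  have hz := zeta_ne_zero hx
  have hw := zetaBar_ne_zero hx
  have hQ := polyQ_ne_zero hx
  have hP := polyP_ne_zero hx
  simp [knFrame, Matrix.det_succ_row_zero, Fin.sum_univ_succ, Fin.succAbove]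
  field_simp
  ring

/-- From det E = R² i sin θ and det η = 1 follows det g = -(R² sin θ)². The factor -i, due to i sin
θ in place of sin θ, becomes the eigenvalues -i and i of the dual. -/
theorem sqrt_det_knMetric (hx : x ∈ knDomain p) :
    (Real.sqrt |(knMetric p x).det| : ℂ) = -Complex.I * (zeta p x * zetaBar p x * iSin x) := by
  have hs := Real.sin_pos_of_pos_of_lt_pi hx.1 hx.2.1
  have h1 : (((knMetric p x).det : ℝ) : ℂ) = ((-(knR2 p x * Real.sin (x 2)) ^ 2 : ℝ) : ℂ) := by
    have hm : metricC (knMetric p) x = (knMetric p x).map (algebraMap ℝ ℂ) := rfl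
    have h2 := congrArg Matrix.det (metricC_knMetric hx)
    rw [hm, ← RingHom.mapMatrix_apply, ← RingHom.map_det, det_mul, det_mul, det_transpose,
      det_nullEta, det_knFrame hx, ← ofReal_knR2] at h2
    have h3 : (((knMetric p x).det : ℝ) : ℂ) = algebraMap ℝ ℂ (knMetric p x).det := rfl
    rw [h3, h2]
    push_cast [-Complex.ofReal_sin]
    linear_combination (knR2 p x : ℂ) ^ 2 * iSin_sq x
  rw [Complex.ofReal_inj.mp h1, abs_neg, abs_of_nonneg (sq_nonneg _),
    Real.sqrt_sq (mul_pos hx.2.2.1 hs).le, ← ofReal_knR2, iSin]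
  push_cast [-Complex.ofReal_sin]
  linear_combination ((knR2 p x : ℂ) * Real.sin (x 2)) * Complex.I_sq

theorem hodgeMat_antisymm (B : Matrix (Fin 4) (Fin 4) ℂ) (a b : Fin 4) :
    hodgeMat B a b = -hodgeMat B b a := by
  fin_cases a <;> fin_cases b <;> simp [hodgeMat]

theorem hodgeMat_knCoframe (hx : x ∈ knDomain p) (a b : Fin 4) :
    (zeta p x * zetaBar p x * iSin x * hodgeMat ((knCoframe p x)ᵀᵀ * bivY * (knCoframe p x)ᵀ) a b
      = -((knFrame p x)ᵀ * bivX * knFrame p x) a b ∧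
    zeta p x * zetaBar p x * iSin x * hodgeMat ((knCoframe p x)ᵀᵀ * bivX * (knCoframe p x)ᵀ) a b
      = -((knFrame p x)ᵀ * bivY * knFrame p x) a b ∧
    zeta p x * zetaBar p x * iSin x * hodgeMat ((knCoframe p x)ᵀᵀ * bivZ * (knCoframe p x)ᵀ) a b
      = -((knFrame p x)ᵀ * bivZ * knFrame p x) a b) ∧
    zeta p x * zetaBar p x * iSin x * hodgeMat ((knCoframe p x)ᵀᵀ * bivY' * (knCoframe p x)ᵀ) a b
      = ((knFrame p x)ᵀ * bivX' * knFrame p x) a b ∧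
    zeta p x * zetaBar p x * iSin x * hodgeMat ((knCoframe p x)ᵀᵀ * bivX' * (knCoframe p x)ᵀ) a b
      = ((knFrame p x)ᵀ * bivY' * knFrame p x) a b ∧
    zeta p x * zetaBar p x * iSin x * hodgeMat ((knCoframe p x)ᵀᵀ * bivZ' * (knCoframe p x)ᵀ) a b
      = ((knFrame p x)ᵀ * bivZ' * knFrame p x) a b := by
  have hz := zeta_ne_zero hx
  have hw := zetaBar_ne_zero hx
  have hQ := polyQ_ne_zero hx
  have hP := polyP_ne_zero hx
  have hs := iSin_ne_zero hx
  simp only [bivX_apply, bivY_apply, bivZ_apply, bivX'_apply, bivY'_apply, bivZ'_apply]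
  refine ⟨⟨?_, ?_, ?_⟩, ?_, ?_, ?_⟩ <;>
  · revert a b
    refine eq_of_antisymm (fun a b => by rw [hodgeMat_antisymm]; ring)
      (fun a b => by simp only [wedge]; ring) ?_ ?_ ?_ ?_ ?_ ?_ <;>
    · simp only [hodgeMat, bivX_apply, bivY_apply, bivZ_apply, bivX'_apply, bivY'_apply,
        bivZ'_apply]
      simp [-mul_eq_zero, -zero_eq_mul, wedge, knFrame, knCoframe]
      try field_simp
      try ring

theorem nullEta_conj_biv :
    (nullEta * bivX * nullEta = -bivY ∧ nullEta * bivY * nullEta = -bivX ∧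
      nullEta * bivZ * nullEta = -bivZ) ∧
    nullEta * bivX' * nullEta = -bivY' ∧ nullEta * bivY' * nullEta = -bivX' ∧
      nullEta * bivZ' * nullEta = -bivZ' := by
  refine ⟨⟨?_, ?_, ?_⟩, ?_, ?_, ?_⟩ <;>
  · ext i j
    fin_cases i <;> fin_cases j <;>
      simp [nullEta, bivX, bivY, bivZ, bivX', bivY', bivZ', Matrix.mul_apply, Fin.sum_univ_four]

theorem transpose_biv :
    (bivXᵀ = -bivX ∧ bivYᵀ = -bivY ∧ bivZᵀ = -bivZ) ∧
      bivX'ᵀ = -bivX' ∧ bivY'ᵀ = -bivY' ∧ bivZ'ᵀ = -bivZ' := by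
  refine ⟨⟨?_, ?_, ?_⟩, ?_, ?_, ?_⟩ <;>
  · ext i j
    fin_cases i <;> fin_cases j <;> simp [bivX, bivY, bivZ, bivX', bivY', bivZ']

theorem invMetricC_knMetric (hx : x ∈ knDomain p) :
    invMetricC (knMetric p) x = knCoframe p x * nullEta * (knCoframe p x)ᵀ :=
  invMetricC_eq_of_frame (metricC_knMetric hx) (knFrame_mul_knCoframe hx) nullEta_mul_self

theorem knFrame_mul_invMetricC (hx : x ∈ knDomain p) :
    knFrame p x * invMetricC (knMetric p) x * (knFrame p x)ᵀ = nullEta := by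
  have he := knFrame_mul_knCoframe hx
  have h1 : (knCoframe p x)ᵀ * (knFrame p x)ᵀ = 1 := by rw [← transpose_mul, he, transpose_one]
  calc knFrame p x * invMetricC (knMetric p) x * (knFrame p x)ᵀ
      = (knFrame p x * knCoframe p x) * nullEta * ((knCoframe p x)ᵀ * (knFrame p x)ᵀ) := by
        rw [invMetricC_knMetric hx]; simp only [Matrix.mul_assoc]
    _ = nullEta := by rw [he, h1, Matrix.one_mul, Matrix.mul_one]

variable (p x) in
/-- The self-dual type D tensor of the null frame. -/
def knTypeD : CTensor4 := typeD ((knFrame p x)ᵀ * bivX * knFrame p x)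
  ((knFrame p x)ᵀ * bivY * knFrame p x) ((knFrame p x)ᵀ * bivZ * knFrame p x)

variable (p x) in
/-- The anti-self-dual type D tensor of the null frame. -/
def knTypeD' : CTensor4 := typeD ((knFrame p x)ᵀ * bivX' * knFrame p x)
  ((knFrame p x)ᵀ * bivY' * knFrame p x) ((knFrame p x)ᵀ * bivZ' * knFrame p x)

theorem hodgeC_knTypeD (hx : x ∈ knDomain p) (a b c d : Fin 4) :
    hodgeC (knMetric p) x (knTypeD p x) a b c d = -Complex.I * knTypeD p x a b c d := by
  refine hodgeC_typeD ?_ a b c d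
  have hv := fun {s t : Matrix (Fin 4) (Fin 4) ℂ} (h1 : nullEta * s * nullEta = -t)
    (h2 : tᵀ = -t) a b => sum_volForm_mul (sqrt_det_knMetric hx) (knFrame_mul_knCoframe hx)
    (invMetricC_knMetric hx) h1 h2 a b
  obtain ⟨⟨c1, c2, c3⟩, -⟩ := nullEta_conj_biv
  obtain ⟨⟨t1, t2, t3⟩, -⟩ := transpose_biv
  simp only [List.forall_mem_cons, List.not_mem_nil, false_implies, implies_true, and_true]
  refine ⟨fun a b => ?_, fun a b => ?_, fun a b => ?_⟩
  · rw [hv c1 t2]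
    linear_combination Complex.I * (hodgeMat_knCoframe hx a b).1.1
  · rw [hv c2 t1]
    linear_combination Complex.I * (hodgeMat_knCoframe hx a b).1.2.1
  · rw [hv c3 t3]
    linear_combination Complex.I * (hodgeMat_knCoframe hx a b).1.2.2

theorem hodgeC_knTypeD' (hx : x ∈ knDomain p) (a b c d : Fin 4) :
    hodgeC (knMetric p) x (knTypeD' p x) a b c d = Complex.I * knTypeD' p x a b c d := by
  refine hodgeC_typeD ?_ a b c d
  have hv := fun {s t : Matrix (Fin 4) (Fin 4) ℂ} (h1 : nullEta * s * nullEta = -t)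
    (h2 : tᵀ = -t) a b => sum_volForm_mul (sqrt_det_knMetric hx) (knFrame_mul_knCoframe hx)
    (invMetricC_knMetric hx) h1 h2 a b
  obtain ⟨-, c1, c2, c3⟩ := nullEta_conj_biv
  obtain ⟨-, t1, t2, t3⟩ := transpose_biv
  simp only [List.forall_mem_cons, List.not_mem_nil, false_implies, implies_true, and_true]
  refine ⟨fun a b => ?_, fun a b => ?_, fun a b => ?_⟩
  · rw [hv c1 t2]
    linear_combination Complex.I * (hodgeMat_knCoframe hx a b).2.1
  · rw [hv c2 t1]
    linear_combination Complex.I * (hodgeMat_knCoframe hx a b).2.2.1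
  · rw [hv c3 t3]
    linear_combination Complex.I * (hodgeMat_knCoframe hx a b).2.2.2

variable (p x) in
/-- The trace-free part of the Riemann tensor of the Kerr-NUT-(Anti)-de Sitter metric. -/
def knWeylPart (a b c d : Fin 4) : ℝ := riemann (knMetric p) x a b c d
  - p.Λ / 3 * (knMetric p x a c * knMetric p x b d - knMetric p x a d * knMetric p x b c)

theorem ofReal_knWeylPart (hx : x ∈ knDomain p) (a b c d : Fin 4) :
    (knWeylPart p x a b c d : ℂ)
      = -psi p x * knTypeD p x a b c d + -psiBar p x * knTypeD' p x a b c d := by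
  rw [knWeylPart]
  push_cast
  rw [riemann_knMetric hx, knTypeD, knTypeD']
  ring

theorem trace_knWeylPart (hx : x ∈ knDomain p) (b d : Fin 4) :
    ∑ a, ∑ c, invMetric (knMetric p) x a c * knWeylPart p x a b c d = 0 := by
  have hG := knFrame_mul_invMetricC hx
  have h1 := trace_typeD hG biv_trace b d
  have h2 := trace_typeD hG biv_trace' b d
  have h3 : ((∑ a, ∑ c, invMetric (knMetric p) x a c * knWeylPart p x a b c d : ℝ) : ℂ) = 0 := by
    simp only [Complex.ofReal_sum, Complex.ofReal_mul, ofReal_knWeylPart hx, mul_add,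
      Finset.sum_add_distrib, mul_left_comm _ (-psi p x), mul_left_comm _ (-psiBar p x),
      ← Finset.mul_sum]
    have h1' : ∑ a, ∑ c, (invMetric (knMetric p) x a c : ℂ) * knTypeD p x a b c d = 0 := h1
    have h2' : ∑ a, ∑ c, (invMetric (knMetric p) x a c : ℂ) * knTypeD' p x a b c d = 0 := h2
    rw [h1', h2']; ring
  exact_mod_cast h3

theorem riemann_knMetric_decomposition (a b c d : Fin 4) : riemann (knMetric p) x a b c d
    = knWeylPart p x a b c d + (knMetric p x a c * (p.Λ / 6 * knMetric p x b d)
      - knMetric p x a d * (p.Λ / 6 * knMetric p x b c)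
      - knMetric p x b c * (p.Λ / 6 * knMetric p x a d)
      + knMetric p x b d * (p.Λ / 6 * knMetric p x a c)) := by
  rw [knWeylPart]; ring

theorem weyl_knMetric (hx : x ∈ knDomain p) (a b c d : Fin 4) :
    ((weyl (knMetric p) x a b c d : ℝ) : ℂ)
      = -psi p x * knTypeD p x a b c d + -psiBar p x * knTypeD' p x a b c d := by
  rw [weyl_eq_of_decomposition (S := fun a b => p.Λ / 6 * knMetric p x a b) (knMetric_symm p x)
    (det_knMetric_ne_zero hx) (trace_knWeylPart hx) riemann_knMetric_decomposition,
    ofReal_knWeylPart hx]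

/-- The dual has eigenvalue -i on the first half of the Weyl tensor and i on the second, so adding i
times the dual doubles the first half and kills the second. -/
theorem weylC_knMetric (hx : x ∈ knDomain p) (a b c d : Fin 4) :
    weylC (knMetric p) x a b c d = -2 * psi p x * knTypeD p x a b c d := by
  have h : (fun a b c d => ((weyl (knMetric p) x a b c d : ℝ) : ℂ))
      = fun a b c d => -psi p x * knTypeD p x a b c d + -psiBar p x * knTypeD' p x a b c d := by
    funext a b c d; exact weyl_knMetric hx a b c d
  rw [weylC, ofReal_weylDual, h, weyl_knMetric hx, hodgeC_add_smul, hodgeC_knTypeD hx,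
    hodgeC_knTypeD' hx]
  linear_combination (psi p x * knTypeD p x a b c d - psiBar p x * knTypeD' p x a b c d)
    * Complex.I_sq

theorem weylC_conformal_knMetric {Ω : Set Coords} (hΩ : IsOpen Ω) (hΩp : Ω ⊆ knDomain p)
    {U : Coords → ℝ} (hU : ContDiffOn ℝ ∞ U Ω) {g' : MetricField}
    (hg' : ∀ x ∈ Ω, g' x = Real.exp (2 * U x) • knMetric p x) (hx : x ∈ Ω) (a b c d : Fin 4) :
    weylC g' x a b c d = -2 * (Real.exp (2 * U x) : ℂ) * psi p x * knTypeD p x a b c d := by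
  rw [weylC_conformal (hg' x hx) (det_knMetric_ne_zero (hΩp hx)), weylC_knMetric (hΩp hx)]
  · ring
  · exact weyl_conformal_of_decomposition hΩ hx
      (fun y hy a b => contDiffAt_knMetric (hΩp hy) a b) (fun y _ => knMetric_symm p y)
      (fun y hy => det_knMetric_ne_zero (hΩp hy)) (fun y hy => hU.contDiffAt (hΩ.mem_nhds hy)) hg'
      (S := fun a b => p.Λ / 6 * knMetric p x a b) (trace_knWeylPart (hΩp hx))
      riemann_knMetric_decomposition

end KerrNUTWeyl

/-! ### The invariant `J_ergo` -/

section Invariant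

variable {p : Params} {x : Coords}

variable (p x) in
/-- The frame components of `-dζ/ζ`. -/
def knXi : Fin 4 → ℂ :=
  ![polyQ p x / (2 * (zeta p x * zetaBar p x) * zeta p x), -1 / zeta p x,
    -(p.a * polyP p x) / (2 * (zeta p x * zetaBar p x) * zeta p x), p.a / zeta p x]

/-- Only ℓ and m occur in N: the congruence of ℓ is geodesic and shear-free. The same ξ describes
the second congruence in `connL_eq`. -/
theorem connN_eq (hx : x ∈ knDomain p) (c : Fin 4) : connN p x c
    = knXi p x 3 * knFrame p x 0 c + knXi p x 1 * knFrame p x 2 c := by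
  have hz := zeta_ne_zero hx
  have hw := zetaBar_ne_zero hx
  have hQ := polyQ_ne_zero hx
  have hP := polyP_ne_zero hx
  fin_cases c <;> simp [connN, knXi, knFrame] <;> field_simp <;> ring

theorem connL_eq (hx : x ∈ knDomain p) (c : Fin 4) : connL p x c
    = knXi p x 2 * knFrame p x 1 c + knXi p x 0 * knFrame p x 3 c := by
  have hz := zeta_ne_zero hx
  have hw := zetaBar_ne_zero hx
  have hQ := polyQ_ne_zero hx
  have hP := polyP_ne_zero hx
  fin_cases c <;> simp [connL, knXi, knFrame] <;> field_simp <;> ring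

theorem hasRC_psi (hx : x ∈ knDomain p) :
    HasRC (psi p) (-3 * psi p x / zeta p x) (3 * p.a * psi p x / zeta p x) x := by
  have hz := zeta_ne_zero hx
  have dz := hasRC_zeta (p := p) x
  have h := (HasRC.const (-((p.m : ℂ) + Complex.I * knL p))).div ((dz.mul dz).mul dz)
    (mul_ne_zero (mul_ne_zero hz hz) hz)
  have he : psi p = fun y => -((p.m : ℂ) + Complex.I * knL p) / (zeta p y * zeta p y * zeta p y) := by
    funext y; rw [psi, pow_three']
  rw [he]
  exact h.congr (by field_simp; ring) (by field_simp; ring)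

theorem pd_psi (hx : x ∈ knDomain p) (c : Fin 4) :
    pd c (psi p) x = 3 * psi p x * (knXi p x ᵥ* knFrame p x) c := by
  have hz := zeta_ne_zero hx
  have hw := zetaBar_ne_zero hx
  have hQ := polyQ_ne_zero hx
  have hP := polyP_ne_zero hx
  rw [(hasRC_psi hx).pd_eq, vecMul, dotProduct, Fin.sum_univ_four]
  fin_cases c <;> simp [-mul_eq_zero, -zero_eq_mul, knXi, knFrame] <;> field_simp <;> ring

/-- This is dζ·dζ/ζ²: the radial part of dζ contributes Q/R² and the imaginary angular part
contributes -a²P/R². -/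
theorem covContr_knXi (hx : x ∈ knDomain p) : covContr nullEta (knXi p x) (knXi p x)
    = (polyQ p x - p.a ^ 2 * polyP p x) / (zeta p x * zetaBar p x * zeta p x ^ 2) := by
  have hz := zeta_ne_zero hx
  have hw := zetaBar_ne_zero hx
  rw [covContr_nullEta]
  simp [knXi]
  field_simp
  ring

theorem conj_iCos (x : Coords) : (starRingEnd ℂ) (iCos x) = -iCos x := by
  rw [iCos, map_mul, Complex.conj_I, Complex.conj_ofReal]; ring

theorem conj_iSin (x : Coords) : (starRingEnd ℂ) (iSin x) = -iSin x := by
  rw [iSin, map_mul, Complex.conj_I, Complex.conj_ofReal]; ring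

theorem conj_zeta (x : Coords) : (starRingEnd ℂ) (zeta p x) = zetaBar p x := by
  simp only [zeta, zetaBar, iL, map_add, map_mul, conj_iCos, Complex.conj_I, Complex.conj_ofReal]
  ring

theorem conj_zetaBar (x : Coords) : (starRingEnd ℂ) (zetaBar p x) = zeta p x := by
  rw [← conj_zeta, Complex.conj_conj]

theorem conj_polyQ (x : Coords) : (starRingEnd ℂ) (polyQ p x) = polyQ p x := by
  rw [← ofReal_knQ, Complex.conj_ofReal]

theorem conj_polyP (x : Coords) : (starRingEnd ℂ) (polyP p x) = polyP p x := by
  rw [← ofReal_knP, Complex.conj_ofReal]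

theorem conj_polyF (x : Coords) : (starRingEnd ℂ) (polyF p x) = polyF p x := by
  rw [← ofReal_form, Complex.conj_ofReal]

theorem conj_knFrame (hx : x ∈ knDomain p) (c : Fin 4) :
    (starRingEnd ℂ) (knFrame p x 0 c) = knFrame p x 0 c ∧
    (starRingEnd ℂ) (knFrame p x 1 c) = knFrame p x 1 c ∧
    (starRingEnd ℂ) (knFrame p x 2 c)
      = 2 * (zeta p x * zetaBar p x) / polyP p x * knFrame p x 3 c ∧
    (starRingEnd ℂ) (knFrame p x 3 c)
      = (2 * (zeta p x * zetaBar p x) / polyP p x)⁻¹ * knFrame p x 2 c := by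
  have hz := zeta_ne_zero hx
  have hw := zetaBar_ne_zero hx
  have hQ := polyQ_ne_zero hx
  have hP := polyP_ne_zero hx
  have h2 : (starRingEnd ℂ) 2 = 2 := map_ofNat _ 2
  fin_cases c <;>
    simp [knFrame, h2, conj_zeta, conj_zetaBar, conj_polyQ, conj_polyP, conj_polyF, conj_iSin] <;>
    (try field_simp) <;> (try simp)

theorem isConjFrame_knFrame (hx : x ∈ knDomain p) : IsConjFrame (knFrame p x) := by
  have hz := zeta_ne_zero hx
  have hw := zetaBar_ne_zero hx
  have hP := polyP_ne_zero hx
  have hk : 2 * (zeta p x * zetaBar p x) / polyP p x ≠ 0 :=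
    div_ne_zero (mul_ne_zero two_ne_zero (mul_ne_zero hz hw)) hP
  refine ⟨_, hk, fun a b => ?_⟩
  simp only [Matrix.smul_apply, smul_eq_mul, bivX_apply, bivY_apply, bivZ_apply, bivX'_apply,
    bivY'_apply, bivZ'_apply, wedge, map_sub, map_mul, (conj_knFrame hx _).1,
    (conj_knFrame hx _).2.1, (conj_knFrame hx _).2.2.1, (conj_knFrame hx _).2.2.2]
  refine ⟨by ring, by ring, ?_⟩
  have := mul_inv_cancel₀ hk
  linear_combination (knFrame p x 2 a * knFrame p x 3 b - knFrame p x 3 a * knFrame p x 2 b) * this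

/-- The value of `J_ergo` for a conformally rescaled Kerr-NUT-(Anti)-de Sitter metric. -/
theorem Jergo_conformal_knMetric {Ω : Set Coords} (hΩ : IsOpen Ω) (hΩp : Ω ⊆ knDomain p)
    {U : Coords → ℝ} (hU : ContDiffOn ℝ ∞ U Ω) {g' : MetricField}
    (hg' : ∀ x ∈ Ω, g' x = Real.exp (2 * U x) • knMetric p x) (hx : x ∈ Ω) :
    Jergo g' x = Real.exp (-10 * U x) * (-2 * (psi p x ^ 4
      * ((polyQ p x - p.a ^ 2 * polyP p x) / (zeta p x * zetaBar p x * zeta p x ^ 2))).re) := by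
  have hxp := hΩp hx
  rw [← covContr_knXi hxp]
  exact Jergo_conformal_typeD hΩ hx (fun y hy => metricC_knMetric (hΩp hy))
    (fun y hy => knFrame_mul_knCoframe (hΩp hy))
    (fun a b => (contDiffAt_knMetric hxp a b).differentiableAt (by simp))
    (fun i a => (contDiffAt_knFrame hxp i a).differentiableAt (by simp))
    (fun y hy => isConjFrame_knFrame (hΩp hy))
    ((hU.contDiffAt (hΩ.mem_nhds hx)).differentiableAt (by simp)) (hasRC_psi hxp).diff hg'
    (fun c => pdMat_knFrame hxp c) (connN_eq hxp) (connL_eq hxp) (pd_psi hxp)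
    (fun y hy => weylC_conformal_knMetric hΩ hΩp hU hg' hy)

theorem Jergo_knMetric (hx : x ∈ knDomain p) :
    Jergo (knMetric p) x = -2 * (psi p x ^ 4
      * ((polyQ p x - p.a ^ 2 * polyP p x) / (zeta p x * zetaBar p x * zeta p x ^ 2))).re := by
  -- The metric itself is the case U = 0, taken on the whole coordinate domain.
  have h := Jergo_conformal_knMetric (g' := knMetric p) (U := fun _ => 0) (isOpen_knDomain p)
    subset_rfl contDiffOn_const (fun y _ => by simp) hx
  simpa using h

theorem knPsi2_eq (p : Params) (x : Coords) : knPsi2 p x = psi p x := by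
  have h : (x 1 : ℂ) + Complex.I * ((p.l + p.a * Real.cos (x 2) : ℝ) : ℂ) = zeta p x := by
    rw [zeta, iL, iCos]; push_cast; ring
  rw [knPsi2, h, psi, one_div, inv_pow, div_eq_mul_inv]

theorem zetaBar_eq (p : Params) (x : Coords) :
    (x 1 : ℂ) - Complex.I * ((p.a * Real.cos (x 2) + p.l : ℝ) : ℂ) = zetaBar p x := by
  rw [zetaBar, iL, iCos]; push_cast; ring

theorem knR_sq (hx : x ∈ knDomain p) : (knR p x : ℂ) ^ 2 = zeta p x * zetaBar p x := by
  rw [← ofReal_knR2, knR, ← Complex.ofReal_pow, Real.sq_sqrt hx.2.2.1.le]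

theorem sqrt_two_sq : (Real.sqrt 2 : ℂ) ^ 2 = 2 := by
  rw [← Complex.ofReal_pow, Real.sq_sqrt (by norm_num)]; norm_num

theorem knRho_sq_sub_knTau_sq (hx : x ∈ knDomain p) : 2 * (knRho p x ^ 2 - knTau p x ^ 2)
    = (polyQ p x - p.a ^ 2 * polyP p x) / (zeta p x * zetaBar p x * zeta p x ^ 2) := by
  have hz := zeta_ne_zero hx
  have hw := zetaBar_ne_zero hx
  -- Only the square of the principal root occurs, so the sign of Q plays no role.
  have hQ : ((knQ p x : ℂ) ^ (1 / 2 : ℂ)) ^ 2 = polyQ p x := by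
    have := Complex.cpow_nat_inv_pow (knQ p x : ℂ) (two_ne_zero)
    rw [ofReal_knQ] at *
    rw [one_div]; exact_mod_cast this
  have hP : (Real.sqrt (knP p x) : ℂ) ^ 2 = polyP p x := by
    rw [← ofReal_knP, ← Complex.ofReal_pow, Real.sq_sqrt hx.2.2.2.1.le]
  have hR : ((knR p x : ℂ) ^ 3) ^ 2 = (zeta p x * zetaBar p x) ^ 3 := by
    rw [← knR_sq hx]; ring
  rw [knRho, knTau, zetaBar_eq]
  simp only [mul_pow, div_pow, hQ, hP, hR, sqrt_two_sq]
  field_simp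

end Invariant

/-! ### The field ∂_t and its norm. -/

section StationaryLimit

variable {p : Params} {x : Coords}

theorem pd_zero_knMetric (hx : x ∈ knDomain p) (a b : Fin 4) :
    pd 0 (fun y => knMetric p y a b) x = 0 := by
  have hd : DifferentiableAt ℝ (fun y => knMetric p y a b) x :=
    (contDiffAt_knMetric hx a b).differentiableAt (by simp)
  rw [pd, ← hd.lineDeriv_eq_fderiv, lineDeriv]
  have h : (fun t : ℝ => knMetric p (x + t • Pi.single 0 1) a b) = fun _ => knMetric p x a b := by
    funext t
    simp [knMetric, knQ, knP, knR2, knForm0, knForm2]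
  rw [h, deriv_const]

theorem lieMetric_dt (g : MetricField) (x : Coords) (a b : Fin 4) :
    lieMetric g dt x a b = pd 0 (fun y => g y a b) x := by
  have h : ∀ (i c : Fin 4), pd i (fun y => dt y c) x = 0 := fun i c => pd_const i (dt x c) x
  simp only [lieMetric, h, mul_zero, add_zero, Fin.sum_univ_four]
  simp [dt]

theorem sum_dt (M : Matrix (Fin 4) (Fin 4) ℝ) (x : Coords) :
    ∑ a, ∑ b, M a b * dt x a * dt x b = M 0 0 := by
  simp [dt, Fin.sum_univ_four]

/-- The component g_tt is (a²P - Q)/R², with the numerator of ξ·ξ up to sign. -/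
theorem knMetric_zero_zero (hx : x ∈ knDomain p) (h : knMetric p x 0 0 = 0) :
    polyQ p x - p.a ^ 2 * polyP p x = 0 := by
  have hz := zeta_ne_zero hx
  have hw := zetaBar_ne_zero hx
  have h1 := ofReal_knMetric (p := p) (x := x) 0 0
  rw [h] at h1
  simp at h1
  field_simp at h1
  linear_combination h1

end StationaryLimit

/-! ### The Newman-Penrose scalars -/

section NewmanPenrose

variable {p : Params} {x : Coords}

variable (p x) in
/-- The ratio of `knEll` to the frame covector `ℓ`. -/
def ratioL : ℂ := ((Real.sqrt (knQ p x) / (Real.sqrt 2 * knR p x) : ℝ) : ℂ)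

variable (p x) in
/-- The ratio of `knM` to the frame covector `m`. -/
def ratioM : ℂ := ((Real.sqrt (knP p x) / (Real.sqrt 2 * knR p x) : ℝ) : ℂ)

theorem ofReal_knR_ne_zero (hx : x ∈ knDomain p) : (knR p x : ℂ) ≠ 0 :=
  Complex.ofReal_ne_zero.mpr (Real.sqrt_pos.mpr hx.2.2.1).ne'

theorem ofReal_sqrt_two_ne_zero : (Real.sqrt 2 : ℂ) ≠ 0 :=
  Complex.ofReal_ne_zero.mpr (by positivity)

theorem ofReal_sqrt_knQ_ne_zero (hQ : 0 < knQ p x) : (Real.sqrt (knQ p x) : ℂ) ≠ 0 :=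
  Complex.ofReal_ne_zero.mpr (Real.sqrt_pos.mpr hQ).ne'

theorem ofReal_sqrt_knP_ne_zero (hx : x ∈ knDomain p) : (Real.sqrt (knP p x) : ℂ) ≠ 0 :=
  Complex.ofReal_ne_zero.mpr (Real.sqrt_pos.mpr hx.2.2.2.1).ne'

theorem sqrt_knQ_sq (hQ : 0 < knQ p x) : (Real.sqrt (knQ p x) : ℂ) ^ 2 = polyQ p x := by
  rw [← ofReal_knQ, ← Complex.ofReal_pow, Real.sq_sqrt hQ.le]

theorem sqrt_knP_sq (hx : x ∈ knDomain p) : (Real.sqrt (knP p x) : ℂ) ^ 2 = polyP p x := by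
  rw [← ofReal_knP, ← Complex.ofReal_pow, Real.sq_sqrt hx.2.2.2.1.le]

theorem ratioL_ne_zero (hx : x ∈ knDomain p) (hQ : 0 < knQ p x) : ratioL p x ≠ 0 := by
  rw [ratioL]; push_cast
  exact div_ne_zero (ofReal_sqrt_knQ_ne_zero hQ)
    (mul_ne_zero ofReal_sqrt_two_ne_zero (ofReal_knR_ne_zero hx))

theorem ratioM_ne_zero (hx : x ∈ knDomain p) : ratioM p x ≠ 0 := by
  rw [ratioM]; push_cast
  exact div_ne_zero (ofReal_sqrt_knP_ne_zero hx)
    (mul_ne_zero ofReal_sqrt_two_ne_zero (ofReal_knR_ne_zero hx))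

/-- The tetrad of square roots differs from the rational frame by the boost `ratioL` on ℓ, n and by
the rescaling `ratioM` on m, m̃. Ψ₂ has weight zero under both, ρ scales with `ratioL` and τ with
`ratioM`. -/
theorem knEll_eq (hx : x ∈ knDomain p) (hQ : 0 < knQ p x) (i : Fin 4) :
    knEll p x i = ratioL p x * knFrame p x 0 i := by
  have hR := ofReal_knR_ne_zero hx
  have h2 := ofReal_sqrt_two_ne_zero
  have hq := ofReal_sqrt_knQ_ne_zero hQ
  simp only [knEll, knT, ratioL, cons_val_zero, cons_val_one, Complex.ofReal_mul,
    Complex.ofReal_div, ofReal_knForm0]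
  fin_cases i <;> simp [knFrame, formR, ← knR_sq hx, ← sqrt_knQ_sq hQ] <;> field_simp

theorem knN_eq (hx : x ∈ knDomain p) (hQ : 0 < knQ p x) (i : Fin 4) :
    knN p x i = (ratioL p x)⁻¹ * knFrame p x 1 i := by
  have hR := ofReal_knR_ne_zero hx
  have h2 := ofReal_sqrt_two_ne_zero
  have hq := ofReal_sqrt_knQ_ne_zero hQ
  have hs := sqrt_two_sq
  simp only [knN, knT, ratioL, cons_val_zero, cons_val_one, Complex.ofReal_mul,
    Complex.ofReal_div, ofReal_knForm0]
  fin_cases i <;> simp [knFrame, formR, ← knR_sq hx, ← sqrt_knQ_sq hQ] <;> field_simp <;>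
    rw [hs]

theorem knM_eq (hx : x ∈ knDomain p) (i : Fin 4) :
    knM p x i = ratioM p x * knFrame p x 2 i := by
  have hR := ofReal_knR_ne_zero hx
  have h2 := ofReal_sqrt_two_ne_zero
  have hq := ofReal_sqrt_knP_ne_zero hx
  simp only [knM, knT, ratioM, cons_val, Complex.ofReal_mul,
    Complex.ofReal_div, ofReal_knForm2]
  fin_cases i <;> simp [knFrame, formTheta, iSin, ← knR_sq hx, ← sqrt_knP_sq hx] <;> field_simp

/-- The conjugate of the frame covector m is (2R²/P) m̃, and `ratioM` squared is P/(2R²). -/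
theorem conjCov_knM_eq (hx : x ∈ knDomain p) (i : Fin 4) :
    conjCov (knM p) x i = (ratioM p x)⁻¹ * knFrame p x 3 i := by
  have hR := ofReal_knR_ne_zero hx
  have h2 := ofReal_sqrt_two_ne_zero
  have hq := ofReal_sqrt_knP_ne_zero hx
  have hP := polyP_ne_zero hx
  have hc : (starRingEnd ℂ) (ratioM p x) = ratioM p x := by rw [ratioM, Complex.conj_ofReal]
  rw [conjCov, knM_eq hx, map_mul, hc, (conj_knFrame hx i).2.2.1, ← mul_assoc]
  congr 1
  apply eq_inv_of_mul_eq_one_left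
  rw [ratioM]
  push_cast
  rw [← knR_sq hx, ← sqrt_knP_sq hx]
  field_simp
  rw [sqrt_two_sq]

theorem cinner_frame (hx : x ∈ knDomain p) {α β : CCovector} {k k' : ℂ} {i j : Fin 4}
    (hα : ∀ a, α x a = k * knFrame p x i a) (hβ : ∀ a, β x a = k' * knFrame p x j a) :
    cinner (knMetric p) α β x = k * k' * nullEta i j := by
  rw [← knFrame_mul_invMetricC hx, Matrix.mul_apply]
  simp only [Matrix.mul_apply, cinner, hα, hβ, Finset.sum_mul, Finset.mul_sum, transpose_apply]
  rw [Finset.sum_comm]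
  exact Finset.sum_congr rfl fun _ _ => Finset.sum_congr rfl fun _ _ => by
    rw [invMetricC, of_apply]; ring

theorem sharp_frame (hx : x ∈ knDomain p) {α : CCovector} {k : ℂ} {i : Fin 4}
    (hα : ∀ a, α x a = k * knFrame p x i a) (a : Fin 4) :
    sharp (knMetric p) α x a = k * (knCoframe p x * nullEta) a i := by
  have h : knCoframe p x * nullEta = invMetricC (knMetric p) x * (knFrame p x)ᵀ := by
    rw [invMetricC_knMetric hx, Matrix.mul_assoc _ _ (knFrame p x)ᵀ, ← transpose_mul,
      knFrame_mul_knCoframe hx, transpose_one, Matrix.mul_one]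
  rw [h, Matrix.mul_apply, sharp, Finset.mul_sum]
  refine Finset.sum_congr rfl fun b _ => ?_
  rw [hα, invMetricC, of_apply, transpose_apply]
  ring

theorem isNullTetradAt_knMetric (hx : x ∈ knDomain p) (hQ : 0 < knQ p x) :
    IsNullTetradAt (knMetric p) (knEll p) (knN p) (knM p) x := by
  have hl := knEll_eq hx hQ
  have hn := knN_eq hx hQ
  have hm := knM_eq hx
  have hc : (starRingEnd ℂ) (ratioL p x) = ratioL p x := by rw [ratioL, Complex.conj_ofReal]
  have h1 := mul_inv_cancel₀ (ratioL_ne_zero hx hQ)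
  have h2 := mul_inv_cancel₀ (ratioM_ne_zero hx)
  refine ⟨?_, ?_, ?_, ?_, ?_, ?_, ?_, ?_, ?_⟩
  · funext i
    rw [conjCov, hl, map_mul, hc, (conj_knFrame hx i).1]
  · funext i
    rw [conjCov, hn, map_mul, map_inv₀, hc, (conj_knFrame hx i).2.1]
  · rw [cinner_frame hx hl hl]; simp [nullEta]
  · rw [cinner_frame hx hn hn]; simp [nullEta]
  · rw [cinner_frame hx hm hm]; simp [nullEta]
  · rw [cinner_frame hx hl hn, h1]; simp [nullEta]
  · rw [cinner_frame hx hm (conjCov_knM_eq hx), h2]; simp [nullEta]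
  · rw [cinner_frame hx hl hm]; simp [nullEta]
  · rw [cinner_frame hx hn hm]; simp [nullEta]

variable {E e : Matrix (Fin 4) (Fin 4) ℂ}

theorem sum_biv_frame (he : E * e = 1) (s : Matrix (Fin 4) (Fin 4) ℂ) (i j : Fin 4) :
    ∑ a, ∑ b, (Eᵀ * s * E) a b * (e * nullEta) a i * (e * nullEta) b j
      = (nullEta * s * nullEta) i j := by
  have h1 : eᵀ * Eᵀ = 1 := by rw [← transpose_mul, he, transpose_one]
  have h : nullEta * s * nullEta = (e * nullEta)ᵀ * (Eᵀ * s * E) * (e * nullEta) := by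
    calc nullEta * s * nullEta = nullEta * (eᵀ * Eᵀ) * s * (E * e) * nullEta := by
          rw [h1, he, Matrix.mul_one, Matrix.mul_one]
      _ = (e * nullEta)ᵀ * (Eᵀ * s * E) * (e * nullEta) := by
          rw [transpose_mul, nullEta_transpose]; simp only [Matrix.mul_assoc]
  rw [h, Matrix.mul_apply (M := (e * nullEta)ᵀ * (Eᵀ * s * E)), Finset.sum_comm]
  refine Finset.sum_congr rfl fun b _ => ?_
  rw [Matrix.mul_apply (M := (e * nullEta)ᵀ), Finset.sum_mul]
  exact Finset.sum_congr rfl fun a _ => by rw [transpose_apply]; ring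

theorem sum_tmul_frame (he : E * e = 1) (s t : Matrix (Fin 4) (Fin 4) ℂ) (i j k l : Fin 4) :
    ∑ a, ∑ b, ∑ c, ∑ d, (Eᵀ * s * E) a b * (Eᵀ * t * E) c d * (e * nullEta) a i
        * (e * nullEta) b j * (e * nullEta) c k * (e * nullEta) d l
      = (nullEta * s * nullEta) i j * (nullEta * t * nullEta) k l := by
  rw [← sum_biv_frame he, ← sum_biv_frame he]
  rw [Finset.sum_mul]
  refine Finset.sum_congr rfl fun a _ => ?_
  rw [Finset.sum_mul]
  refine Finset.sum_congr rfl fun b _ => ?_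
  simp only [Finset.mul_sum]
  exact Finset.sum_congr rfl fun c _ => Finset.sum_congr rfl fun d _ => by ring

theorem sum_typeD_frame (he : E * e = 1) (X Y Z : Matrix (Fin 4) (Fin 4) ℂ) (i j k l : Fin 4) :
    ∑ a, ∑ b, ∑ c, ∑ d, typeD (Eᵀ * X * E) (Eᵀ * Y * E) (Eᵀ * Z * E) a b c d
        * (e * nullEta) a i * (e * nullEta) b j * (e * nullEta) c k * (e * nullEta) d l
      = typeD (nullEta * X * nullEta) (nullEta * Y * nullEta) (nullEta * Z * nullEta) i j k l := by
  simp only [typeD, sub_mul, add_mul, Finset.sum_add_distrib, Finset.sum_sub_distrib,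
    sum_tmul_frame he]

theorem npPsi2_knMetric (hx : x ∈ knDomain p) (hQ : 0 < knQ p x) :
    npPsi2 (knMetric p) (knEll p) (knN p) (knM p) x = psi p x := by
  have he := knFrame_mul_knCoframe hx
  have h1 := mul_inv_cancel₀ (ratioL_ne_zero hx hQ)
  have h2 := mul_inv_cancel₀ (ratioM_ne_zero hx)
  have h3 : ∀ a b c d, ((weyl (knMetric p) x a b c d : ℝ) : ℂ) * sharp (knMetric p) (knEll p) x a
      * sharp (knMetric p) (knM p) x b * sharp (knMetric p) (conjCov (knM p)) x c
      * sharp (knMetric p) (knN p) x d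
      = -psi p x * (knTypeD p x a b c d * (knCoframe p x * nullEta) a 0
          * (knCoframe p x * nullEta) b 2 * (knCoframe p x * nullEta) c 3
          * (knCoframe p x * nullEta) d 1)
        + -psiBar p x * (knTypeD' p x a b c d * (knCoframe p x * nullEta) a 0
          * (knCoframe p x * nullEta) b 2 * (knCoframe p x * nullEta) c 3
          * (knCoframe p x * nullEta) d 1) := by
    intro a b c d
    rw [weyl_knMetric hx, sharp_frame hx (knEll_eq hx hQ), sharp_frame hx (knN_eq hx hQ),
      sharp_frame hx (knM_eq hx), sharp_frame hx (conjCov_knM_eq hx)]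
    generalize (knCoframe p x * nullEta) a 0 = A0
    generalize (knCoframe p x * nullEta) b 2 = A1
    generalize (knCoframe p x * nullEta) c 3 = A2
    generalize (knCoframe p x * nullEta) d 1 = A3
    linear_combination (-psi p x * knTypeD p x a b c d + -psiBar p x * knTypeD' p x a b c d)
      * A0 * A1 * A2 * A3 * (ratioM p x * (ratioM p x)⁻¹ * h1 + h2)
  simp only [npPsi2, h3, Finset.sum_add_distrib, ← Finset.mul_sum, knTypeD, knTypeD',
    sum_typeD_frame he]
  -- On (ℓ, m, m̄, n) the self-dual tensor has the value -1, from the product of the X and Y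
  -- components alone, and the anti-self-dual one vanishes. This fixes the sign of Ψ₂.
  obtain ⟨⟨c1, c2, c3⟩, c1', c2', c3'⟩ := nullEta_conj_biv
  rw [c1, c2, c3, c1', c2', c3']
  simp [typeD, bivX, bivY, bivZ, bivX', bivY', bivZ']

theorem pd_knEll (hx : x ∈ knDomain p) (hQ : 0 < knQ p x) (a b : Fin 4) :
    pd b (fun y => knEll p y a) x
      = pd b (ratioL p) x * knFrame p x 0 a + ratioL p x * pd b (fun y => knFrame p y 0 a) x := by
  have hR : 0 < knR p x := Real.sqrt_pos.mpr hx.2.2.1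
  have h1 : DifferentiableAt ℝ (ratioL p) x := by
    have hdQ : DifferentiableAt ℝ (knQ p) x := by unfold knQ; fun_prop
    have hdR2 : DifferentiableAt ℝ (knR2 p) x := by unfold knR2; fun_prop
    have hdR : DifferentiableAt ℝ (knR p) x := hdR2.sqrt hx.2.2.1.ne'
    have hd := (hdQ.sqrt hQ.ne').fun_mul ((hdR.const_mul (Real.sqrt 2)).fun_inv
      (mul_ne_zero (by positivity) hR.ne'))
    simp only [← div_eq_mul_inv] at hd
    exact differentiableAt_ofReal hd
  rw [← pd_mul h1 ((contDiffAt_knFrame hx 0 a).differentiableAt (by simp))]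
  have hc : Continuous (knQ p) := by unfold knQ; fun_prop
  apply pd_congr
  filter_upwards [(isOpen_knDomain p).mem_nhds hx, (isOpen_lt continuous_const hc).mem_nhds hQ]
    with y hy hyQ using knEll_eq hy hyQ a

theorem covDeriv1_knEll (hx : x ∈ knDomain p) (hQ : 0 < knQ p x) (a b : Fin 4) :
    covDeriv1 (knMetric p) (knEll p) x a b = pd b (ratioL p) x * knFrame p x 0 a
      - ratioL p x * (knConn p x b * knFrame p x) 0 a := by
  have h := congrFun (congrFun (pdMat_knFrame hx b) 0) a
  rw [pdMat, of_apply, Matrix.sub_apply, Matrix.mul_apply] at h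
  rw [covDeriv1, pd_knEll hx hQ, h]
  simp only [knEll_eq hx hQ, christoffelMat, of_apply, mul_sub, Finset.mul_sum]
  rw [Finset.sum_congr rfl fun c _ => show (christoffel (knMetric p) x c b a : ℂ)
    * (ratioL p x * knFrame p x 0 c)
    = ratioL p x * (knFrame p x 0 c * (christoffel (knMetric p) x c b a : ℂ)) by ring]
  ring

/-- The derivative of the boost factor multiplies ℓ and drops out because ℓ·m = 0. What remains is
the entry N of the connection matrix. -/
theorem sum_covDeriv1_knEll (hx : x ∈ knDomain p) (hQ : 0 < knQ p x) (b : Fin 4) :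
    ∑ a, covDeriv1 (knMetric p) (knEll p) x a b * sharp (knMetric p) (knM p) x a
      = ratioL p x * ratioM p x * connN p x b := by
  have he := knFrame_mul_knCoframe hx
  have h1 : ∑ a, knFrame p x 0 a * (knCoframe p x * nullEta) a 2 = 0 := by
    rw [← Matrix.mul_apply, ← Matrix.mul_assoc, he]
    simp [nullEta]
  have h2 : ∑ a, (knConn p x b * knFrame p x) 0 a * (knCoframe p x * nullEta) a 2
      = -connN p x b := by
    rw [← Matrix.mul_apply, Matrix.mul_assoc, ← Matrix.mul_assoc (knFrame p x), he,
      Matrix.one_mul, Matrix.mul_apply]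
    simp [nullEta, knConn, connMat, Fin.sum_univ_four]
  have h3 : ∀ a, covDeriv1 (knMetric p) (knEll p) x a b * sharp (knMetric p) (knM p) x a
      = ratioM p x * pd b (ratioL p) x * (knFrame p x 0 a * (knCoframe p x * nullEta) a 2)
        - ratioM p x * ratioL p x
          * ((knConn p x b * knFrame p x) 0 a * (knCoframe p x * nullEta) a 2) := by
    intro a
    rw [covDeriv1_knEll hx hQ, sharp_frame hx (knM_eq hx)]; ring
  simp only [h3, Finset.sum_sub_distrib, ← Finset.mul_sum, h1, h2]
  ring

theorem sum_connN_frame (hx : x ∈ knDomain p) (i : Fin 4) :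
    ∑ b, connN p x b * (knCoframe p x * nullEta) b i
      = knXi p x 3 * nullEta 0 i + knXi p x 1 * nullEta 2 i := by
  have h : ∀ k, ∑ b, knFrame p x k b * (knCoframe p x * nullEta) b i = nullEta k i := by
    intro k
    rw [← Matrix.mul_apply, ← Matrix.mul_assoc, knFrame_mul_knCoframe hx, Matrix.one_mul]
  simp only [connN_eq hx, add_mul, mul_assoc, Finset.sum_add_distrib, ← Finset.mul_sum, h]

/-- Evaluating N = ξ₃ℓ + ξ₁m on m̄ selects ξ₁ = -1/ζ. -/
theorem npRho_knMetric (hx : x ∈ knDomain p) (hQ : 0 < knQ p x) :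
    npRho (knMetric p) (knEll p) (knM p) x = ratioL p x / zeta p x := by
  have h2 := mul_inv_cancel₀ (ratioM_ne_zero hx)
  have hz := zeta_ne_zero hx
  rw [npRho, Finset.sum_comm]
  simp only [← Finset.sum_mul, sum_covDeriv1_knEll hx hQ, sharp_frame hx (conjCov_knM_eq hx)]
  have h3 : ∀ b, ratioL p x * ratioM p x * connN p x b
      * ((ratioM p x)⁻¹ * (knCoframe p x * nullEta) b 3)
      = ratioL p x * (connN p x b * (knCoframe p x * nullEta) b 3) := by
    intro b
    linear_combination ratioL p x * connN p x b * (knCoframe p x * nullEta) b 3 * h2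
  simp only [h3, ← Finset.mul_sum, sum_connN_frame hx]
  simp [nullEta, knXi]
  field_simp

/-- Evaluating N on n selects -ξ₃ = -a/ζ, the sign coming from ℓ·n = -1. The boost factors of ℓ and
n cancel. -/
theorem npTau_knMetric (hx : x ∈ knDomain p) (hQ : 0 < knQ p x) :
    npTau (knMetric p) (knEll p) (knN p) (knM p) x = p.a * ratioM p x / zeta p x := by
  have h1 := mul_inv_cancel₀ (ratioL_ne_zero hx hQ)
  have hz := zeta_ne_zero hx
  rw [npTau, Finset.sum_comm]
  simp only [← Finset.sum_mul, sum_covDeriv1_knEll hx hQ, sharp_frame hx (knN_eq hx hQ)]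
  have h3 : ∀ b, ratioL p x * ratioM p x * connN p x b
      * ((ratioL p x)⁻¹ * (knCoframe p x * nullEta) b 1)
      = ratioM p x * (connN p x b * (knCoframe p x * nullEta) b 1) := by
    intro b
    linear_combination ratioM p x * connN p x b * (knCoframe p x * nullEta) b 1 * h1
  simp only [h3, ← Finset.mul_sum, sum_connN_frame hx]
  simp [nullEta, knXi]
  field_simp

theorem knRho_eq (hx : x ∈ knDomain p) (hQ : 0 < knQ p x) :
    knRho p x = ratioL p x / zeta p x := by
  have hz := zeta_ne_zero hx
  have hw := zetaBar_ne_zero hx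
  have hR := ofReal_knR_ne_zero hx
  have h2 := ofReal_sqrt_two_ne_zero
  have hq : (knQ p x : ℂ) ^ (1 / 2 : ℂ) = (Real.sqrt (knQ p x) : ℂ) := by
    rw [Real.sqrt_eq_rpow, Complex.ofReal_cpow hQ.le]; norm_num
  rw [knRho, hq, zetaBar_eq, ratioL]
  push_cast
  field_simp
  rw [knR_sq hx]
  ring

theorem knTau_eq (hx : x ∈ knDomain p) : knTau p x = p.a * ratioM p x / zeta p x := by
  have hz := zeta_ne_zero hx
  have hw := zetaBar_ne_zero hx
  have hR := ofReal_knR_ne_zero hx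
  have h2 := ofReal_sqrt_two_ne_zero
  rw [knTau, zetaBar_eq, ratioM]
  push_cast
  field_simp
  rw [knR_sq hx]
  ring

end NewmanPenrose

end ConformalBH

end

open ConformalBH in
theorem mainTheorem5 (p : Params) (Ω : Set Coords) (hΩ : IsOpen Ω) (hΩp : Ω ⊆ knDomain p)
    (U : Coords → ℝ) (hU : ContDiffOn ℝ ∞ U Ω)
    (g' : MetricField) (hg' : ∀ x ∈ Ω, g' x = Real.exp (2 * U x) • knMetric p x) :
    -- `Ψ₂`, `ρ`, `τ` are the Newman-Penrose scalars of the unrescaled metric in its null tetrad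
    (∀ x ∈ Ω, 0 < knQ p x →
      IsNullTetradAt (knMetric p) (knEll p) (knN p) (knM p) x ∧
      npPsi2 (knMetric p) (knEll p) (knN p) (knM p) x = knPsi2 p x ∧
      npRho (knMetric p) (knEll p) (knM p) x = knRho p x ∧
      npTau (knMetric p) (knEll p) (knN p) (knM p) x = knTau p x) ∧
    -- conformal covariance and the value of `J_ergo`
    (∀ x ∈ Ω, Jergo g' x = Real.exp (-10 * U x) * Jergo (knMetric p) x ∧
      Jergo g' x = Real.exp (-10 * U x) *
        (-4 * (knPsi2 p x ^ 4 * (knRho p x ^ 2 - knTau p x ^ 2)).re)) ∧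
    -- `∂_t` is Killing for the Kerr-NUT-(A)dS metric and conformal Killing for `g'`
    IsKillingOn (knMetric p) dt Ω ∧ IsConformalKillingOn g' dt Ω ∧
    -- `J_ergo` vanishes on the conformal stationary limit surface, which is the stationary limit
    -- surface of the Kerr-NUT-(A)dS metric
    limitSurface g' dt Ω = limitSurface (knMetric p) dt Ω ∧
    (∀ x ∈ limitSurface g' dt Ω, Jergo g' x = 0) := by
  have hJ : ∀ x ∈ Ω, Jergo g' x = Real.exp (-10 * U x) * Jergo (knMetric p) x := fun x hx => by
    rw [Jergo_knMetric (hΩp hx), Jergo_conformal_knMetric hΩ hΩp hU hg' hx]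
  have h00 : ∀ x ∈ Ω, g' x 0 0 = Real.exp (2 * U x) * knMetric p x 0 0 := fun x hx => by
    rw [hg' x hx]; rfl
  -- As ∂_t annihilates the components of g, the Lie derivative of e^{2U}g along ∂_t is 2(∂_t
  -- U)e^{2U}g, which gives the conformal factor used here.
  refine ⟨fun x hx hQ => ⟨isNullTetradAt_knMetric (hΩp hx) hQ, ?_, ?_, ?_⟩,
    fun x hx => ⟨hJ x hx, ?_⟩, fun x hx a b => ?_, ⟨fun x => 2 * pd 0 U x, fun x hx a b => ?_⟩,
    ?_, ?_⟩
  · rw [npPsi2_knMetric (hΩp hx) hQ, knPsi2_eq]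
  · rw [npRho_knMetric (hΩp hx) hQ, knRho_eq (hΩp hx) hQ]
  · rw [npTau_knMetric (hΩp hx) hQ, knTau_eq (hΩp hx)]
  -- The factor -4 is -2 from the type D formula times 2 from ξ·ξ = 2(ρ² - τ²).
  · rw [hJ x hx, Jergo_knMetric (hΩp hx), ← knRho_sq_sub_knTau_sq (hΩp hx), knPsi2_eq,
      mul_left_comm _ (2 : ℂ), ← Complex.ofReal_ofNat, Complex.re_ofReal_mul]
    ring
  · rw [lieMetric_dt, pd_zero_knMetric (hΩp hx)]
  · rw [lieMetric_dt, pd_conformal hΩ hx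
      (fun a b => (contDiffAt_knMetric (hΩp hx) a b).differentiableAt (by simp))
      ((hU.contDiffAt (hΩ.mem_nhds hx)).differentiableAt (by simp)) hg',
      pd_zero_knMetric (hΩp hx), hg' x hx, Matrix.smul_apply, smul_eq_mul]
    ring
  · ext x
    simp only [limitSurface, Set.mem_ofPred_eq, sum_dt]
    refine and_congr_right fun hx => ?_
    rw [h00 x hx, mul_eq_zero, or_iff_right (Real.exp_ne_zero _)]
  · intro x hx
    obtain ⟨hxΩ, h0⟩ := hx
    rw [sum_dt, h00 x hxΩ, mul_eq_zero, or_iff_right (Real.exp_ne_zero _)] at h0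
    -- J_ergo is the real part of a multiple of Q - a²P, which is zero as soon as g_tt is.
    rw [Jergo_conformal_knMetric hΩ hΩp hU hg' hxΩ, knMetric_zero_zero (hΩp hxΩ) h0]
    simp
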